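/- **Setting.** Let $\mathcal A$ be a C*-algebra. A C*-correspondence $X$ over $\mathcal A$ is a right Hilbert $\mathcal A$-module with a nondegenerate left action of $\mathcal A$ by adjointable operators; $\otimes$ denotes the interior tensor product, $X^{\otimes 0}=\mathcal A$, and $\mathcal F(X)=\bigoplus_{n\ge 0}X^{\otimes n}$ is the Fock space. A product system $\mathbb E$ over $\mathbb N_0^2$ consists of two C*-correspondences $E_1,E_2$ over $\mathcal A$ and a unitary bimodule isomorphism $t_{2,1}:E_2\otimes E_1\to E_1\otimes E_2$; put $t_{1,2}=t_{2,1}^{-1}$ and $t_{i,i}=\mathrm{id}$. If $\pi,\rho$ are nondegenerate representations of $\mathcal A$ on Hilbert spaces $\mathcal K,\mathcal L$, an isometric bimodule map $\Theta:X\to B(\mathcal K,\mathcal L)$ is a linear map with $\Theta(a\xi b)=\rho(a)\Theta(\xi)\pi(b)$ and $\Theta(\xi)^*\Theta(\eta)=\pi(\langle\xi,\eta\rangle)$; $\widetilde\Theta:X\otimes_\pi\mathcal K\to\mathcal L$ is the isometry $\widetilde\Theta(\xi\otimes h)=\Theta(\xi)h$. An isometric covariant representation $(\sigma,V^{(1)},V^{(2)})$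 of $\mathbb E$ on a Hilbert space $\mathcal H$ consists of a nondegenerate representation $\sigma$ of $\mathcal A$ on $\mathcal H$ and isometric bimodule maps $V^{(i)}:E_i\to B(\mathcal H)$ with $$\widetilde V^{(2)}(I_{E_2}\otimes\widetilde V^{(1)})=\widetilde V^{(1)}(I_{E_1}\otimes\widetilde V^{(2)})(t_{2,1}\otimes I_{\mathcal H}).$$ Put $E=E_1\otimes E_2$, $\widetilde V=\widetilde V^{(1)}(I_{E_1}\otimes\widetilde V^{(2)}):E\otimes\mathcal H\to\mathcal H$, $\widetilde V_0(a\otimes h)=\sigma(a)h$ and $\widetilde V_{n+1}=\widetilde V(I_E\otimes\widetilde V_n)$. The representation is pure if $\widetilde V_n\widetilde V_n^*\to 0$ in the strong operator topology. Put $$\mathcal W=\mathcal H\ominus\widetilde V(E\otimes\mathcal H),\qquad \mathcal W_i=\mathcal H\ominus\widetilde V^{(i)}(E_i\otimes\mathcal H)\quad(i=1,2).$$ Let $(\rho,S)$ be the representation of $E$ on $\mathcal F(E)\otimes\mathcal W$ induced by $\sigma|_{\mathcal W}$, that is, $\rho(a)=\phi_\infty(a)\otimes I_{\mathcal W}$,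 where $\phi_\infty$ is the left action of $\mathcal A$ on $\mathcal F(E)$, and $S(\xi)(\eta\otimes w)=(\xi\otimes\eta)\otimes w$; put $\widetilde S(\xi\otimes x)=S(\xi)x$ and define $\widetilde S_n$ from $\widetilde S$ as $\widetilde V_n$ from $\widetilde V$. We identify $\mathcal W$ with $\mathcal A\otimes\mathcal W\subseteq\mathcal F(E)\otimes\mathcal W$. Let $t_{i,\mathbf 1}=(I_{E_1}\otimes t_{i,2})(t_{i,1}\otimes I_{E_2}):E_i\otimes E\to E\otimes E_i$ and let $t_{i,\mathbf 1}^{(n)}:E_i\otimes E^{\otimes n}\to E^{\otimes n}\otimes E_i$ be its $n$-fold iterate. For an isometric bimodule map $\Theta:E_i\to B(\mathcal W,\mathcal F(E)\otimes\mathcal W)$, operators $M_\Theta(\xi)$, $\xi\in E_i$, on $\mathcal F(E)\otimes\mathcal W$ are determined by $$M_\Theta(\xi)\,\widetilde S_n(\xi_n\otimes w)=\widetilde S_n(I_{E^{\otimes n}}\otimes\widetilde\Theta)(t_{i,\mathbf 1}^{(n)}\otimes I_{\mathcal W})(\xi\otimes\xi_n\otimes w)\qquad(\xi_n\in E^{\otimes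 n},\ w\in\mathcal W,\ n\ge0).$$ A BCL-representation of $(\sigma,V^{(1)},V^{(2)})$ is an isometric covariant representation $(\rho,M_{\Theta_1},M_{\Theta_2})$ of $\mathbb E$ on $\mathcal F(E)\otimes\mathcal W$, with isometric bimodule maps $\Theta_i:E_i\to B(\mathcal W,\mathcal F(E)\otimes\mathcal W)$, such that $\Pi V^{(i)}(\xi)\Pi^*=M_{\Theta_i}(\xi)$ for $\xi\in E_i$, $i=1,2$, where $\Pi:\mathcal H\to\mathcal F(E)\otimes\mathcal W$ is the Wold–von Neumann unitary: $\Pi\sigma(a)=\rho(a)\Pi$ and $\Pi\widetilde V_n(\eta\otimes w)=\widetilde S_n(\eta\otimes w)$ for $\eta\in E^{\otimes n}$, $w\in\mathcal W$, $n\ge0$. **Theorem.** Let $(\sigma,V^{(1)},V^{(2)})$ be a pure isometric covariant representation of $\mathbb E$ on $\mathcal H$. Then a BCL-representation $(\rho,M_{\Theta_1},M_{\Theta_2})$ of it exists, and every such representation is pure. Moreover $$\mathcal W=\widetilde V^{(2)}(E_2\otimes\mathcal W_1)\oplus\mathcal W_2=\widetilde V^{(1)}(E_1\otimes\mathcal W_2)\oplus\mathcal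 W_1,$$ these orthogonal decompositions induce orthogonal decompositions of $E_1\otimes\mathcal W$ and of $E_2\otimes\mathcal W$, respectively, and with respect to these every BCL-representation satisfies $$\widetilde\Theta_1=\widetilde S\bigl(I_{E_1}\otimes\widetilde V^{(2)*}|_{\widetilde V^{(2)}(E_2\otimes\mathcal W_1)}\bigr)\ \oplus\ \widetilde V^{(1)}|_{E_1\otimes\mathcal W_2},$$ $$\widetilde\Theta_2=\widetilde S(t_{2,1}\otimes I_{\mathcal W})\bigl(I_{E_2}\otimes\widetilde V^{(1)*}|_{\widetilde V^{(1)}(E_1\otimes\mathcal W_2)}\bigr)\ \oplus\ \widetilde V^{(2)}|_{E_2\otimes\mathcal W_1}.$$ That is, $\widetilde\Theta_1$ is given by the first formula on $E_1\otimes\widetilde V^{(2)}(E_2\otimes\mathcal W_1)$ and by $\widetilde V^{(1)}$, with values in $\mathcal W$, on $E_1\otimes\mathcal W_2$; similarly for $\widetilde\Theta_2$. -/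

import Mathlib

open scoped ComplexOrder InnerProductSpace
open Filter Topology

namespace CStarCorr

set_option linter.unusedSectionVars false

universe u v w w₁ w₂ w₃ w₄

section Gram

lemma eq_star_mul_self_of_conj {M : Type*} [NonUnitalCStarAlgebra M]
    (m : M) (hm : IsSelfAdjoint m)
    (h : ∀ X Q : M, star X * m * X = -(star Q * Q) → Q = 0) : ∃ N, m = star N * N := by
  let _ := CStarAlgebra.spectralOrder M
  have _ := CStarAlgebra.spectralOrderedRing M
  have hP : (0 : M) ≤ m⁻ := CFC.negPart_nonneg m
  have hPs : star (m⁻) = m⁻ := (IsSelfAdjoint.of_nonneg hP)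
  have h3 : (0 : M) ≤ m⁻ * m⁻ * m⁻ := by
    have := star_left_conjugate_nonneg hP (m⁻)
    rwa [hPs] at this
  obtain ⟨Q, hQ⟩ := CStarAlgebra.nonneg_iff_eq_star_mul_self.mp h3
  have hMP : star (m⁻) * m * m⁻ = -(star Q * Q) := by
    rw [← hQ, hPs]
    nth_rewrite 2 [← CFC.posPart_sub_negPart m hm]
    simp [mul_sub, CFC.negPart_mul_posPart]
  have hQ0 : Q = 0 := h _ _ hMP
  have h5 : m⁻ * m⁻ * m⁻ = 0 := by rw [hQ, hQ0]; simp
  have h6 : m⁻ * m⁻ = 0 := by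
    rw [← CStarRing.star_mul_self_eq_zero_iff]
    rw [star_mul, hPs, ← mul_assoc, h5, zero_mul]
  have h7 : m⁻ = 0 := by
    rw [← CStarRing.star_mul_self_eq_zero_iff, hPs, h6]
  exact CStarAlgebra.nonneg_iff_eq_star_mul_self.mp ((CFC.negPart_eq_zero_iff m hm).1 h7)

lemma exists_factor {B : Type*} [NonUnitalCStarAlgebra B] [PartialOrder B] [StarOrderedRing B]
    {n : Type*} [Fintype n] (M : n → n → B)
    (hM : ∀ i j, star (M i j) = M j i)
    (h : ∀ v : n → B, 0 ≤ ∑ i, ∑ j, star (v i) * M i j * v j) :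
    ∃ N : n → n → B, ∀ i j, M i j = ∑ k, star (N k i) * N k j := by
  classical
  let m : CStarMatrix n n B := CStarMatrix.ofMatrix (Matrix.of M)
  have hm : ∀ i j, m i j = M i j := fun _ _ => rfl
  have key : ∃ N, m = star N * N := by
    refine eq_star_mul_self_of_conj m ?_ fun X Q hXQ => ?_
    · ext i j
      simp [CStarMatrix.star_apply, hm, hM]
    · ext k j
      have h1 : 0 ≤ (star X * m * X) j j := by
        have := h (fun i => X i j)
        rw [Finset.sum_comm] at this
        simpa [CStarMatrix.mul_apply, CStarMatrix.star_apply, Finset.sum_mul, hm] using this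
      rw [hXQ, CStarMatrix.neg_apply] at h1
      have h2 : (star Q * Q) j j = ∑ k, star (Q k j) * Q k j := by
        simp [CStarMatrix.mul_apply, CStarMatrix.star_apply]
      rw [h2] at h1
      have h4 : ∑ k, star (Q k j) * Q k j = 0 :=
        le_antisymm (by simpa using h1) (Finset.sum_nonneg fun _ _ => star_mul_self_nonneg _)
      have := (Finset.sum_eq_zero_iff_of_nonneg
        (fun _ _ => star_mul_self_nonneg _)).1 h4 k (Finset.mem_univ k)
      simpa using (CStarRing.star_mul_self_eq_zero_iff _).1 this
  obtain ⟨N, hN⟩ := key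
  refine ⟨N, fun i j => ?_⟩
  rw [← hm, hN]
  simp [CStarMatrix.mul_apply, CStarMatrix.star_apply]


lemma cauchy_schwarz {B V : Type*} [NonUnitalCStarAlgebra B] [PartialOrder B] [StarOrderedRing B]
    [AddCommGroup V] [Module ℂ V] (F : V →ₗ⋆[ℂ] V →ₗ[ℂ] B) (r : B → V → V)
    (hs : ∀ x y, star (F x y) = F y x) (hn : ∀ x, 0 ≤ F x x)
    (hr : ∀ x y b, F x (r b y) = F x y * b) (x y : V) :
    ‖F x y‖ ^ 2 ≤ ‖F x x‖ * ‖F y y‖ := by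
  set b := F x y with hb
  have key : ∀ t : ℝ, ‖F x x‖ ≤ t → ‖b‖ ^ 2 * t ≤ t ^ 2 * ‖F y y‖ := by
    intro t ht
    have ht0 : 0 ≤ t := (norm_nonneg _).trans ht
    have h1 := hn (r b x - (t : ℂ) • y)
    have hyx : F y x = star b := by rw [hb, hs]
    have h2 : F (r b x) y = star b * b := by rw [← hs, hr, hyx, star_mul, star_star]
    have h3 : F (r b x) (r b x) = star b * F x x * b := by
      rw [hr, ← hs, hr, star_mul, hs x x]
    have h4 : star b * F x x * b ≤ t • (star b * b) :=
      (CStarAlgebra.star_left_conjugate_le_norm_smul (hb := (hs x x : star _ = _))).trans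
        (smul_le_smul_of_nonneg_right ht (star_mul_self_nonneg b))
    have h5 : F (r b x - (t : ℂ) • y) (r b x - (t : ℂ) • y) =
        star b * F x x * b - t • (star b * b) - t • (star b * b) + t ^ 2 • F y y := by
      simp only [map_sub, LinearMap.sub_apply, LinearMap.map_smulₛₗ, RingHom.id_apply,
        LinearMap.smul_apply, h2, h3, hr, hyx, Complex.conj_ofReal, sq, mul_smul]
      simp only [Complex.coe_smul]
      module
    have h6 : t • (star b * b) ≤ t ^ 2 • F y y := by
      rw [h5] at h1
      rw [← sub_nonneg] at h4 ⊢
      convert add_nonneg h1 h4 using 1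
      abel
    have h7 := CStarAlgebra.norm_le_norm_of_nonneg_of_le
      (smul_nonneg ht0 (star_mul_self_nonneg b)) h6
    rw [norm_smul, norm_smul, CStarRing.norm_star_mul_self] at h7
    simp only [Real.norm_eq_abs, abs_of_nonneg ht0, abs_of_nonneg (sq_nonneg t)] at h7
    nlinarith
  refine le_of_forall_pos_le_add fun ε hε => ?_
  have hy := norm_nonneg (F y y)
  have hx := norm_nonneg (F x x)
  obtain ⟨t, ht, ht', ht0⟩ : ∃ t, ‖F x x‖ ≤ t ∧ t * ‖F y y‖ ≤ ‖F x x‖ * ‖F y y‖ + ε ∧ 0 < t := by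
    refine ⟨‖F x x‖ + ε / (‖F y y‖ + 1), le_add_of_nonneg_right (by positivity), ?_, by positivity⟩
    rw [add_mul]
    gcongr
    rw [div_mul_eq_mul_div, div_le_iff₀ (by positivity)]
    nlinarith
  refine le_trans ?_ ht'
  have := key t ht
  rw [sq t, mul_assoc, mul_comm] at this
  exact le_of_mul_le_mul_left this ht0

lemma exists_root {A : Type*} [NonUnitalCStarAlgebra A] (a : A) :
    ∃ b : A, star b = b ∧ (2 * ‖a‖) • b - b * b = star a * a := by
  have hsa : IsSelfAdjoint (star a * a) := IsSelfAdjoint.star_mul_self a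
  set f : ℝ → ℝ := fun x => ‖a‖ - √(‖a‖ ^ 2 - x) with hf
  have hfc : Continuous f := by fun_prop
  have hf0 : f 0 = 0 := by simp [hf]
  refine ⟨cfcₙ f (star a * a), cfcₙ_predicate (p := IsSelfAdjoint) f (star a * a), ?_⟩
  have hid : star a * a = cfcₙ (id : ℝ → ℝ) (star a * a) := (cfcₙ_id ℝ (star a * a)).symm
  have hfc' : ContinuousOn f (quasispectrum ℝ (star a * a)) := hfc.continuousOn
  rw [← cfcₙ_mul f f (star a * a) hfc' hf0 hfc' hf0,
    ← cfcₙ_const_mul (2 * ‖a‖) f (star a * a) hfc' hf0,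
    ← cfcₙ_sub (fun x => 2 * ‖a‖ * f x) (fun x => f x * f x) (star a * a)
      (hfc'.const_mul _) (by rw [hf0, mul_zero]) (hfc'.mul hfc') (by rw [hf0, mul_zero])]
  conv_rhs => rw [hid]
  refine cfcₙ_congr fun x hx => ?_
  have h1 : ‖x‖ ≤ ‖star a * a‖ :=
    NonUnitalIsometricContinuousFunctionalCalculus.norm_quasispectrum_le (star a * a) hx hsa
  rw [CStarRing.norm_star_mul_self, ← sq] at h1
  have h2 : 0 ≤ ‖a‖ ^ 2 - x := sub_nonneg.2 ((le_abs_self x).trans h1)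
  have h3 := Real.sq_sqrt h2
  simp only [hf, id]
  nlinarith

end Gram

/-- A (right) Hilbert `B`-module with a nondegenerate left action of `A` by adjointable operators,
i.e. a nondegenerate C*-correspondence from `A` to `B`.  The inner product `ip` is `B`-valued,
linear in the second variable; `rs x b` is the right action `x · b` and `ls a x` the left action
`φ(a) x`.  (Mathlib's `CStarModule` uses the left-module convention `⟨x, a • y⟩ = a * ⟨x, y⟩` and is
not suited here.)  The remaining bimodule laws are consequences of the fields.  For `B = ℂ` this
is a Hilbert space carrying a nondegenerate `*`-representation of `A`. -/
structure Corr (A : Type u) (B : Type v) [NonUnitalCStarAlgebra A] [NonUnitalCStarAlgebra B]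
    [PartialOrder B] : Type (max u v (w + 1)) where
  carrier : Type w
  [grp : NormedAddCommGroup carrier]
  [spc : NormedSpace ℂ carrier]
  [cpl : CompleteSpace carrier]
  ip : carrier → carrier → B
  rs : carrier → B → carrier
  ls : A → carrier → carrier
  ip_add : ∀ x y z, ip x (y + z) = ip x y + ip x z
  ip_smul : ∀ (c : ℂ) x y, ip x (c • y) = c • ip x y
  star_ip : ∀ x y, star (ip x y) = ip y x
  ip_rs : ∀ x y b, ip x (rs y b) = ip x y * b
  ip_nonneg : ∀ x, 0 ≤ ip x x
  norm_sq : ∀ x, ‖x‖ ^ 2 = ‖ip x x‖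
  add_ls : ∀ a a' x, ls (a + a') x = ls a x + ls a' x
  smul_ls : ∀ (c : ℂ) a x, ls (c • a) x = c • ls a x
  mul_ls : ∀ a a' x, ls (a * a') x = ls a (ls a' x)
  ip_ls : ∀ a x y, ip (ls a x) y = ip x (ls (star a) y)
  nondeg : closure (Submodule.span ℂ {y | ∃ a x, y = ls a x} : Set carrier) = Set.univ

attribute [instance] Corr.grp Corr.spc Corr.cpl

instance {A : Type u} {B : Type v} [NonUnitalCStarAlgebra A] [NonUnitalCStarAlgebra B]
    [PartialOrder B] : CoeSort (Corr.{u, v, w} A B) (Type w) := ⟨Corr.carrier⟩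

namespace Corr

variable {A : Type u} {B : Type v} [NonUnitalCStarAlgebra A] [NonUnitalCStarAlgebra B]
  [PartialOrder B] (X : Corr.{u, v, w} A B)

/-- The inner product as a sesquilinear map. -/
def ipL : X →ₗ⋆[ℂ] X →ₗ[ℂ] B where
  toFun x := ⟨⟨X.ip x, X.ip_add x⟩, fun c y => X.ip_smul c x y⟩
  map_add' x y := by
    ext z
    simp only [LinearMap.coe_mk, AddHom.coe_mk, LinearMap.add_apply]
    rw [← X.star_ip, X.ip_add, star_add, X.star_ip, X.star_ip]
  map_smul' c x := by
    ext z
    simp only [LinearMap.coe_mk, AddHom.coe_mk, LinearMap.smul_apply]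
    rw [← X.star_ip, X.ip_smul, star_smul, X.star_ip]; rfl

lemma ipL_apply (x y : X) : X.ipL x y = X.ip x y := rfl

lemma add_ip (x y z : X) : X.ip (x + y) z = X.ip x z + X.ip y z := by simp [← ipL_apply]
lemma smul_ip (c : ℂ) (x y : X) : X.ip (c • x) y = star c • X.ip x y := by simp [← ipL_apply]
lemma ip_sub (x y z : X) : X.ip x (y - z) = X.ip x y - X.ip x z := by simp [← ipL_apply]
lemma sub_ip (x y z : X) : X.ip (x - y) z = X.ip x z - X.ip y z := by simp [← ipL_apply]
@[simp] lemma ip_zero (x : X) : X.ip x 0 = 0 := by simp [← ipL_apply]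
@[simp] lemma zero_ip (x : X) : X.ip 0 x = 0 := by simp [← ipL_apply]

lemma ip_ls' (a : A) (x y : X) : X.ip x (X.ls a y) = X.ip (X.ls (star a) x) y := by
  rw [X.ip_ls, star_star]

lemma rs_ip (x y : X) (b : B) : X.ip (X.rs x b) y = star b * X.ip x y := by
  rw [← X.star_ip, X.ip_rs, star_mul, X.star_ip]

lemma eq_of_ip {x y : X} (h : ∀ z, X.ip z x = X.ip z y) : x = y := by
  have h1 : X.ip (x - y) (x - y) = 0 := by rw [X.ip_sub, h, sub_self]
  have h2 := X.norm_sq (x - y)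
  rw [h1, norm_zero, sq_eq_zero_iff, norm_eq_zero, sub_eq_zero] at h2
  exact h2

lemma ls_add (a : A) (x y : X) : X.ls a (x + y) = X.ls a x + X.ls a y :=
  X.eq_of_ip fun z => by simp only [ip_ls', X.ip_add]

lemma ls_smul (a : A) (c : ℂ) (x : X) : X.ls a (c • x) = c • X.ls a x :=
  X.eq_of_ip fun z => by simp only [ip_ls', X.ip_smul]

lemma rs_add (x y : X) (b : B) : X.rs (x + y) b = X.rs x b + X.rs y b :=
  X.eq_of_ip fun z => by simp only [X.ip_rs, X.ip_add, add_mul]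

lemma add_rs (x : X) (b c : B) : X.rs x (b + c) = X.rs x b + X.rs x c :=
  X.eq_of_ip fun z => by simp only [X.ip_rs, X.ip_add, mul_add]

lemma rs_mul (x : X) (b c : B) : X.rs x (b * c) = X.rs (X.rs x b) c :=
  X.eq_of_ip fun z => by simp only [X.ip_rs, mul_assoc]

lemma ls_rs (a : A) (x : X) (b : B) : X.ls a (X.rs x b) = X.rs (X.ls a x) b :=
  X.eq_of_ip fun z => by simp only [X.ip_rs, ip_ls']

/-- For the left action of a fixed `a`, the defect `‖a‖² ⟨x, y⟩ - ⟨a x, a y⟩` is again of the form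
`⟨D x, D y⟩`. -/
lemma exists_defect (a : A) :
    ∃ D : X → X, ∀ x y, X.ip (X.ls a x) (X.ls a y) + X.ip (D x) (D y) = ‖a‖ ^ 2 • X.ip x y := by
  obtain ⟨b, hb, hab⟩ := exists_root a
  refine ⟨fun x => (‖a‖ : ℂ) • x - X.ls b x, fun x y => ?_⟩
  have h1 : X.ip (X.ls a x) (X.ls a y) = (2 * ‖a‖) • X.ip x (X.ls b y) - X.ip x (X.ls (b * b) y) := by
    rw [X.ip_ls, ← X.mul_ls, ← hab]
    have : (2 * ‖a‖) • b - b * b = ((2 * ‖a‖ : ℝ) : ℂ) • b + (-1 : ℂ) • (b * b) := by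
      rw [Complex.coe_smul]; module
    rw [this, X.add_ls, X.smul_ls, X.smul_ls, X.ip_add, X.ip_smul, X.ip_smul, Complex.coe_smul]
    module
  have h2 : X.ip (X.ls b x) y = X.ip x (X.ls b y) := by rw [X.ip_ls, hb]
  have h3 : X.ip (X.ls b x) (X.ls b y) = X.ip x (X.ls (b * b) y) := by
    rw [X.ip_ls, hb, X.mul_ls]
  simp only [h1, X.ip_sub, X.sub_ip, X.ip_smul, X.smul_ip, h2, h3, Complex.star_def,
    Complex.conj_ofReal]
  simp only [Complex.coe_smul]
  module

variable [StarOrderedRing B]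

lemma norm_ip_le (x y : X) : ‖X.ip x y‖ ≤ ‖x‖ * ‖y‖ := by
  have := cauchy_schwarz X.ipL (fun b x => X.rs x b) X.star_ip X.ip_nonneg
    (fun x y b => X.ip_rs x y b) x y
  simp only [ipL_apply] at this
  rw [← X.norm_sq, ← X.norm_sq, ← mul_pow] at this
  exact (pow_le_pow_iff_left₀ (norm_nonneg _) (by positivity) two_ne_zero).1 this

lemma continuous_ip : Continuous fun p : X × X => X.ip p.1 p.2 := by
  have : ∀ p : X × X, X.ip p.1 p.2 =
      LinearMap.mkContinuous₂ X.ipL 1 (fun x y => by simpa [ipL_apply] using X.norm_ip_le x y) p.1 p.2 :=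
    fun _ => rfl
  simp_rw [this]
  fun_prop

lemma norm_ls_le (a : A) (x : X) : ‖X.ls a x‖ ≤ ‖a‖ * ‖x‖ := by
  obtain ⟨D, hD⟩ := X.exists_defect a
  rw [← pow_le_pow_iff_left₀ (norm_nonneg _) (by positivity) two_ne_zero, mul_pow, X.norm_sq,
    X.norm_sq]
  have := CStarAlgebra.norm_le_norm_of_nonneg_of_le (X.ip_nonneg (X.ls a x))
    (le_add_of_nonneg_right (X.ip_nonneg (D x)) |>.trans_eq (hD x x))
  simpa [norm_smul] using this

/-- The left action of `a` as a bounded operator. -/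
noncomputable def lsL (a : A) : X →L[ℂ] X :=
  LinearMap.mkContinuous ⟨⟨X.ls a, X.ls_add a⟩, fun c x => X.ls_smul a c x⟩ ‖a‖ (X.norm_ls_le a)

@[simp] lemma lsL_apply (a : A) (x : X) : X.lsL a x = X.ls a x := rfl

lemma exists_near (x : X) {ε : ℝ} (hε : 0 < ε) : ∃ a, ‖X.ls a x - x‖ < ε := by
  let _ := CStarAlgebra.spectralOrder A
  have _ := CStarAlgebra.spectralOrderedRing A
  have hl := CStarAlgebra.increasingApproximateUnit A
  set l := CStarAlgebra.approximateUnit A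
  have key : ∀ y ∈ Submodule.span ℂ {y | ∃ a x, y = X.ls a x},
      Tendsto (fun e => X.ls e y) l (𝓝 y) := by
    intro y hy
    induction hy using Submodule.span_induction with
    | mem y hy =>
      obtain ⟨a, z, rfl⟩ := hy
      simp only [← X.mul_ls]
      rw [tendsto_iff_norm_sub_tendsto_zero]
      have h1 := (tendsto_iff_norm_sub_tendsto_zero.1 (hl.tendsto_mul_right a)).mul_const ‖z‖
      rw [zero_mul] at h1
      refine squeeze_zero (fun _ => norm_nonneg _) (fun e => ?_) h1
      have : X.ls (e * a) z - X.ls a z = X.ls (e * a - a) z := by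
        have h2 : e * a - a = e * a + (-1 : ℂ) • a := by simp [sub_eq_add_neg]
        rw [h2, X.add_ls, X.smul_ls]; simp [sub_eq_add_neg]
      rw [this]
      exact X.norm_ls_le _ _
    | zero => simp [← lsL_apply]
    | add y z _ _ hy hz => simpa [X.ls_add] using hy.add hz
    | smul c y _ hy => simpa [X.ls_smul] using hy.const_smul c
  have hx : x ∈ closure (Submodule.span ℂ {y | ∃ a x, y = X.ls a x} : Set X) := by
    rw [X.nondeg]; trivial
  obtain ⟨y, hy, hxy⟩ := Metric.mem_closure_iff.1 hx (ε / 3) (by positivity)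
  have h1 := Metric.tendsto_nhds.1 (key y hy) (ε / 3) (by positivity)
  obtain ⟨e, he, he1⟩ := (h1.and hl.eventually_norm).exists
  refine ⟨e, ?_⟩
  have h2 : X.ls e x - x = (X.ls e y - y) + X.ls e (x - y) - (x - y) := by
    simp only [← lsL_apply, map_sub]; abel
  rw [dist_eq_norm] at he hxy
  have h3 := X.norm_ls_le e (x - y)
  have h4 : ‖X.ls e (x - y)‖ ≤ ‖x - y‖ := h3.trans (mul_le_of_le_one_left (norm_nonneg _) he1)
  rw [h2]
  have h5 := norm_sub_le ((X.ls e y - y) + X.ls e (x - y)) (x - y)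
  have h6 := norm_add_le (X.ls e y - y) (X.ls e (x - y))
  linarith

end Corr

/-- Data generating a C*-correspondence: a `B`-valued positive definite kernel on a set `G` with a
right multiplication by `B` and a left multiplication by `A`. -/
structure Ker (A : Type u) (B : Type v) [NonUnitalCStarAlgebra A] [NonUnitalCStarAlgebra B]
    [PartialOrder B] : Type (max u v (w + 1)) where
  G : Type w
  K : G → G → B
  r : G → B → G
  l : A → G → G
  star_K : ∀ g h, star (K g h) = K h g
  psd : ∀ (s : Finset G) (c : G → ℂ), 0 ≤ ∑ g ∈ s, ∑ h ∈ s, (star (c g) * c h) • K g h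
  K_r : ∀ g h b, K g (r h b) = K g h * b
  K_l : ∀ a g h, K (l a g) h = K g (l (star a) h)
  K_add : ∀ a a' g h, K g (l (a + a') h) = K g (l a h) + K g (l a' h)
  K_smul : ∀ (c : ℂ) a g h, K g (l (c • a) h) = c • K g (l a h)
  K_mul : ∀ a a' g h, K g (l (a * a') h) = K g (l a (l a' h))
  bound : ∀ a (s : Finset G) (c : G → ℂ), ∑ g ∈ s, ∑ h ∈ s, (star (c g) * c h) • K (l a g) (l a h)
    ≤ ‖a‖ ^ 2 • ∑ g ∈ s, ∑ h ∈ s, (star (c g) * c h) • K g h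
  near : ∀ g (ε : ℝ), 0 < ε → ∃ a, ‖K (l a g) (l a g) - K (l a g) g - K g (l a g) + K g g‖ < ε

namespace Ker

variable {A : Type u} {B : Type v} [NonUnitalCStarAlgebra A] [NonUnitalCStarAlgebra B]
  [PartialOrder B] (k : Ker.{u, v, w} A B)

/-- Finite formal linear combinations of elements of `G`. -/
abbrev Pre : Type w := k.G →₀ ℂ

/-- The basis element given by `g`. -/
noncomputable def of (g : k.G) : k.Pre := Finsupp.single g 1

lemma single_eq (g : k.G) (c : ℂ) : (Finsupp.single g c : k.Pre) = c • k.of g := by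
  simp [of]

lemma pre_induction {p : k.Pre → Prop} (x : k.Pre) (h0 : p 0)
    (hadd : ∀ x y, p x → p y → p (x + y)) (hof : ∀ (c : ℂ) g, p (c • k.of g)) : p x := by
  refine Finsupp.induction_linear (motive := p) x h0 hadd fun g c => ?_
  rw [single_eq]; exact hof c g

/-- The sesquilinear extension of the kernel. -/
noncomputable def form : k.Pre →ₗ⋆[ℂ] k.Pre →ₗ[ℂ] B where
  toFun c := c.sum fun g z => star z • (Finsupp.linearCombination ℂ (k.K g) : k.Pre →ₗ[ℂ] B)
  map_add' c d := Finsupp.sum_add_index' (fun _ => by simp) (fun _ _ _ => by simp [add_smul])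
  map_smul' z c := by
    refine (Finsupp.sum_smul_index' (fun _ => by simp)).trans ?_
    simp [Finsupp.smul_sum, mul_smul]

@[simp] lemma form_of (g h : k.G) : k.form (k.of g) (k.of h) = k.K g h := by
  simp [form, of, Finsupp.sum_single_index]

lemma form_apply (x y : k.Pre) : k.form x y = ∑ g ∈ x.support, ∑ h ∈ y.support,
    (star (x g) * y h) • k.K g h := by
  simp [form, Finsupp.sum, LinearMap.sum_apply, Finsupp.linearCombination_apply, Finset.smul_sum,
    mul_smul]

lemma form_self_nonneg (x : k.Pre) : 0 ≤ k.form x x := by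
  rw [form_apply]; exact k.psd _ _

lemma star_form (x y : k.Pre) : star (k.form x y) = k.form y x := by
  induction x using k.pre_induction with
  | h0 => simp
  | hadd x x' hx hx' => simp [hx, hx']
  | hof c g =>
    induction y using k.pre_induction with
    | h0 => simp
    | hadd y y' hy hy' => simp_all
    | hof d h => simp [k.star_K, smul_comm c]

/-- Right multiplication on formal combinations. -/
noncomputable def rPre (b : B) : k.Pre →ₗ[ℂ] k.Pre := Finsupp.lmapDomain ℂ ℂ (fun g => k.r g b)

/-- Left multiplication on formal combinations. -/
noncomputable def lPre (a : A) : k.Pre →ₗ[ℂ] k.Pre := Finsupp.lmapDomain ℂ ℂ (k.l a)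

@[simp] lemma rPre_of (b : B) (g : k.G) : k.rPre b (k.of g) = k.of (k.r g b) :=
  Finsupp.mapDomain_single

@[simp] lemma lPre_of (a : A) (g : k.G) : k.lPre a (k.of g) = k.of (k.l a g) :=
  Finsupp.mapDomain_single

lemma form_ext {P Q : k.Pre →ₗ⋆[ℂ] k.Pre →ₗ[ℂ] B}
    (h : ∀ g g', P (k.of g) (k.of g') = Q (k.of g) (k.of g')) (x y : k.Pre) : P x y = Q x y := by
  induction x using k.pre_induction with
  | h0 => simp
  | hadd x x' hx hx' => simp [hx, hx']
  | hof c g =>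
    induction y using k.pre_induction with
    | h0 => simp
    | hadd y y' hy hy' => simp_all
    | hof d h' => simp [h]

lemma form_rPre (x y : k.Pre) (b : B) : k.form x (k.rPre b y) = k.form x y * b := by
  induction x using k.pre_induction with
  | h0 => simp
  | hadd x x' hx hx' => simp [hx, hx', add_mul]
  | hof c g =>
    induction y using k.pre_induction with
    | h0 => simp
    | hadd y y' hy hy' => simp_all [add_mul]
    | hof d h => simp [k.K_r, smul_mul_assoc]

lemma form_lPre (x y : k.Pre) (a : A) :
    k.form (k.lPre a x) y = k.form x (k.lPre (star a) y) :=
  k.form_ext (P := k.form ∘ₛₗ k.lPre a)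
    (Q := k.form.compl₂ (k.lPre (star a))) (by simp [k.K_l]) x y

lemma form_lPre_self_le (x : k.Pre) (a : A) :
    k.form (k.lPre a x) (k.lPre a x) ≤ ‖a‖ ^ 2 • k.form x x := by
  have h := k.bound a x.support x
  rw [form_apply k x x]
  refine le_of_eq_of_le ?_ h
  have hx : x = ∑ g ∈ x.support, x g • k.of g := by
    conv_lhs => rw [← Finsupp.sum_single x]
    exact Finset.sum_congr rfl fun g _ => k.single_eq g _
  conv_lhs => rw [hx]
  simp only [map_sum, LinearMap.sum_apply, LinearMap.map_smulₛₗ, LinearMap.smul_apply, map_smul,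
    lPre_of, form_of, mul_smul]
  simp only [Finset.smul_sum]
  rw [Finset.sum_comm]
  refine Finset.sum_congr rfl fun g _ => Finset.sum_congr rfl fun h _ => ?_
  rw [smul_comm]; rfl

lemma form_add_lPre (x y : k.Pre) (a a' : A) :
    k.form x (k.lPre (a + a') y) = k.form x (k.lPre a y + k.lPre a' y) :=
  k.form_ext (P := k.form.compl₂ (k.lPre (a + a'))) (Q := k.form.compl₂ (k.lPre a + k.lPre a'))
    (by simp [k.K_add]) x y

lemma form_smul_lPre (x y : k.Pre) (c : ℂ) (a : A) :
    k.form x (k.lPre (c • a) y) = k.form x (c • k.lPre a y) :=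
  k.form_ext (P := k.form.compl₂ (k.lPre (c • a))) (Q := k.form.compl₂ (c • k.lPre a))
    (by simp [k.K_smul]) x y

lemma form_mul_lPre (x y : k.Pre) (a a' : A) :
    k.form x (k.lPre (a * a') y) = k.form x (k.lPre a (k.lPre a' y)) :=
  k.form_ext (P := k.form.compl₂ (k.lPre (a * a'))) (Q := k.form.compl₂ (k.lPre a ∘ₗ k.lPre a'))
    (by simp [k.K_mul]) x y

noncomputable instance : Norm k.Pre := ⟨fun x => √‖k.form x x‖⟩

lemma pre_norm_sq (x : k.Pre) : ‖x‖ ^ 2 = ‖k.form x x‖ := by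
  change √‖k.form x x‖ ^ 2 = _; simp

lemma pre_norm_nonneg (x : k.Pre) : 0 ≤ ‖x‖ := Real.sqrt_nonneg _

variable [StarOrderedRing B]

lemma norm_form_le (x y : k.Pre) : ‖k.form x y‖ ≤ ‖x‖ * ‖y‖ := by
  have := cauchy_schwarz k.form (fun b => k.rPre b) k.star_form k.form_self_nonneg
    (fun x y b => k.form_rPre x y b) x y
  rw [← pre_norm_sq, ← pre_norm_sq, ← mul_pow] at this
  exact (pow_le_pow_iff_left₀ (norm_nonneg _)
    (mul_nonneg (pre_norm_nonneg k x) (pre_norm_nonneg k y)) two_ne_zero).1 this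

lemma pre_core : SeminormedSpace.Core ℂ k.Pre where
  norm_nonneg := k.pre_norm_nonneg
  norm_smul c x := by
    rw [← pow_left_inj₀ (k.pre_norm_nonneg _)
      (mul_nonneg (norm_nonneg c) (k.pre_norm_nonneg _)) two_ne_zero, mul_pow, pre_norm_sq,
      pre_norm_sq]
    simp [norm_smul, sq, mul_assoc]
  norm_triangle x y := by
    rw [← pow_le_pow_iff_left₀ (k.pre_norm_nonneg _)
      (add_nonneg (k.pre_norm_nonneg _) (k.pre_norm_nonneg _)) two_ne_zero, pre_norm_sq]
    have h : k.form (x + y) (x + y) = k.form x x + k.form x y + (k.form y x + k.form y y) := by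
      simp
    rw [h]
    have h1 := norm_add_le (k.form x x + k.form x y) (k.form y x + k.form y y)
    have h2 := norm_add_le (k.form x x) (k.form x y)
    have h3 := norm_add_le (k.form y x) (k.form y y)
    have := k.norm_form_le x y
    have := k.norm_form_le y x
    have := k.pre_norm_sq x
    have := k.pre_norm_sq y
    nlinarith

noncomputable instance : SeminormedAddCommGroup k.Pre := SeminormedAddCommGroup.ofCore k.pre_core

noncomputable instance : NormedSpace ℂ k.Pre where
  norm_smul_le c x := (k.pre_core.norm_smul c x).le


lemma norm_rPre_le (b : B) (x : k.Pre) : ‖k.rPre b x‖ ≤ ‖b‖ * ‖x‖ := by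
  rw [← pow_le_pow_iff_left₀ (norm_nonneg _) (by positivity) two_ne_zero, mul_pow, pre_norm_sq,
    pre_norm_sq, form_rPre, ← star_form, form_rPre, star_mul, k.star_form x x]
  calc _ ≤ ‖star b‖ * ‖k.form x x‖ * ‖b‖ := norm_mul₃_le
    _ = _ := by rw [norm_star]; ring

lemma norm_lPre_le (a : A) (x : k.Pre) : ‖k.lPre a x‖ ≤ ‖a‖ * ‖x‖ := by
  rw [← pow_le_pow_iff_left₀ (norm_nonneg _) (by positivity) two_ne_zero, mul_pow, pre_norm_sq,
    pre_norm_sq]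
  have := CStarAlgebra.norm_le_norm_of_nonneg_of_le (k.form_self_nonneg _)
    (k.form_lPre_self_le x a)
  simpa [norm_smul] using this

/-- The form as a bounded sesquilinear map. -/
noncomputable def formL : k.Pre →L⋆[ℂ] k.Pre →L[ℂ] B :=
  LinearMap.mkContinuous₂ k.form 1 fun x y => by simpa using k.norm_form_le x y

/-- The Hilbert module: the (separated) completion of `k.Pre`. -/
abbrev Cpl : Type w := UniformSpace.Completion k.Pre

/-- The inner product on the completion, as a bounded sesquilinear map. -/
noncomputable def ipC : k.Cpl →L⋆[ℂ] k.Cpl →L[ℂ] B :=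
  (ContinuousLinearMap.fromCompletion
    ((ContinuousLinearMap.fromCompletion k.formL).flip)).flip

@[simp] lemma ipC_coe (x y : k.Pre) : k.ipC x y = k.form x y := by
  simp [ipC, formL]

/-- The left action on the completion. -/
noncomputable def lC (a : A) : k.Cpl →L[ℂ] k.Cpl :=
  ((k.lPre a).mkContinuous ‖a‖ (k.norm_lPre_le a)).completion

/-- The right action on the completion. -/
noncomputable def rC (b : B) : k.Cpl →L[ℂ] k.Cpl :=
  ((k.rPre b).mkContinuous ‖b‖ (k.norm_rPre_le b)).completion

@[simp] lemma lC_coe (a : A) (x : k.Pre) : k.lC a (x : k.Cpl) = (k.lPre a x : k.Pre) := by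
  simp [lC]

@[simp] lemma rC_coe (b : B) (x : k.Pre) : k.rC b (x : k.Cpl) = (k.rPre b x : k.Pre) := by
  simp [rC]

lemma ipC_norm_sq (x : k.Cpl) : ‖x‖ ^ 2 = ‖k.ipC x x‖ := by
  refine UniformSpace.Completion.induction_on x (isClosed_eq (by fun_prop) (by fun_prop)) ?_
  intro x; rw [ipC_coe, UniformSpace.Completion.norm_coe, pre_norm_sq]

lemma star_ipC (x y : k.Cpl) : star (k.ipC x y) = k.ipC y x := by
  refine UniformSpace.Completion.induction_on₂ x y (isClosed_eq (by fun_prop) (by fun_prop)) ?_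
  intro x y; simp [star_form]

lemma ipC_rC (x y : k.Cpl) (b : B) : k.ipC x (k.rC b y) = k.ipC x y * b := by
  refine UniformSpace.Completion.induction_on₂ x y (isClosed_eq (by fun_prop) (by fun_prop)) ?_
  intro x y; simp [form_rPre]

lemma ipC_lC (x y : k.Cpl) (a : A) : k.ipC (k.lC a x) y = k.ipC x (k.lC (star a) y) := by
  refine UniformSpace.Completion.induction_on₂ x y (isClosed_eq (by fun_prop) (by fun_prop)) ?_
  intro x y; simp [form_lPre]

lemma ipC_nonneg (x : k.Cpl) : 0 ≤ k.ipC x x := by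
  refine UniformSpace.Completion.induction_on x
    (CStarAlgebra.isClosed_nonneg.preimage (by fun_prop)) ?_
  intro x; simpa using k.form_self_nonneg x

lemma eq_of_ipC {x y : k.Cpl} (h : ∀ z : k.Pre, k.ipC z x = k.ipC z y) : x = y := by
  have h1 : ∀ z, k.ipC z x = k.ipC z y := fun z =>
    UniformSpace.Completion.induction_on z (isClosed_eq (by fun_prop) (by fun_prop)) h
  have h2 := k.ipC_norm_sq (x - y)
  rw [map_sub, h1 (x - y), sub_self, norm_zero, sq_eq_zero_iff, norm_eq_zero, sub_eq_zero] at h2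
  exact h2

/-- The class of a generator in the completion. -/
noncomputable def cls (g : k.G) : k.Cpl := (k.of g : k.Pre)

@[simp] lemma ipC_mk (g h : k.G) : k.ipC (k.cls g) (k.cls h) = k.K g h := by simp [cls]
@[simp] lemma lC_mk (a : A) (g : k.G) : k.lC a (k.cls g) = k.cls (k.l a g) := by simp [cls]
@[simp] lemma rC_mk (b : B) (g : k.G) : k.rC b (k.cls g) = k.cls (k.r g b) := by simp [cls]

lemma coe_mem_span (x : k.Pre) : (x : k.Cpl) ∈ Submodule.span ℂ (Set.range k.cls) := by
  induction x using k.pre_induction with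
  | h0 => rw [UniformSpace.Completion.coe_zero]; exact zero_mem _
  | hadd x y hx hy => rw [UniformSpace.Completion.coe_add]; exact add_mem hx hy
  | hof c g =>
    rw [UniformSpace.Completion.coe_smul]
    exact Submodule.smul_mem _ _ (Submodule.subset_span ⟨g, rfl⟩)

lemma closure_span_mk : closure (Submodule.span ℂ (Set.range k.cls) : Set k.Cpl) = Set.univ := by
  rw [← dense_iff_closure_eq]
  refine (UniformSpace.Completion.denseRange_coe (α := k.Pre)).mono ?_
  rintro _ ⟨x, rfl⟩
  exact k.coe_mem_span x

lemma closure_span_lC :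
    closure (Submodule.span ℂ {y | ∃ a x, y = k.lC a x} : Set k.Cpl) = Set.univ := by
  set S := Submodule.span ℂ {y | ∃ a x, y = k.lC a x}
  have h : Submodule.span ℂ (Set.range k.cls) ≤ S.topologicalClosure := by
    rw [Submodule.span_le]
    rintro _ ⟨g, rfl⟩
    refine Metric.mem_closure_iff.2 fun ε hε => ?_
    obtain ⟨a, ha⟩ := k.near g (ε ^ 2) (by positivity)
    refine ⟨k.lC a (k.cls g), Submodule.subset_span ⟨a, _, rfl⟩, ?_⟩
    rw [dist_comm, dist_eq_norm, ← pow_lt_pow_iff_left₀ (norm_nonneg _) hε.le two_ne_zero,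
      ipC_norm_sq]
    have h3 : k.ipC (k.lC a (k.cls g) - k.cls g) (k.lC a (k.cls g) - k.cls g) =
        k.K (k.l a g) (k.l a g) - k.K (k.l a g) g - k.K g (k.l a g) + k.K g g := by
      simp only [lC_mk, map_sub, _root_.sub_apply, ipC_mk]
      abel
    rw [h3]; exact ha
  have h2 := closure_minimal (s := (Submodule.span ℂ (Set.range k.cls) : Set k.Cpl)) h
    S.isClosed_topologicalClosure
  rw [closure_span_mk] at h2
  exact Set.univ_subset_iff.1 h2

lemma add_lC (a a' : A) (x : k.Cpl) : k.lC (a + a') x = k.lC a x + k.lC a' x := by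
  refine UniformSpace.Completion.induction_on x (isClosed_eq (by fun_prop) (by fun_prop)) ?_
  intro x
  refine k.eq_of_ipC fun z => ?_
  rw [map_add]
  simp only [lC_coe, ipC_coe]
  rw [form_add_lPre, map_add]

lemma smul_lC (c : ℂ) (a : A) (x : k.Cpl) : k.lC (c • a) x = c • k.lC a x := by
  refine UniformSpace.Completion.induction_on x (isClosed_eq (k.lC (c • a)).continuous
    ((k.lC a).continuous.const_smul c)) ?_
  intro x
  refine k.eq_of_ipC fun z => ?_
  rw [map_smul]
  simp only [lC_coe, ipC_coe]
  rw [form_smul_lPre, map_smul]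

lemma mul_lC (a a' : A) (x : k.Cpl) : k.lC (a * a') x = k.lC a (k.lC a' x) := by
  refine UniformSpace.Completion.induction_on x (isClosed_eq (by fun_prop) (by fun_prop)) ?_
  intro x
  refine k.eq_of_ipC fun z => ?_
  simp only [lC_coe, ipC_coe]
  rw [form_mul_lPre]

/-- The C*-correspondence generated by a kernel: the completion of the space of formal linear
combinations of generators with respect to the kernel. -/
noncomputable def corr : Corr.{u, v, w} A B where
  carrier := k.Cpl
  ip x y := k.ipC x y
  rs x b := k.rC b x
  ls a x := k.lC a x
  ip_add _ _ _ := map_add _ _ _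
  ip_smul _ _ _ := map_smul _ _ _
  star_ip := k.star_ipC
  ip_rs x y b := k.ipC_rC x y b
  ip_nonneg := k.ipC_nonneg
  norm_sq := k.ipC_norm_sq
  add_ls := k.add_lC
  smul_ls := k.smul_lC
  mul_ls := k.mul_lC
  ip_ls a x y := k.ipC_lC x y a
  nondeg := k.closure_span_lC

/-- The class of a generator, as an element of the generated correspondence. -/
noncomputable def gen (g : k.G) : k.corr := k.cls g

lemma ip_gen (g h : k.G) : k.corr.ip (k.gen g) (k.gen h) = k.K g h := k.ipC_mk g h
lemma ls_gen (a : A) (g : k.G) : k.corr.ls a (k.gen g) = k.gen (k.l a g) := k.lC_mk a g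
lemma rs_gen (b : B) (g : k.G) : k.corr.rs (k.gen g) b = k.gen (k.r g b) := k.rC_mk b g
lemma dense_gen : closure (Submodule.span ℂ (Set.range k.gen) : Set k.corr) = Set.univ :=
  k.closure_span_mk

end Ker

section

variable {A B C D : Type*} [NonUnitalCStarAlgebra A] [NonUnitalCStarAlgebra B]
  [NonUnitalCStarAlgebra C] [NonUnitalCStarAlgebra D]

section Hom

variable [PartialOrder B]

/-- An isometric bimodule map between C*-correspondences: it preserves the inner product and
intertwines the left actions (compatibility with the right actions is then automatic). -/
structure Hom (X : Corr.{_, _, w₁} A B) (Y : Corr.{_, _, w₂} A B) where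
  toLin : X →ₗ[ℂ] Y
  ip_map : ∀ x y, Y.ip (toLin x) (toLin y) = X.ip x y
  ls_map : ∀ a x, toLin (X.ls a x) = Y.ls a (toLin x)

instance (X : Corr.{_, _, w₁} A B) (Y : Corr.{_, _, w₂} A B) :
    CoeFun (Hom X Y) (fun _ => X → Y) := ⟨fun f => f.toLin⟩

/-- A unitary isomorphism of C*-correspondences: a surjective isometric bimodule map. -/
structure Iso (X : Corr.{_, _, w₁} A B) (Y : Corr.{_, _, w₂} A B) extends Hom X Y where
  surj : Function.Surjective toHom

instance (X : Corr.{_, _, w₁} A B) (Y : Corr.{_, _, w₂} A B) :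
    CoeFun (Iso X Y) (fun _ => X → Y) := ⟨fun f => f.toHom⟩

variable {X : Corr.{_, _, w₁} A B} {Y : Corr.{_, _, w₂} A B} {Z : Corr.{_, _, w₃} A B}

namespace Hom

lemma norm_map (f : Hom X Y) (x : X) : ‖f x‖ = ‖x‖ := by
  rw [← pow_left_inj₀ (norm_nonneg _) (norm_nonneg _) two_ne_zero, X.norm_sq, Y.norm_sq, f.ip_map]

/-- A bimodule isometry as a linear isometry. -/
def toLI (f : Hom X Y) : X →ₗᵢ[ℂ] Y := ⟨f.toLin, f.norm_map⟩

/-- A bimodule isometry as a bounded operator. -/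
def toCLM (f : Hom X Y) : X →L[ℂ] Y := f.toLI.toContinuousLinearMap

@[simp] lemma toCLM_apply (f : Hom X Y) (x : X) : f.toCLM x = f x := rfl

lemma injective (f : Hom X Y) : Function.Injective f := f.toLI.injective

lemma continuous (f : Hom X Y) : Continuous f := f.toLI.continuous

@[simp] lemma map_add (f : Hom X Y) (x y : X) : f (x + y) = f x + f y := f.toLin.map_add x y
@[simp] lemma map_smul (f : Hom X Y) (c : ℂ) (x : X) : f (c • x) = c • f x := f.toLin.map_smul c x

lemma rs_map (f : Hom X Y) (x : X) (b : B) : f (X.rs x b) = Y.rs (f x) b := by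
  have h : Y.ip (f (X.rs x b) - Y.rs (f x) b) (f (X.rs x b) - Y.rs (f x) b) = 0 := by
    simp only [Y.ip_sub, Y.sub_ip, f.ip_map, Y.ip_rs, Y.rs_ip, X.ip_rs, X.rs_ip]
    simp [mul_assoc]
  have h2 := Y.norm_sq (f (X.rs x b) - Y.rs (f x) b)
  rw [h, norm_zero, sq_eq_zero_iff, norm_eq_zero, sub_eq_zero] at h2
  exact h2

/-- The identity. -/
def id (X : Corr.{_, _, w₁} A B) : Hom X X := ⟨LinearMap.id, fun _ _ => rfl, fun _ _ => rfl⟩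

@[simp] lemma id_apply (x : X) : Hom.id X x = x := rfl

/-- Composition. -/
def comp (g : Hom Y Z) (f : Hom X Y) : Hom X Z where
  toLin := g.toLin ∘ₗ f.toLin
  ip_map x y := by simp [g.ip_map, f.ip_map]
  ls_map a x := by simp [g.ls_map, f.ls_map]

@[simp] lemma comp_apply (g : Hom Y Z) (f : Hom X Y) (x : X) : g.comp f x = g (f x) := rfl

lemma isClosed_range (f : Hom X Y) : IsClosed (Set.range f) :=
  f.toLI.isometry.isClosedEmbedding.isClosed_range

/-- Two bounded maps agreeing on a family with dense span are equal. -/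
lemma ext_dense {G : Type*} {u : G → X} (hu : closure (Submodule.span ℂ (Set.range u) : Set X) = Set.univ)
    (f g : Hom X Y) (h : ∀ i, f (u i) = g (u i)) (x : X) : f x = g x := by
  have : Set.EqOn f.toCLM g.toCLM (closure (Submodule.span ℂ (Set.range u) : Set X)) :=
    ContinuousLinearMap.eqOn_closure_span (by rintro _ ⟨i, rfl⟩; exact h i)
  exact this (by rw [hu]; trivial)

/-- A bimodule isometry whose range contains a family with dense span is unitary. -/
def toIso (f : Hom X Y) {G : Type*} (v : G → Y)
    (hv : closure (Submodule.span ℂ (Set.range v) : Set Y) = Set.univ)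
    (h : ∀ i, v i ∈ Set.range f) : Iso X Y where
  toHom := f
  surj := by
    rw [← Set.range_eq_univ, ← Set.univ_subset_iff, ← hv]
    refine closure_minimal ?_ f.isClosed_range
    have : Submodule.span ℂ (Set.range v) ≤ LinearMap.range f.toLin := by
      rw [Submodule.span_le]
      rintro _ ⟨i, rfl⟩
      exact h i
    exact this

section gen

variable {G : Type*} (u : G → X) (v : G → Y)

lemma exists_ofGen (hu : closure (Submodule.span ℂ (Set.range u) : Set X) = Set.univ)
    (hip : ∀ i j, Y.ip (v i) (v j) = X.ip (u i) (u j))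
    (hls : ∀ a i, ∃ j, u j = X.ls a (u i) ∧ v j = Y.ls a (v i)) (hsB : StarOrderedRing B) :
    ∃ f : Hom X Y, ∀ i, f (u i) = v i := by
  let p : (G →₀ ℂ) →ₗ[ℂ] X := Finsupp.linearCombination ℂ u
  let q : (G →₀ ℂ) →ₗ[ℂ] Y := Finsupp.linearCombination ℂ v
  have hpq : ∀ c d, Y.ip (q c) (q d) = X.ip (p c) (p d) := by
    intro c d
    simp only [← Corr.ipL_apply, p, q, Finsupp.linearCombination_apply, Finsupp.sum, map_sum,
      LinearMap.sum_apply, LinearMap.map_smulₛₗ, LinearMap.smul_apply]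
    simp only [Corr.ipL_apply, hip]
  have hn : ∀ c, ‖q c‖ = ‖p c‖ := fun c => by
    rw [← pow_left_inj₀ (norm_nonneg _) (norm_nonneg _) two_ne_zero, X.norm_sq, Y.norm_sq, hpq]
  have hd : DenseRange p := by
    rw [DenseRange, dense_iff_closure_eq, ← hu, ← Finsupp.range_linearCombination]; rfl
  have hb : ∃ C, ∀ c, ‖q c‖ ≤ C * ‖p c‖ := ⟨1, fun c => by rw [hn, one_mul]⟩
  let F : X →L[ℂ] Y := q.extendOfNorm p
  have hF : ∀ c, F (p c) = q c := fun c => LinearMap.extendOfNorm_eq hd hb c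
  have hFu : ∀ i, F (u i) = v i := fun i => by simpa [p, q] using hF (Finsupp.single i 1)
  refine ⟨⟨F.toLinearMap, fun x y => ?_, fun a x => ?_⟩, hFu⟩
  · refine hd.induction_on₂ (p := fun x y => Y.ip (F x) (F y) = X.ip x y)
      (isClosed_eq ?_ X.continuous_ip) (fun c d => by rw [hF, hF, hpq]) x y
    exact Y.continuous_ip.comp ((F.continuous.comp continuous_fst).prodMk
      (F.continuous.comp continuous_snd))
  · have : Set.EqOn (F.comp (X.lsL a)) ((Y.lsL a).comp F)
        (closure (Submodule.span ℂ (Set.range u) : Set X)) := by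
      refine ContinuousLinearMap.eqOn_closure_span ?_
      rintro _ ⟨i, rfl⟩
      obtain ⟨j, h1, h2⟩ := hls a i
      simp [← h1, hFu, h2]
    exact this (by rw [hu]; trivial)

end gen

end Hom

namespace Iso

/-- The inverse of a unitary isomorphism. -/
noncomputable def symm (f : Iso X Y) : Iso Y X where
  toLin := (LinearEquiv.ofBijective f.toLin ⟨f.toHom.injective, f.surj⟩).symm.toLinearMap
  ip_map x y := by
    rw [← f.ip_map]
    congr 1 <;> exact LinearEquiv.apply_symm_apply (LinearEquiv.ofBijective f.toLin _) _
  ls_map a x := by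
    apply f.toHom.injective
    rw [f.ls_map]
    refine (LinearEquiv.apply_symm_apply (LinearEquiv.ofBijective f.toLin _) _).trans ?_
    congr 1
    exact (LinearEquiv.apply_symm_apply (LinearEquiv.ofBijective f.toLin _) _).symm
  surj := (LinearEquiv.ofBijective f.toLin _).symm.surjective

@[simp] lemma apply_symm_apply (f : Iso X Y) (y : Y) : f (f.symm y) = y :=
  LinearEquiv.apply_symm_apply (LinearEquiv.ofBijective f.toLin ⟨f.toHom.injective, f.surj⟩) y

@[simp] lemma symm_apply_apply (f : Iso X Y) (x : X) : f.symm (f x) = x :=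
  f.toHom.injective (f.apply_symm_apply (f x))

/-- The identity. -/
def refl (X : Corr.{_, _, w₁} A B) : Iso X X := ⟨Hom.id X, fun x => ⟨x, rfl⟩⟩

/-- Composition of unitary isomorphisms, `f` first. -/
def trans (f : Iso X Y) (g : Iso Y Z) : Iso X Z :=
  ⟨g.toHom.comp f.toHom, g.surj.comp f.surj⟩

@[simp] lemma trans_apply (f : Iso X Y) (g : Iso Y Z) (x : X) : f.trans g x = g (f x) := rfl

end Iso

end Hom

section Self

variable (A) [PartialOrder A] [StarOrderedRing A]

/-- `A` as a C*-correspondence over itself, with `⟨a, b⟩ = a* b`. -/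
noncomputable def Corr.self : Corr A A where
  carrier := A
  ip a b := star a * b
  rs a b := a * b
  ls a b := a * b
  ip_add _ _ _ := mul_add _ _ _
  ip_smul _ _ _ := mul_smul_comm _ _ _
  star_ip _ _ := by simp
  ip_rs _ _ _ := (mul_assoc _ _ _).symm
  ip_nonneg a := star_mul_self_nonneg a
  norm_sq a := by rw [CStarRing.norm_star_mul_self, sq]
  add_ls _ _ _ := add_mul _ _ _
  smul_ls _ _ _ := smul_mul_assoc _ _ _
  mul_ls _ _ _ := mul_assoc _ _ _
  ip_ls _ _ _ := by simp [mul_assoc]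
  nondeg := by
    refine Set.eq_univ_of_forall fun x => ?_
    have hl := CStarAlgebra.increasingApproximateUnit A
    have := hl.neBot
    refine closure_mono Submodule.subset_span
      (mem_closure_of_tendsto (hl.tendsto_mul_right x) (Eventually.of_forall fun e => ⟨e, x, rfl⟩))

end Self

section Tensor

variable [PartialOrder B] [StarOrderedRing B] [PartialOrder C] [StarOrderedRing C]
  [PartialOrder D] [StarOrderedRing D]

lemma exists_gram (X : Corr.{_, _, w₁} A B) (Y : Corr.{_, _, w₂} B C) {n : Type*} [Fintype n]
    (x : n → X) (y : n → Y) :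
    ∃ z : n → Y, ∑ i, ∑ j, Y.ip (y i) (Y.ls (X.ip (x i) (x j)) (y j)) = ∑ k, Y.ip (z k) (z k) := by
  obtain ⟨N, hN⟩ := exists_factor (fun i j => X.ip (x i) (x j)) (fun i j => X.star_ip _ _) (by
    intro v
    have : ∑ i, ∑ j, star (v i) * X.ip (x i) (x j) * v j =
        X.ip (∑ i, X.rs (x i) (v i)) (∑ i, X.rs (x i) (v i)) := by
      simp only [← Corr.ipL_apply, map_sum, LinearMap.sum_apply]
      simp only [Corr.ipL_apply, X.ip_rs, X.rs_ip]
      rw [Finset.sum_comm]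
    rw [this]; exact X.ip_nonneg _)
  refine ⟨fun k => ∑ i, Y.ls (N k i) (y i), ?_⟩
  have hsum : ∀ (g : n → B) (y : Y), Y.ls (∑ k, g k) y = ∑ k, Y.ls (g k) y := fun g y =>
    map_sum (⟨⟨fun b => Y.ls b y, by simpa using Y.smul_ls 0 0 y⟩, fun a b => Y.add_ls a b y⟩ :
      B →+ Y) g _
  simp only [hN, hsum]
  simp only [← Corr.ipL_apply, map_sum, LinearMap.sum_apply]
  simp only [Corr.ipL_apply, Y.mul_ls, ← Y.ip_ls]
  rw [Finset.sum_comm_cycle]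
  refine Finset.sum_congr rfl fun k _ => Finset.sum_comm

lemma tensor_psd (X : Corr.{_, _, w₁} A B) (Y : Corr.{_, _, w₂} B C) (F : X → X)
    (s : Finset (X × Y)) (c : X × Y → ℂ) :
    0 ≤ ∑ g ∈ s, ∑ h ∈ s,
      (star (c g) * c h) • Y.ip g.2 (Y.ls (X.ip (F g.1) (F h.1)) h.2) := by
  obtain ⟨z, hz⟩ := exists_gram X Y (n := s) (fun i => F i.1.1) (fun i => c i.1 • i.1.2)
  have : ∑ g ∈ s, ∑ h ∈ s, (star (c g) * c h) • Y.ip g.2 (Y.ls (X.ip (F g.1) (F h.1)) h.2) =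
      ∑ k, Y.ip (z k) (z k) := by
    rw [← hz, ← Finset.sum_coe_sort]
    refine Finset.sum_congr rfl fun i _ => ?_
    rw [← Finset.sum_coe_sort]
    refine Finset.sum_congr rfl fun j _ => ?_
    rw [Y.ls_smul, Y.ip_smul, Y.smul_ip, smul_smul, mul_comm]
  rw [this]
  exact Finset.sum_nonneg fun k _ => Y.ip_nonneg _

/-- The kernel `⟨x ⊗ y, x' ⊗ y'⟩ = ⟨y, ⟨x, x'⟩ y'⟩` of the interior tensor product. -/
noncomputable def tensorKer (X : Corr.{_, _, w₁} A B) (Y : Corr.{_, _, w₂} B C) :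
    Ker.{_, _, max w₁ w₂} A C where
  G := X × Y
  K g h := Y.ip g.2 (Y.ls (X.ip g.1 h.1) h.2)
  r g c := (g.1, Y.rs g.2 c)
  l a g := (X.ls a g.1, g.2)
  star_K g h := by rw [Y.star_ip, Y.ip_ls, X.star_ip]
  psd := tensor_psd X Y fun x => x
  K_r g h c := by rw [Y.ls_rs, Y.ip_rs]
  K_l a g h := by rw [X.ip_ls]
  K_add a a' g h := by rw [X.add_ls, X.ip_add, Y.add_ls, Y.ip_add]
  K_smul c a g h := by rw [X.smul_ls, X.ip_smul, Y.smul_ls, Y.ip_smul]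
  K_mul a a' g h := by rw [X.mul_ls]
  bound a s c := by
    obtain ⟨F, hF⟩ := X.exists_defect a
    rw [← sub_nonneg]
    convert tensor_psd X Y F s c using 1
    have h : ∀ x x' : X, ∀ y y' : Y, ‖a‖ ^ 2 • Y.ip y (Y.ls (X.ip x x') y') =
        Y.ip y (Y.ls (X.ip (X.ls a x) (X.ls a x')) y') + Y.ip y (Y.ls (X.ip (F x) (F x')) y') := by
      intro x x' y y'
      rw [← Y.ip_add, ← Y.add_ls, hF, ← Complex.coe_smul, ← Complex.coe_smul (‖a‖ ^ 2) (X.ip x x'),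
        Y.smul_ls, Y.ip_smul]
    rw [sub_eq_iff_eq_add, Finset.smul_sum, ← Finset.sum_add_distrib]
    refine Finset.sum_congr rfl fun g _ => ?_
    rw [Finset.smul_sum, ← Finset.sum_add_distrib]
    refine Finset.sum_congr rfl fun g' _ => ?_
    rw [smul_comm, h, ← smul_add, add_comm]
  near g ε hε := by
    obtain ⟨a, ha⟩ := X.exists_near g.1 (ε := √(ε / (‖g.2‖ ^ 2 + 1))) (by positivity)
    refine ⟨a, ?_⟩
    have h1 : ∀ b b' : B, Y.ls (b - b') g.2 = Y.ls b g.2 - Y.ls b' g.2 := fun b b' => by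
      have : b - b' = b + (-1 : ℂ) • b' := by simp [sub_eq_add_neg]
      rw [this, Y.add_ls, Y.smul_ls]; simp [sub_eq_add_neg]
    have h2 : Y.ip g.2 (Y.ls (X.ip (X.ls a g.1 - g.1) (X.ls a g.1 - g.1)) g.2) =
        Y.ip g.2 (Y.ls (X.ip (X.ls a g.1) (X.ls a g.1)) g.2) -
        Y.ip g.2 (Y.ls (X.ip (X.ls a g.1) g.1) g.2) - Y.ip g.2 (Y.ls (X.ip g.1 (X.ls a g.1)) g.2) +
        Y.ip g.2 (Y.ls (X.ip g.1 g.1) g.2) := by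
      simp only [X.ip_sub, X.sub_ip, h1, Y.ip_sub]; abel
    rw [← h2]
    set t := ‖X.ls a g.1 - g.1‖ with ht
    have h3 : t ^ 2 < ε / (‖g.2‖ ^ 2 + 1) := by
      rw [← Real.sq_sqrt (show 0 ≤ ε / (‖g.2‖ ^ 2 + 1) by positivity)]
      exact pow_lt_pow_left₀ ha (norm_nonneg _) two_ne_zero
    calc _ ≤ ‖g.2‖ * ‖Y.ls (X.ip (X.ls a g.1 - g.1) (X.ls a g.1 - g.1)) g.2‖ := Y.norm_ip_le _ _
      _ ≤ ‖g.2‖ * (t ^ 2 * ‖g.2‖) := by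
        gcongr
        rw [ht, X.norm_sq]
        exact Y.norm_ls_le _ _
      _ = t ^ 2 * ‖g.2‖ ^ 2 := by ring
      _ ≤ ε / (‖g.2‖ ^ 2 + 1) * ‖g.2‖ ^ 2 := by gcongr
      _ < ε := by rw [div_mul_eq_mul_div, div_lt_iff₀ (by positivity)]; nlinarith

/-- The interior tensor product `X ⊗_B Y` of an `A`-`B`-correspondence and a
`B`-`C`-correspondence: the completion of the span of the elementary tensors for
`⟨x ⊗ y, x' ⊗ y'⟩ = ⟨y, ⟨x, x'⟩ y'⟩`, with `a (x ⊗ y) = (a x) ⊗ y` and `(x ⊗ y) c = x ⊗ (y c)`. -/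
noncomputable def Corr.tensor (X : Corr.{_, _, w₁} A B) (Y : Corr.{_, _, w₂} B C) :
    Corr.{_, _, max w₁ w₂} A C := (tensorKer X Y).corr

infixr:70 " ⊠ " => Corr.tensor

end Tensor

end

section

variable {A B C D : Type*} [NonUnitalCStarAlgebra A] [NonUnitalCStarAlgebra B]
  [NonUnitalCStarAlgebra C] [NonUnitalCStarAlgebra D]

section TensorMaps

variable [PartialOrder B] [StarOrderedRing B] [PartialOrder C] [StarOrderedRing C]
  [PartialOrder D] [StarOrderedRing D]

section tmul

variable {X : Corr.{_, _, w₁} A B} {Y : Corr.{_, _, w₂} B C}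

/-- The elementary tensor `x ⊗ y`. -/
noncomputable def tmul (x : X) (y : Y) : (X ⊠ Y : Corr A C) := (tensorKer X Y).gen (x, y)

lemma ip_tmul (x x' : X) (y y' : Y) :
    (X ⊠ Y).ip (tmul x y) (tmul x' y') = Y.ip y (Y.ls (X.ip x x') y') :=
  (tensorKer X Y).ip_gen (x, y) (x', y')

lemma ls_tmul (a : A) (x : X) (y : Y) : (X ⊠ Y).ls a (tmul x y) = tmul (X.ls a x) y :=
  (tensorKer X Y).ls_gen a (x, y)

lemma rs_tmul (x : X) (y : Y) (c : C) : (X ⊠ Y).rs (tmul x y) c = tmul x (Y.rs y c) :=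
  (tensorKer X Y).rs_gen c (x, y)

lemma dense_tmul :
    closure (Submodule.span ℂ (Set.range fun p : X × Y => tmul p.1 p.2) : Set (X ⊠ Y : Corr A C)) =
      Set.univ := (tensorKer X Y).dense_gen

lemma tensor_eq {z z' : (X ⊠ Y : Corr A C)}
    (h : ∀ x y, (X ⊠ Y).ip (tmul x y) z = (X ⊠ Y).ip (tmul x y) z') : z = z' := by
  refine Corr.eq_of_ip _ fun t => ?_
  let S : Submodule ℂ (X ⊠ Y : Corr A C) :=
    LinearMap.ker ((X ⊠ Y).ipL.flip z - (X ⊠ Y).ipL.flip z')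
  have hS : ∀ t, t ∈ S ↔ (X ⊠ Y).ip t z = (X ⊠ Y).ip t z' := fun t => by
    simp [S, Corr.ipL_apply, sub_eq_zero]
  have hcl : IsClosed (S : Set (X ⊠ Y : Corr A C)) := by
    have : (S : Set (X ⊠ Y : Corr A C)) = {t | (X ⊠ Y).ip t z = (X ⊠ Y).ip t z'} :=
      Set.ext hS
    rw [this]
    exact isClosed_eq ((X ⊠ Y).continuous_ip.comp (by fun_prop : Continuous fun t => (t, z)))
      ((X ⊠ Y).continuous_ip.comp (by fun_prop : Continuous fun t => (t, z')))
  have h1 : Submodule.span ℂ (Set.range fun p : X × Y => tmul p.1 p.2) ≤ S := by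
    rw [Submodule.span_le]
    rintro _ ⟨p, rfl⟩
    exact (hS _).2 (h _ _)
  have h2 := closure_minimal h1 hcl
  rw [dense_tmul] at h2
  exact (hS t).1 (h2 trivial)

lemma add_tmul (x x' : X) (y : Y) : tmul (x + x') y = tmul x y + tmul x' y := by
  refine tensor_eq fun s t => ?_
  rw [Corr.ip_add]; simp only [ip_tmul, X.ip_add, Y.add_ls, Y.ip_add]

lemma tmul_add (x : X) (y y' : Y) : tmul x (y + y') = tmul x y + tmul x y' := by
  refine tensor_eq fun s t => ?_
  rw [Corr.ip_add]; simp only [ip_tmul, Y.ls_add, Y.ip_add]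

lemma smul_tmul (c : ℂ) (x : X) (y : Y) : tmul (c • x) y = c • tmul x y := by
  refine tensor_eq fun s t => ?_
  rw [Corr.ip_smul]; simp only [ip_tmul, X.ip_smul, Y.smul_ls, Y.ip_smul]

lemma tmul_smul (c : ℂ) (x : X) (y : Y) : tmul x (c • y) = c • tmul x y := by
  refine tensor_eq fun s t => ?_
  rw [Corr.ip_smul]; simp only [ip_tmul, Y.ls_smul, Y.ip_smul]

/-- The tensor product is balanced over `B`. -/
lemma rs_tmul_eq (x : X) (b : B) (y : Y) : tmul (X.rs x b) y = tmul x (Y.ls b y) := by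
  refine tensor_eq fun s t => ?_
  simp only [ip_tmul, X.ip_rs, Y.mul_ls]

lemma norm_tmul_le (x : X) (y : Y) : ‖tmul x y‖ ≤ ‖x‖ * ‖y‖ := by
  rw [← pow_le_pow_iff_left₀ (norm_nonneg _) (by positivity) two_ne_zero, Corr.norm_sq, ip_tmul]
  calc _ ≤ ‖y‖ * ‖Y.ls (X.ip x x) y‖ := Y.norm_ip_le _ _
    _ ≤ ‖y‖ * (‖x‖ ^ 2 * ‖y‖) := by
      gcongr
      rw [X.norm_sq]
      exact Y.norm_ls_le _ _
    _ = _ := by ring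

/-- `x ⊗ y` as a bounded bilinear map. -/
noncomputable def tmulL : X →L[ℂ] Y →L[ℂ] (X ⊠ Y : Corr A C) :=
  LinearMap.mkContinuous₂ (LinearMap.mk₂ ℂ tmul add_tmul smul_tmul tmul_add tmul_smul) 1
    fun x y => by simpa using norm_tmul_le x y

lemma tmulL_apply (x : X) (y : Y) : tmulL x y = tmul x y := rfl

lemma dense_tmul_of_dense {G H : Type*} {a : G → X} {b : H → Y}
    (ha : closure (Submodule.span ℂ (Set.range a) : Set X) = Set.univ)
    (hb : closure (Submodule.span ℂ (Set.range b) : Set Y) = Set.univ) :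
    closure (Submodule.span ℂ (Set.range fun p : G × H => tmul (a p.1) (b p.2)) :
      Set (X ⊠ Y : Corr A C)) = Set.univ := by
  set S := (Submodule.span ℂ (Set.range fun p : G × H => tmul (a p.1) (b p.2))).topologicalClosure
    with hS
  have hSc : IsClosed (S : Set (X ⊠ Y : Corr A C)) := Submodule.isClosed_topologicalClosure _
  have h1 : ∀ x h, tmul x (b h) ∈ S := by
    intro x h
    have h2 : Submodule.span ℂ (Set.range a) ≤ S.comap (tmulL.flip (b h)).toLinearMap := by
      rw [Submodule.span_le]
      rintro _ ⟨g, rfl⟩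
      exact Submodule.le_topologicalClosure _ (Submodule.subset_span ⟨(g, h), rfl⟩)
    have h3 := closure_minimal (s := (Submodule.span ℂ (Set.range a) : Set X)) h2
      (hSc.preimage (tmulL.flip (b h)).continuous)
    rw [ha] at h3
    exact h3 (Set.mem_univ x)
  have h4 : ∀ x y, tmul x y ∈ S := by
    intro x y
    have h2 : Submodule.span ℂ (Set.range b) ≤ S.comap (tmulL x).toLinearMap := by
      rw [Submodule.span_le]
      rintro _ ⟨h, rfl⟩
      exact h1 x h
    have h3 := closure_minimal (s := (Submodule.span ℂ (Set.range b) : Set Y)) h2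
      (hSc.preimage (tmulL x).continuous)
    rw [hb] at h3
    exact h3 (Set.mem_univ y)
  have h5 : Submodule.span ℂ (Set.range fun p : X × Y => tmul p.1 p.2) ≤ S := by
    rw [Submodule.span_le]
    rintro _ ⟨p, rfl⟩
    exact h4 _ _
  have h6 := closure_minimal (s := ((Submodule.span ℂ (Set.range fun p : X × Y => tmul p.1 p.2) :
    Submodule ℂ (X ⊠ Y : Corr A C)) : Set (X ⊠ Y : Corr A C))) h5 hSc
  rw [dense_tmul] at h6
  exact Set.univ_subset_iff.1 h6

end tmul

lemma dense_id (X : Corr.{_, _, w₁} A B) :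
    closure (Submodule.span ℂ (Set.range fun x : X => x) : Set X) = Set.univ := by
  simp

section tmap

variable {X : Corr.{_, _, w₁} A B} {X' : Corr.{_, _, w₂} A B}
  {Y : Corr.{_, _, w₃} B C} {Y' : Corr.{_, _, w₄} B C}

lemma exists_tmap (f : Hom X X') (g : Hom Y Y') :
    ∃ F : Hom (X ⊠ Y) (X' ⊠ Y'), ∀ p : X × Y, F (tmul p.1 p.2) = tmul (f p.1) (g p.2) :=
  Hom.exists_ofGen (fun p : X × Y => tmul p.1 p.2) (fun p => tmul (f p.1) (g p.2)) dense_tmul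
    (fun p q => by simp only [ip_tmul, f.ip_map, ← g.ls_map, g.ip_map])
    (fun a p => ⟨(X.ls a p.1, p.2), by simp only [ls_tmul], by simp only [ls_tmul, f.ls_map]⟩)
    inferInstance

/-- The tensor product `f ⊗ g` of bimodule isometries. -/
noncomputable def tmap (f : Hom X X') (g : Hom Y Y') : Hom (X ⊠ Y) (X' ⊠ Y') :=
  (exists_tmap f g).choose

@[simp] lemma tmap_tmul (f : Hom X X') (g : Hom Y Y') (x : X) (y : Y) :
    tmap f g (tmul x y) = tmul (f x) (g y) := (exists_tmap f g).choose_spec (x, y)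

/-- The tensor product of unitary isomorphisms. -/
noncomputable def tmapIso (f : Iso X X') (g : Iso Y Y') : Iso (X ⊠ Y) (X' ⊠ Y') :=
  (tmap f.toHom g.toHom).toIso (fun p : X' × Y' => tmul p.1 p.2) dense_tmul fun p => by
    obtain ⟨x, hx⟩ := f.surj p.1
    obtain ⟨y, hy⟩ := g.surj p.2
    exact ⟨tmul x y, by rw [tmap_tmul, hx, hy]⟩

@[simp] lemma tmapIso_tmul (f : Iso X X') (g : Iso Y Y') (x : X) (y : Y) :
    tmapIso f g (tmul x y) = tmul (f x) (g y) := tmap_tmul _ _ _ _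

end tmap

section assoc

variable (X : Corr.{_, _, w₁} A B) (Y : Corr.{_, _, w₂} B C) (Z : Corr.{_, _, w₃} C D)

lemma dense_tmul₁ : closure (Submodule.span ℂ (Set.range fun p : (X × Y) × Z =>
    tmul (tmul p.1.1 p.1.2) p.2) : Set ((X ⊠ Y) ⊠ Z : Corr A D)) = Set.univ :=
  dense_tmul_of_dense (X := X ⊠ Y) (Y := Z) (a := fun p : X × Y => tmul p.1 p.2)
    (b := fun z : Z => z) dense_tmul (dense_id Z)

lemma dense_tmul₂ : closure (Submodule.span ℂ (Set.range fun p : X × (Y × Z) =>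
    tmul p.1 (tmul p.2.1 p.2.2)) : Set (X ⊠ (Y ⊠ Z) : Corr A D)) = Set.univ :=
  dense_tmul_of_dense (X := X) (Y := Y ⊠ Z) (a := fun x : X => x)
    (b := fun p : Y × Z => tmul p.1 p.2) (dense_id X) dense_tmul

lemma exists_assoc : ∃ F : Hom ((X ⊠ Y) ⊠ Z) (X ⊠ (Y ⊠ Z)), ∀ p : (X × Y) × Z,
    F (tmul (tmul p.1.1 p.1.2) p.2) = tmul p.1.1 (tmul p.1.2 p.2) :=
  Hom.exists_ofGen (fun p : (X × Y) × Z => tmul (tmul p.1.1 p.1.2) p.2)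
    (fun p => tmul p.1.1 (tmul p.1.2 p.2))
    (dense_tmul₁ X Y Z)
    (fun p q => by simp only [ip_tmul, ls_tmul])
    (fun a p => ⟨((X.ls a p.1.1, p.1.2), p.2), by simp only [ls_tmul], by simp only [ls_tmul]⟩)
    inferInstance

/-- The canonical identification `(X ⊗ Y) ⊗ Z = X ⊗ (Y ⊗ Z)`. -/
noncomputable def assoc : Iso ((X ⊠ Y) ⊠ Z) (X ⊠ (Y ⊠ Z)) :=
  (exists_assoc X Y Z).choose.toIso (fun p : X × (Y × Z) => tmul p.1 (tmul p.2.1 p.2.2))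
    (dense_tmul₂ X Y Z)
    fun p => ⟨tmul (tmul p.1 p.2.1) p.2.2,
      (exists_assoc X Y Z).choose_spec ((p.1, p.2.1), p.2.2)⟩

variable {X Y Z}

@[simp] lemma assoc_tmul (x : X) (y : Y) (z : Z) :
    assoc X Y Z (tmul (tmul x y) z) = tmul x (tmul y z) :=
  (exists_assoc X Y Z).choose_spec ((x, y), z)

@[simp] lemma assoc_symm_tmul (x : X) (y : Y) (z : Z) :
    (assoc X Y Z).symm (tmul x (tmul y z)) = tmul (tmul x y) z := by
  rw [← assoc_tmul, Iso.symm_apply_apply]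

end assoc

section unit

variable (X : Corr.{_, _, w₁} B C)

lemma exists_lunit : ∃ F : Hom (Corr.self B ⊠ X) X,
    ∀ p : Corr.self B × X, F (tmul p.1 p.2) = X.ls p.1 p.2 :=
  Hom.exists_ofGen (fun p : Corr.self B × X => tmul p.1 p.2) (fun p => X.ls p.1 p.2)
    dense_tmul
    (fun p q => by
      refine Eq.trans ?_ (ip_tmul _ _ _ _).symm
      exact (X.ip_ls _ _ _).trans (congrArg _ (X.mul_ls _ _ _).symm))
    (fun b p => ⟨((Corr.self B).ls b p.1, p.2), (ls_tmul _ _ _).symm, X.mul_ls _ _ _⟩)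
    inferInstance

/-- The canonical identification `B ⊗ X = X`, `b ⊗ x ↦ b x`. -/
noncomputable def lunit : Iso (Corr.self B ⊠ X) X :=
  (exists_lunit X).choose.toIso (fun p : Corr.self B × X => X.ls p.1 p.2)
    (by
      refine Eq.trans ?_ X.nondeg
      congr 3
      ext y; constructor
      · rintro ⟨p, rfl⟩; exact ⟨_, _, rfl⟩
      · rintro ⟨b, x, rfl⟩; exact ⟨(b, x), rfl⟩)
    fun p => ⟨_, (exists_lunit X).choose_spec p⟩

@[simp] lemma lunit_tmul (b : B) (x : X) : lunit X (tmul (X := Corr.self B) b x) = X.ls b x :=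
  (exists_lunit X).choose_spec (b, x)

lemma exists_runit : ∃ F : Hom (X ⊠ Corr.self C) X,
    ∀ p : X × Corr.self C, F (tmul p.1 p.2) = X.rs p.1 p.2 :=
  Hom.exists_ofGen (fun p : X × Corr.self C => tmul p.1 p.2) (fun p => X.rs p.1 p.2)
    dense_tmul
    (fun p q => by
      refine Eq.trans ?_ (ip_tmul _ _ _ _).symm
      refine ((X.ip_rs _ _ _).trans (congrArg (· * _) (X.rs_ip _ _ _))).trans ?_
      exact mul_assoc _ _ _)
    (fun b p => ⟨(X.ls b p.1, p.2), (ls_tmul _ _ _).symm, (X.ls_rs _ _ _).symm⟩)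
    inferInstance

lemma dense_rs :
    closure (Submodule.span ℂ (Set.range fun p : X × C => X.rs p.1 p.2) : Set X) = Set.univ := by
  refine Set.eq_univ_of_forall fun x => ?_
  have hl := CStarAlgebra.increasingApproximateUnit C
  have := hl.neBot
  refine closure_mono Submodule.subset_span
    (mem_closure_of_tendsto (f := fun e => X.rs x e) (b := CStarAlgebra.approximateUnit C) ?_
      (Eventually.of_forall fun e => ⟨(x, e), rfl⟩))
  rw [tendsto_iff_norm_sub_tendsto_zero]
  have h1 : ∀ e, ‖X.rs x e - x‖ ^ 2 =
      ‖star e * (X.ip x x * e) - X.ip x x * e - (star e * X.ip x x - X.ip x x)‖ := fun e => by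
    rw [X.norm_sq]
    simp only [X.ip_sub, X.sub_ip, X.ip_rs, X.rs_ip, mul_assoc]
  have h2 : Tendsto (fun e => ‖X.rs x e - x‖ ^ 2) (CStarAlgebra.approximateUnit C) (𝓝 0) := by
    have h3 : Tendsto (fun e => X.ip x x * e - X.ip x x) (CStarAlgebra.approximateUnit C)
        (𝓝 0) := by
      simpa using (hl.tendsto_mul_left (X.ip x x)).sub_const (X.ip x x)
    have h4 : Tendsto (fun e => 2 * ‖X.ip x x * e - X.ip x x‖) (CStarAlgebra.approximateUnit C)
        (𝓝 0) := by simpa using h3.norm.const_mul 2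
    refine squeeze_zero' (Eventually.of_forall fun _ => by positivity) ?_ h4
    filter_upwards [hl.eventually_norm] with e he
    rw [h1]
    have h5 : star e * (X.ip x x * e) - X.ip x x * e - (star e * X.ip x x - X.ip x x) =
        star e * (X.ip x x * e - X.ip x x) - (X.ip x x * e - X.ip x x) := by
      rw [mul_sub]; abel
    rw [h5]
    refine (norm_sub_le _ _).trans ?_
    have h6 := norm_mul_le (star e) (X.ip x x * e - X.ip x x)
    rw [norm_star] at h6
    have h7 := mul_le_of_le_one_left (norm_nonneg (X.ip x x * e - X.ip x x)) he
    linarith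
  have h8 := h2.sqrt
  simpa using h8

/-- The canonical identification `X ⊗ C = X`, `x ⊗ c ↦ x c`. -/
noncomputable def runit : Iso (X ⊠ Corr.self C) X :=
  (exists_runit X).choose.toIso (fun p : X × C => X.rs p.1 p.2) (dense_rs X)
    fun p => ⟨_, (exists_runit X).choose_spec p⟩

@[simp] lemma runit_tmul (x : X) (c : C) : runit X (tmul (Y := Corr.self C) x c) = X.rs x c :=
  (exists_runit X).choose_spec (x, c)

end unit

end TensorMaps

section DirectSum

variable [PartialOrder B] [StarOrderedRing B] {ι : Type} [DecidableEq ι]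
  (X : ι → Corr.{_, _, w₁} A B)

/-- The `i`-th component of an element of the disjoint union of the `X i`. -/
noncomputable def component (i : ι) (g : Σ i, X i) : X i := if h : g.1 = i then h ▸ g.2 else 0

lemma component_self (i : ι) (x : X i) : component X i ⟨i, x⟩ = x := by simp [component]
lemma component_ne {i j : ι} (h : i ≠ j) (x : X i) : component X j ⟨i, x⟩ = 0 := by
  simp [component, h]

lemma component_ls (a : A) (i : ι) (g : Σ i, X i) :
    component X i ⟨g.1, (X g.1).ls a g.2⟩ = (X i).ls a (component X i g) := by
  obtain ⟨j, x⟩ := g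
  by_cases h : j = i
  · subst h; simp [component_self]
  · rw [component_ne X h, component_ne X h, ← Corr.lsL_apply, map_zero]

lemma component_rs (b : B) (i : ι) (g : Σ i, X i) :
    component X i ⟨g.1, (X g.1).rs g.2 b⟩ = (X i).rs (component X i g) b := by
  obtain ⟨j, x⟩ := g
  by_cases h : j = i
  · subst h; simp [component_self]
  · rw [component_ne X h, component_ne X h]
    exact (X i).eq_of_ip fun z => by simp [(X i).ip_rs]

lemma sum_component (s : Finset (Σ i, X i)) (c : (Σ i, X i) → ℂ) (f : ∀ i, X i → X i)
    (hf : ∀ i, f i 0 = 0) :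
    ∑ g ∈ s, ∑ h ∈ s, (star (c g) * c h) • (X g.1).ip (f g.1 g.2) (f g.1 (component X g.1 h)) =
      ∑ i ∈ s.image Sigma.fst, ∑ g ∈ s, ∑ h ∈ s, (star (c g) * c h) •
        (X i).ip (f i (component X i g)) (f i (component X i h)) := by
  rw [Finset.sum_comm]
  conv_rhs => rw [Finset.sum_comm]
  rw [Finset.sum_comm]
  refine Finset.sum_congr rfl fun g hg => ?_
  rw [Finset.sum_eq_single g.1]
  · rw [show component X g.1 g = g.2 from component_self X g.1 g.2]
  · intro i _ hi
    rw [show component X i g = 0 from component_ne X (Ne.symm hi) g.2, hf]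
    simp
  · intro h
    exact absurd (Finset.mem_image_of_mem _ hg) h

lemma sum_eq_ip (Y : Corr.{_, _, w₂} A B) {G : Type*} (s : Finset G) (c : G → ℂ) (y : G → Y) :
    ∑ g ∈ s, ∑ h ∈ s, (star (c g) * c h) • Y.ip (y g) (y h) =
      Y.ip (∑ g ∈ s, c g • y g) (∑ g ∈ s, c g • y g) := by
  simp only [← Corr.ipL_apply, map_sum, LinearMap.sum_apply, map_smul, LinearMap.map_smulₛₗ,
    LinearMap.smul_apply, Finset.smul_sum, smul_smul]
  rw [Finset.sum_comm]
  refine Finset.sum_congr rfl fun g _ => Finset.sum_congr rfl fun h _ => ?_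
  rw [mul_comm]; rfl

/-- The kernel of the direct sum: `⟨x, y⟩` for `x, y` in the same summand, and `0` otherwise. -/
noncomputable def dsumKer : Ker A B where
  G := Σ i, X i
  K g h := (X g.1).ip g.2 (component X g.1 h)
  r g b := ⟨g.1, (X g.1).rs g.2 b⟩
  l a g := ⟨g.1, (X g.1).ls a g.2⟩
  star_K g h := by
    obtain ⟨i, x⟩ := g
    obtain ⟨j, y⟩ := h
    by_cases h : i = j
    · subst h; simp [component_self, Corr.star_ip]
    · simp [component_ne X h, component_ne X (Ne.symm h)]
  psd s c := by
    rw [sum_component X s c (fun i x => x) (fun _ => rfl)]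
    refine Finset.sum_nonneg fun i _ => ?_
    rw [sum_eq_ip]
    exact (X i).ip_nonneg _
  K_r g h b := by rw [component_rs, Corr.ip_rs]
  K_l a g h := by rw [component_ls, Corr.ip_ls]
  K_add a a' g h := by
    rw [component_ls X (a + a') g.1 h, component_ls X a g.1 h, component_ls X a' g.1 h,
      Corr.add_ls, Corr.ip_add]
  K_smul c a g h := by
    rw [component_ls X (c • a) g.1 h, component_ls X a g.1 h, Corr.smul_ls, Corr.ip_smul]
  K_mul a a' g h := by
    rw [component_ls X (a * a') g.1 h, component_ls X a g.1 ⟨h.1, (X h.1).ls a' h.2⟩,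
      component_ls X a' g.1 h, Corr.mul_ls]
  bound a s c := by
    simp only [component_ls]
    rw [sum_component X s c (fun i x => x) (fun _ => rfl),
      sum_component X s c (fun i x => (X i).ls a x)
        (fun i => by rw [← Corr.lsL_apply, map_zero]), Finset.smul_sum]
    refine Finset.sum_le_sum fun i _ => ?_
    rw [sum_eq_ip, sum_eq_ip]
    obtain ⟨F, hF⟩ := (X i).exists_defect a
    rw [← hF]
    have : ∑ g ∈ s, c g • (X i).ls a (component X i g) =
        (X i).ls a (∑ g ∈ s, c g • component X i g) := by
      simp only [← Corr.lsL_apply, map_sum, map_smul]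
    rw [this]
    exact le_add_of_nonneg_right ((X i).ip_nonneg _)
  near g ε hε := by
    obtain ⟨a, ha⟩ := (X g.1).exists_near g.2 (ε := √ε) (by positivity)
    refine ⟨a, ?_⟩
    rw [component_ls X a g.1 g, show component X g.1 g = g.2 from component_self X g.1 g.2]
    have : ‖(X g.1).ls a g.2 - g.2‖ ^ 2 < ε := by
      rw [← Real.sq_sqrt hε.le]
      exact pow_lt_pow_left₀ ha (norm_nonneg _) two_ne_zero
    rw [(X g.1).norm_sq] at this
    convert this using 2
    simp only [Corr.ip_sub, Corr.sub_ip]; abel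

/-- The direct sum of C*-correspondences (the completed orthogonal sum). -/
noncomputable def Corr.dsum : Corr A B := (dsumKer X).corr

/-- The element of the direct sum with only component `x` in the summand `i`. -/
noncomputable def single (i : ι) (x : X i) : Corr.dsum X := (dsumKer X).gen ⟨i, x⟩

lemma ip_single_self (i : ι) (x y : X i) :
    (Corr.dsum X).ip (single X i x) (single X i y) = (X i).ip x y := by
  refine ((dsumKer X).ip_gen ⟨i, x⟩ ⟨i, y⟩).trans ?_
  simp [dsumKer, component_self]

lemma ip_single_ne {i j : ι} (h : i ≠ j) (x : X i) (y : X j) :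
    (Corr.dsum X).ip (single X i x) (single X j y) = 0 := by
  refine ((dsumKer X).ip_gen ⟨i, x⟩ ⟨j, y⟩).trans ?_
  simp [dsumKer, component_ne X (Ne.symm h)]

lemma ls_single (a : A) (i : ι) (x : X i) :
    (Corr.dsum X).ls a (single X i x) = single X i ((X i).ls a x) := (dsumKer X).ls_gen a ⟨i, x⟩

lemma dense_single :
    closure (Submodule.span ℂ (Set.range fun g : Σ i, X i => single X g.1 g.2) :
      Set (Corr.dsum X)) = Set.univ := (dsumKer X).dense_gen

lemma exists_incl (i : ι) : ∃ F : Hom (X i) (Corr.dsum X), ∀ x, F x = single X i x :=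
  Hom.exists_ofGen (fun x => x) (fun x => single X i x) (dense_id (X i))
    (fun x y => ip_single_self X i x y)
    (fun a x => ⟨(X i).ls a x, rfl, (ls_single X a i x).symm⟩) inferInstance

/-- The inclusion of a summand into the direct sum. -/
noncomputable def incl (i : ι) : Hom (X i) (Corr.dsum X) := (exists_incl X i).choose

@[simp] lemma incl_apply (i : ι) (x : X i) : incl X i x = single X i x :=
  (exists_incl X i).choose_spec x

end DirectSum

end

section Fock

variable {A : Type u} [NonUnitalCStarAlgebra A] [PartialOrder A] [StarOrderedRing A]

/-- The tensor powers `E^{⊗ n}`, with `E^{⊗ 0} = A` and `E^{⊗ (n + 1)} = E ⊗ E^{⊗ n}`. -/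
noncomputable def powT (E : Corr.{u, u, u} A A) : ℕ → Corr.{u, u, u} A A
  | 0 => Corr.self A
  | n + 1 => E ⊠ powT E n

/-- The Fock space `F(E) = ⨁ₙ E^{⊗ n}`. -/
noncomputable def Fock (E : Corr.{u, u, u} A A) : Corr.{u, u, u} A A := Corr.dsum (powT E)

lemma dense_create (E : Corr.{u, u, u} A A) :
    closure (Submodule.span ℂ (Set.range fun p : E × (Σ n, powT E n) =>
      tmul (Y := Fock E) p.1 (single (powT E) p.2.1 p.2.2)) : Set (E ⊠ Fock E : Corr A A)) = Set.univ :=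
  dense_tmul_of_dense (X := E) (Y := Fock E) (a := fun x : E => x)
    (b := fun p : Σ n, powT E n => single (powT E) p.1 p.2) (dense_id E) (dense_single (powT E))

lemma exists_create (E : Corr.{u, u, u} A A) : ∃ F : Hom (E ⊠ Fock E) (Fock E),
    ∀ p : E × (Σ n, powT E n), F (tmul (Y := Fock E) p.1 (single (powT E) p.2.1 p.2.2)) =
      single (powT E) (p.2.1 + 1) (tmul p.1 p.2.2 : (E ⊠ powT E p.2.1 : Corr A A)) :=
  Hom.exists_ofGen (Y := Fock E)
    (fun p : E × (Σ n, powT E n) => tmul (Y := Fock E) p.1 (single (powT E) p.2.1 p.2.2))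
    (fun p => single (powT E) (p.2.1 + 1) (tmul p.1 p.2.2 : (E ⊠ powT E p.2.1 : Corr A A)))
    (dense_create E)
    (fun p q => by
      obtain ⟨e, n, x⟩ := p
      obtain ⟨e', m, x'⟩ := q
      refine Eq.trans ?_ (ip_tmul (Y := Fock E) e e' (single (powT E) n x)
        (single (powT E) m x')).symm
      have h : (Fock E).ls (E.ip e e') (single (powT E) m x') =
        single (powT E) m ((powT E m).ls (E.ip e e') x') := ls_single _ _ _ _
      rw [h]
      by_cases hnm : n = m
      · subst hnm
        exact (ip_single_self (powT E) (n + 1) _ _).trans ((ip_tmul _ _ _ _).trans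
          (ip_single_self (powT E) n _ _).symm)
      · exact (ip_single_ne (powT E) (by simpa using hnm) _ _).trans
          (ip_single_ne (powT E) hnm _ _).symm)
    (fun a p => ⟨(E.ls a p.1, p.2), (ls_tmul _ _ _).symm,
      ((ls_single (powT E) a (p.2.1 + 1) _).trans (congrArg _ (ls_tmul _ _ _))).symm⟩)
    inferInstance

/-- The creation operators `ξ ⊗ η ↦ V_ξ η`, where `V_ξ (ξ₁ ⊗ ⋯ ⊗ ξₙ) = ξ ⊗ ξ₁ ⊗ ⋯ ⊗ ξₙ`. -/
noncomputable def create (E : Corr.{u, u, u} A A) : Hom (E ⊠ Fock E) (Fock E) :=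
  (exists_create E).choose

lemma create_tmul_single (E : Corr.{u, u, u} A A) (e : E) (n : ℕ) (x : powT E n) :
    create E (tmul (Y := Fock E) e (single (powT E) n x)) =
      single (powT E) (n + 1) (tmul e x : (E ⊠ powT E n : Corr A A)) :=
  (exists_create E).choose_spec (e, ⟨n, x⟩)

/-- The operator `S̃ : E ⊗ (F(E) ⊗ W) → F(E) ⊗ W`, `S̃ (ξ ⊗ η ⊗ w) = V_ξ η ⊗ w`, of the induced
representation of `E` on `F(E) ⊗ W`.  The representation `ρ(a) = φ_∞(a) ⊗ I` is the left action of
`A` on `F(E) ⊗ W`. -/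
noncomputable def indS (E : Corr.{u, u, u} A A) (W : Corr.{u, 0, v} A ℂ) :
    Hom (E ⊠ (Fock E ⊠ W)) (Fock E ⊠ W) :=
  (tmap (create E) (Hom.id W)).comp (assoc E (Fock E) W).symm.toHom

/-- The embedding `W = A ⊗ W ⊆ F(E) ⊗ W` onto the vacuum part. -/
noncomputable def vac (E : Corr.{u, u, u} A A) (W : Corr.{u, 0, v} A ℂ) : Hom W (Fock E ⊠ W) :=
  (tmap (incl (powT E) 0) (Hom.id W)).comp (lunit W).symm.toHom

/-- The operators `f_n : E^{⊗ n} ⊗ H → H`, `f_0 (a ⊗ h) = a h`, `f_{n+1} = f (I ⊗ f_n)`,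
so that `f_n (ξ₁ ⊗ ⋯ ⊗ ξₙ ⊗ h) = V(ξ₁) ⋯ V(ξₙ) h` if `f (ξ ⊗ h) = V(ξ) h`. -/
noncomputable def iter {E : Corr.{u, u, u} A A} {H : Corr.{u, 0, v} A ℂ} (f : Hom (E ⊠ H) H) :
    ∀ n : ℕ, Hom (powT E n ⊠ H) H
  | 0 => (lunit H).toHom
  | n + 1 => f.comp ((tmap (Hom.id E) (iter f n)).comp (assoc E (powT E n) H).toHom)

/-- The isomorphism `X ⊗ E^{⊗ n} → E^{⊗ n} ⊗ X` composed of `n` copies of `t : X ⊗ E → E ⊗ X`. -/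
noncomputable def tpow {X E : Corr.{u, u, u} A A} (t : Iso (X ⊠ E) (E ⊠ X)) :
    ∀ n : ℕ, Iso (X ⊠ powT E n) (powT E n ⊠ X)
  | 0 => (runit X).trans (lunit X).symm
  | n + 1 => (assoc X E (powT E n)).symm.trans ((tmapIso t (Iso.refl (powT E n))).trans
      ((assoc E X (powT E n)).trans ((tmapIso (Iso.refl E) (tpow t n)).trans
        (assoc E (powT E n) X).symm)))

end Fock

section Hilbert

variable {A : Type u} [NonUnitalCStarAlgebra A] {B : Type w} [NonUnitalCStarAlgebra B]

/-- A correspondence from `A` to `ℂ` is a Hilbert space. -/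
noncomputable instance (H : Corr.{u, 0, v} A ℂ) : InnerProductSpace ℂ H where
  toNormedSpace := H.spc
  inner x y := H.ip x y
  norm_sq_eq_re_inner x := by
    have h := (Complex.nonneg_iff.1 (H.ip_nonneg x))
    have h2 : H.ip x x = ((H.ip x x).re : ℂ) := Complex.ext rfl (by simp [← h.2])
    rw [H.norm_sq, h2, Complex.norm_of_nonneg h.1]; simp
  conj_inner_symm x y := H.star_ip y x
  add_left := H.add_ip
  smul_left x y c := H.smul_ip c x y

lemma Corr.inner_eq (H : Corr.{u, 0, v} A ℂ) (x y : H) : ⟪x, y⟫_ℂ = H.ip x y := rfl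

/-- A Hilbert space with a nondegenerate `*`-representation of `A`, as a correspondence from `A`
to `ℂ`. -/
noncomputable def Corr.ofRep {H : Type v} [NormedAddCommGroup H] [InnerProductSpace ℂ H]
    [CompleteSpace H] (σ : A →⋆ₙₐ[ℂ] (H →L[ℂ] H))
    (hσ : closure (Submodule.span ℂ {y | ∃ a x, y = σ a x} : Set H) = Set.univ) :
    Corr.{u, 0, v} A ℂ where
  carrier := H
  ip x y := ⟪x, y⟫_ℂ
  rs x c := c • x
  ls a x := σ a x
  ip_add := inner_add_right
  ip_smul c x y := inner_smul_right x y c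
  star_ip x y := inner_conj_symm y x
  ip_rs x y c := by rw [inner_smul_right, mul_comm]
  ip_nonneg x := by
    rw [inner_self_eq_norm_sq_to_K]
    exact pow_nonneg (Complex.zero_le_real.2 (norm_nonneg x)) 2
  norm_sq x := by rw [inner_self_eq_norm_sq_to_K]; simp
  add_ls a a' x := by simp
  smul_ls c a x := by simp
  mul_ls a a' x := by simp
  ip_ls a x y := by
    rw [map_star, ContinuousLinearMap.star_eq_adjoint, ContinuousLinearMap.adjoint_inner_right]
  nondeg := hσ

/-- A closed subspace invariant under the representation of `A`. -/
structure InvSub (H : Corr.{u, 0, v} A ℂ) where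
  sub : Submodule ℂ H
  closed : IsClosed (sub : Set H)
  inv : ∀ a, ∀ x ∈ sub, H.ls a x ∈ sub

namespace InvSub

variable {H : Corr.{u, 0, v} A ℂ}

/-- The subspace with the restricted representation of `A`. -/
noncomputable def corr (p : InvSub H) : Corr.{u, 0, v} A ℂ where
  carrier := p.sub
  cpl := p.closed.completeSpace_coe
  ip x y := H.ip x y
  rs x c := c • x
  ls a x := ⟨H.ls a x, p.inv a x x.2⟩
  ip_add x y z := H.ip_add x y z
  ip_smul c x y := H.ip_smul c x y
  star_ip x y := H.star_ip x y
  ip_rs x y c := (H.ip_smul c x y).trans (mul_comm _ _)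
  ip_nonneg x := H.ip_nonneg x
  norm_sq x := H.norm_sq x
  add_ls a a' x := Subtype.ext (H.add_ls a a' x)
  smul_ls c a x := Subtype.ext (H.smul_ls c a x)
  mul_ls a a' x := Subtype.ext (H.mul_ls a a' x)
  ip_ls a x y := H.ip_ls a x y
  nondeg := by
    refine Set.eq_univ_of_forall fun x => Metric.mem_closure_iff.2 fun ε hε => ?_
    obtain ⟨a, ha⟩ := H.exists_near (x : H) hε
    refine ⟨⟨H.ls a x, p.inv a x x.2⟩, Submodule.subset_span ⟨a, x, rfl⟩, ?_⟩
    rw [dist_comm, dist_eq_norm]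
    exact ha

/-- The inclusion of an invariant subspace. -/
noncomputable def incl (p : InvSub H) : Hom p.corr H where
  toLin := p.sub.subtype
  ip_map _ _ := rfl
  ls_map _ _ := rfl

/-- The inclusion between nested invariant subspaces. -/
noncomputable def le {p q : InvSub H} (h : p.sub ≤ q.sub) : Hom p.corr q.corr where
  toLin := Submodule.inclusion h
  ip_map _ _ := rfl
  ls_map _ _ := rfl

end InvSub

namespace Hom

variable {X : Corr.{u, 0, v} A ℂ} {H : Corr.{u, 0, w} A ℂ}

/-- The range of an isometric bimodule map. -/
noncomputable def rangeSub (f : Hom X H) : InvSub H where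
  sub := LinearMap.range f.toLin
  closed := f.isClosed_range
  inv := by
    rintro a _ ⟨x, rfl⟩
    exact ⟨X.ls a x, f.ls_map a x⟩

/-- The orthogonal complement of the range. -/
noncomputable def wander (f : Hom X H) : InvSub H where
  sub := (LinearMap.range f.toLin)ᗮ
  closed := Submodule.isClosed_orthogonal _
  inv a x hx := by
    rw [Submodule.mem_orthogonal] at hx ⊢
    rintro _ ⟨y, rfl⟩
    rw [Corr.inner_eq, H.ip_ls', ← f.ls_map]
    exact hx _ ⟨_, rfl⟩

/-- An isometric bimodule map as a unitary onto its range. -/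
noncomputable def toRange (f : Hom X H) : Iso X f.rangeSub.corr where
  toLin := f.toLin.rangeRestrict
  ip_map := f.ip_map
  ls_map a x := Subtype.ext (f.ls_map a x)
  surj := f.toLin.surjective_rangeRestrict

end Hom

/-- Two isometric maps `f : X → Z`, `g : Y → Z` exhibit `Z` as the orthogonal direct sum of the
ranges of `f` and `g`. -/
def IsOrthSum {X : Corr.{u, 0, w₁} A ℂ} {Y : Corr.{u, 0, w₂} A ℂ} {Z : Corr.{u, 0, w₃} A ℂ}
    (f : Hom X Z) (g : Hom Y Z) : Prop :=
  (∀ x y, ⟪f x, g y⟫_ℂ = 0) ∧ ∀ z, ∃ x y, z = f x + g y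

variable [PartialOrder B] [StarOrderedRing B]

/-- An isometric bimodule map `Θ : X → B(W, Z)`, i.e. a linear map with
`Θ(a x b) = ρ(a) Θ(x) π(b)` and `Θ(x)* Θ(y) = π(⟨x, y⟩)`, where `π` and `ρ` are the
representations on `W` and `Z`.  If `X` is a correspondence over `A` and `W = Z = H` with
representation `σ`, then `(σ, Θ)` is an isometric covariant representation of `X` on `H`. -/
structure IsoBimod (X : Corr.{u, w, w₁} A B) (W : Corr.{w, 0, w₂} B ℂ) (Z : Corr.{u, 0, w₃} A ℂ) where
  op : X →ₗ[ℂ] (W →L[ℂ] Z)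
  op_ls : ∀ a x, op (X.ls a x) = Z.lsL a ∘L op x
  op_rs : ∀ x b, op (X.rs x b) = op x ∘L W.lsL b
  op_adj : ∀ x y, ContinuousLinearMap.adjoint (op x) ∘L op y = W.lsL (X.ip x y)

namespace IsoBimod

variable {X : Corr.{u, w, w₁} A B} {W : Corr.{w, 0, w₂} B ℂ} {Z : Corr.{u, 0, w₃} A ℂ}

lemma exists_tilde (Θ : IsoBimod X W Z) :
    ∃ F : Hom (X ⊠ W) Z, ∀ p : X × W, F (tmul p.1 p.2) = Θ.op p.1 p.2 :=
  Hom.exists_ofGen (fun p : X × W => tmul p.1 p.2) (fun p => Θ.op p.1 p.2) dense_tmul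
    (fun p q => by
      rw [ip_tmul, ← Corr.inner_eq, ← Corr.inner_eq, ← Corr.lsL_apply, ← Θ.op_adj,
        ContinuousLinearMap.comp_apply, ContinuousLinearMap.adjoint_inner_right])
    (fun a p => ⟨(X.ls a p.1, p.2), (ls_tmul _ _ _).symm, by rw [Θ.op_ls]; rfl⟩)
    inferInstance

/-- The isometry `Θ̃ : X ⊗ W → Z`, `Θ̃ (x ⊗ w) = Θ(x) w`. -/
noncomputable def tilde (Θ : IsoBimod X W Z) : Hom (X ⊠ W) Z := Θ.exists_tilde.choose

@[simp] lemma tilde_tmul (Θ : IsoBimod X W Z) (x : X) (w : W) :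
    Θ.tilde (tmul x w) = Θ.op x w := Θ.exists_tilde.choose_spec (x, w)

end IsoBimod

end Hilbert

section Covariant

/-- A product system over `ℕ₀²`: two correspondences and a unitary `t_{2,1}`.  The other
isomorphisms are `t_{1,2} = t_{2,1}⁻¹` and `t_{i,i} = id`. -/
structure ProductSystem (A : Type u) [NonUnitalCStarAlgebra A] [PartialOrder A]
    [StarOrderedRing A] where
  E₁ : Corr.{u, u, u} A A
  E₂ : Corr.{u, u, u} A A
  t : Iso (E₂ ⊠ E₁) (E₁ ⊠ E₂)

variable {A : Type u} [NonUnitalCStarAlgebra A] [PartialOrder A] [StarOrderedRing A]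

namespace ProductSystem

variable (P : ProductSystem A)

/-- `E = E₁ ⊗ E₂`. -/
noncomputable def E : Corr.{u, u, u} A A := P.E₁ ⊠ P.E₂

/-- The isomorphism `(I ⊗ t_{1,2}) (t_{1,1} ⊗ I) : E₁ ⊗ E → E ⊗ E₁`. -/
noncomputable def t₁ : Iso (P.E₁ ⊠ P.E) (P.E ⊠ P.E₁) :=
  (tmapIso (Iso.refl P.E₁) P.t.symm).trans (assoc P.E₁ P.E₂ P.E₁).symm

/-- The isomorphism `(I ⊗ t_{2,2}) (t_{2,1} ⊗ I) : E₂ ⊗ E → E ⊗ E₂`. -/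
noncomputable def t₂ : Iso (P.E₂ ⊠ P.E) (P.E ⊠ P.E₂) :=
  (assoc P.E₂ P.E₁ P.E₂).symm.trans (tmapIso P.t (Iso.refl P.E₂))

end ProductSystem

/-- An isometric covariant representation `(σ, V⁽¹⁾, V⁽²⁾)` of a product system on the Hilbert
space `H`, which carries the representation `σ` of `A`:
`Ṽ⁽²⁾ (I ⊗ Ṽ⁽¹⁾) = Ṽ⁽¹⁾ (I ⊗ Ṽ⁽²⁾) (t_{2,1} ⊗ I)`. -/
structure IsoCovRep (P : ProductSystem A) (H : Corr.{u, 0, v} A ℂ) where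
  V₁ : IsoBimod P.E₁ H H
  V₂ : IsoBimod P.E₂ H H
  comm : ∀ x : ((P.E₂ ⊠ P.E₁) ⊠ H : Corr A ℂ),
    V₂.tilde (tmap (Hom.id P.E₂) V₁.tilde (assoc P.E₂ P.E₁ H x)) =
      V₁.tilde (tmap (Hom.id P.E₁) V₂.tilde
        (assoc P.E₁ P.E₂ H (tmap P.t.toHom (Hom.id H) x)))

/-- Tensoring with maps of orthogonal ranges gives maps of orthogonal ranges. -/
lemma tmap_orth {B : Type w} [NonUnitalCStarAlgebra B] [PartialOrder B] [StarOrderedRing B]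
    {X : Corr.{u, u, w₁} A A} {Y : Corr.{u, w, w₂} A B} {Z : Corr.{u, w, w₃} A B}
    {H : Corr.{u, w, w₄} A B} (f : Hom Y H) (g : Hom Z H) (h : ∀ y z, H.ip (f y) (g z) = 0)
    (x : (X ⊠ Y : Corr A B)) (x' : (X ⊠ Z : Corr A B)) :
    (X ⊠ H).ip (tmap (Hom.id X) f x) (tmap (Hom.id X) g x') = 0 := by
  have key : ∀ (F : (X ⊠ Z : Corr A B) →L[ℂ] B), (∀ p : X × Z, F (tmul p.1 p.2) = 0) →
      ∀ z, F z = 0 := by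
    intro F hF z
    have h1 : Set.EqOn F (0 : (X ⊠ Z : Corr A B) →L[ℂ] B) (closure (Submodule.span ℂ
        (Set.range fun p : X × Z => tmul p.1 p.2) : Set (X ⊠ Z : Corr A B))) :=
      ContinuousLinearMap.eqOn_closure_span (by rintro _ ⟨p, rfl⟩; exact hF p)
    exact h1 (by rw [dense_tmul]; trivial)
  have key' : ∀ (F : (X ⊠ Y : Corr A B) →L⋆[ℂ] B), (∀ p : X × Y, F (tmul p.1 p.2) = 0) →
      ∀ z, F z = 0 := by
    intro F hF z
    have h1 : Set.EqOn F (0 : (X ⊠ Y : Corr A B) →L⋆[ℂ] B) (closure (Submodule.span ℂ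
        (Set.range fun p : X × Y => tmul p.1 p.2) : Set (X ⊠ Y : Corr A B))) :=
      ContinuousLinearMap.eqOn_closure_span (by rintro _ ⟨p, rfl⟩; exact hF p)
    exact h1 (by rw [dense_tmul]; trivial)
  let L := LinearMap.mkContinuous₂ (X ⊠ H).ipL 1
    (fun x y => by simpa [Corr.ipL_apply] using (X ⊠ H).norm_ip_le x y)
  have hL : ∀ a b, L a b = (X ⊠ H).ip a b := fun _ _ => rfl
  have h1 : ∀ (e : X) (y : Y) z', (X ⊠ H).ip (tmul e (f y)) (tmap (Hom.id X) g z') = 0 := by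
    intro e y
    refine key ((L (tmul e (f y))).comp (tmap (Hom.id X) g).toCLM) fun p => ?_
    simp only [ContinuousLinearMap.comp_apply, Hom.toCLM_apply, tmap_tmul, hL, ip_tmul,
      ← g.ls_map, h]
  refine key' ((L.flip (tmap (Hom.id X) g x')).comp (tmap (Hom.id X) f).toCLM) (fun p => ?_) x
  simp only [ContinuousLinearMap.comp_apply, Hom.toCLM_apply, tmap_tmul,
    ContinuousLinearMap.flip_apply, hL, h1]

namespace IsoCovRep

variable {P : ProductSystem A} {H : Corr.{u, 0, v} A ℂ} (V : IsoCovRep P H)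

/-- `Ṽ = Ṽ⁽¹⁾ (I ⊗ Ṽ⁽²⁾) : E ⊗ H → H`. -/
noncomputable def tilde : Hom (P.E ⊠ H) H :=
  V.V₁.tilde.comp ((tmap (Hom.id P.E₁) V.V₂.tilde).comp (assoc P.E₁ P.E₂ H).toHom)

/-- Purity: `Ṽ_n Ṽ_n* → 0` in the strong operator topology. -/
def IsPure : Prop :=
  ∀ h : H, Tendsto
    (fun n => iter V.tilde n (ContinuousLinearMap.adjoint (iter V.tilde n).toCLM h)) atTop (𝓝 0)

/-- The wandering subspace `𝒲 = H ⊖ Ṽ(E ⊗ H)`. -/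
noncomputable def W : InvSub H := V.tilde.wander

/-- The wandering subspace `𝒲₁ = H ⊖ Ṽ⁽¹⁾(E₁ ⊗ H)`. -/
noncomputable def W₁ : InvSub H := V.V₁.tilde.wander

/-- The wandering subspace `𝒲₂ = H ⊖ Ṽ⁽²⁾(E₂ ⊗ H)`. -/
noncomputable def W₂ : InvSub H := V.V₂.tilde.wander

/-- The restriction of `Ṽ⁽¹⁾` to `E₁ ⊗ 𝒲₂`. -/
noncomputable def r₁ : Hom (P.E₁ ⊠ V.W₂.corr) H :=
  V.V₁.tilde.comp (tmap (Hom.id P.E₁) V.W₂.incl)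

/-- The restriction of `Ṽ⁽²⁾` to `E₂ ⊗ 𝒲₁`. -/
noncomputable def r₂ : Hom (P.E₂ ⊠ V.W₁.corr) H :=
  V.V₂.tilde.comp (tmap (Hom.id P.E₂) V.W₁.incl)

/-- The subspace `Ṽ⁽¹⁾(E₁ ⊗ 𝒲₂)`. -/
noncomputable def L₁ : InvSub H := V.r₁.rangeSub

/-- The subspace `Ṽ⁽²⁾(E₂ ⊗ 𝒲₁)`. -/
noncomputable def L₂ : InvSub H := V.r₂.rangeSub

lemma tilde_eq (x : (P.E ⊠ H : Corr A ℂ)) : ∃ y : (P.E₂ ⊠ (P.E₁ ⊠ H) : Corr A ℂ),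
    V.tilde x = V.V₂.tilde (tmap (Hom.id P.E₂) V.V₁.tilde y) := by
  obtain ⟨z, hz⟩ := (tmapIso P.t (Iso.refl H)).surj x
  refine ⟨assoc P.E₂ P.E₁ H z, ?_⟩
  rw [V.comm]
  subst hz; rfl

lemma W₁_le : V.W₁.sub ≤ V.W.sub := by
  refine Submodule.orthogonal_le ?_
  rintro _ ⟨x, rfl⟩
  exact ⟨_, rfl⟩

lemma W₂_le : V.W₂.sub ≤ V.W.sub := by
  refine Submodule.orthogonal_le ?_
  rintro _ ⟨x, rfl⟩
  obtain ⟨y, hy⟩ := V.tilde_eq x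
  exact ⟨_, hy.symm⟩

lemma L₁_le : V.L₁.sub ≤ V.W.sub := by
  rintro _ ⟨x, rfl⟩
  refine (Submodule.mem_orthogonal _ _).2 ?_
  rintro _ ⟨y, rfl⟩
  refine (V.V₁.tilde.ip_map _ _).trans (tmap_orth V.V₂.tilde V.W₂.incl ?_ _ _)
  intro a b
  exact (Submodule.mem_orthogonal _ _).1 b.2 _ ⟨a, rfl⟩

lemma L₂_le : V.L₂.sub ≤ V.W.sub := by
  rintro _ ⟨x, rfl⟩
  refine (Submodule.mem_orthogonal _ _).2 ?_
  rintro _ ⟨y, rfl⟩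
  obtain ⟨z, hz⟩ := V.tilde_eq y
  have hz' : V.tilde.toLin y = V.V₂.tilde (tmap (Hom.id P.E₂) V.V₁.tilde z) := hz
  rw [hz']
  refine (V.V₂.tilde.ip_map _ _).trans (tmap_orth V.V₁.tilde V.W₁.incl ?_ _ _)
  intro a b
  exact (Submodule.mem_orthogonal _ _).1 b.2 _ ⟨a, rfl⟩

/-- The restriction of `Ṽ⁽¹⁾*` to `Ṽ⁽¹⁾(E₁ ⊗ 𝒲₂)`, with values in `E₁ ⊗ 𝒲₂`; see
`adj₁_spec`. -/
noncomputable def adj₁ : Hom V.L₁.corr (P.E₁ ⊠ V.W₂.corr) := V.r₁.toRange.symm.toHom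

/-- The restriction of `Ṽ⁽²⁾*` to `Ṽ⁽²⁾(E₂ ⊗ 𝒲₁)`, with values in `E₂ ⊗ 𝒲₁`; see
`adj₂_spec`. -/
noncomputable def adj₂ : Hom V.L₂.corr (P.E₂ ⊠ V.W₁.corr) := V.r₂.toRange.symm.toHom

lemma adjoint_map {X : Corr.{u, 0, w₁} A ℂ} {Y : Corr.{u, 0, w₂} A ℂ} (f : Hom X Y) (x : X) :
    ContinuousLinearMap.adjoint f.toCLM (f x) = x :=
  ext_inner_left ℂ fun y => by
    rw [ContinuousLinearMap.adjoint_inner_right]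
    exact f.ip_map y x

lemma adj₁_spec (l : V.L₁.corr) : tmap (Hom.id P.E₁) V.W₂.incl (V.adj₁ l) =
    ContinuousLinearMap.adjoint V.V₁.tilde.toCLM (V.L₁.incl l) := by
  obtain ⟨x, rfl⟩ := V.r₁.toRange.surj l
  have h : V.adj₁ (V.r₁.toRange x) = x := V.r₁.toRange.symm_apply_apply x
  rw [h]
  exact (adjoint_map V.V₁.tilde (tmap (Hom.id P.E₁) V.W₂.incl x)).symm

lemma adj₂_spec (l : V.L₂.corr) : tmap (Hom.id P.E₂) V.W₁.incl (V.adj₂ l) =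
    ContinuousLinearMap.adjoint V.V₂.tilde.toCLM (V.L₂.incl l) := by
  obtain ⟨x, rfl⟩ := V.r₂.toRange.surj l
  have h : V.adj₂ (V.r₂.toRange x) = x := V.r₂.toRange.symm_apply_apply x
  rw [h]
  exact (adjoint_map V.V₂.tilde (tmap (Hom.id P.E₂) V.W₁.incl x)).symm

/-- The Hilbert space `F(E) ⊗ 𝒲` with its representation `ρ` of `A`. -/
noncomputable abbrev model : Corr.{u, 0, max u v} A ℂ := Fock P.E ⊠ V.W.corr

/-- `S̃` restricted to `E ⊗ 𝒲 ⊆ E ⊗ (F(E) ⊗ 𝒲)`, where `S` is the induced representation of `E`. -/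
noncomputable def indSW : Hom (P.E ⊠ V.W.corr) V.model :=
  (indS P.E V.W.corr).comp (tmap (Hom.id P.E) (vac P.E V.W.corr))

end IsoCovRep

/-- `M = M_Θ` for an isometric bimodule map `Θ : X → B(W, F(E) ⊗ W)`:
`M(ξ) S_n(ξ_n) h = S̃_n (I ⊗ Θ̃) (t^{(n)} ⊗ I) (ξ ⊗ ξ_n ⊗ h)` for all `n`, where
`t^{(n)} : X ⊗ E^{⊗ n} → E^{⊗ n} ⊗ X` is composed of copies of `t : X ⊗ E → E ⊗ X`.  (The vectors
`S_n(ξ_n) h` span a dense subspace, so `M` is determined by `Θ`.) -/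
def IsMult {X E : Corr.{u, u, u} A A} {W : Corr.{u, 0, v} A ℂ} (t : Iso (X ⊠ E) (E ⊠ X))
    (Θ : IsoBimod X W (Fock E ⊠ W)) (M : IsoBimod X (Fock E ⊠ W) (Fock E ⊠ W)) : Prop :=
  ∀ (n : ℕ) (ξ : X) (x : (powT E n ⊠ W : Corr A ℂ)),
    M.op ξ (iter (indS E W) n (tmap (Hom.id (powT E n)) (vac E W) x)) =
      iter (indS E W) n (tmap (Hom.id (powT E n)) Θ.tilde
        (assoc (powT E n) X W (tmap (tpow t n).toHom (Hom.id W)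
          ((assoc X (powT E n) W).symm (tmul ξ x)))))

/-- `U : H → F(E) ⊗ 𝒲` is the Wold-von Neumann decomposition of the pure representation `V`:
the unitary that intertwines the representations of `A` and satisfies
`U Ṽ_n (η ⊗ w) = S̃_n (η ⊗ w)` for `η ∈ E^{⊗ n}` and `w ∈ 𝒲`. -/
def IsWold {P : ProductSystem A} {H : Corr.{u, 0, v} A ℂ} (V : IsoCovRep P H)
    (U : Iso H V.model) : Prop :=
  ∀ (n : ℕ) (x : (powT P.E n ⊠ V.W.corr : Corr A ℂ)),
    U (iter V.tilde n (tmap (Hom.id (powT P.E n)) V.W.incl x)) =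
      iter (indS P.E V.W.corr) n (tmap (Hom.id (powT P.E n)) (vac P.E V.W.corr) x)

/-- `M = (ρ, M_{Θ₁}, M_{Θ₂})` is the BCL-representation of `V` with symbols `Θ₁, Θ₂`: it is the
isometric covariant representation on `F(E) ⊗ 𝒲` with `U V⁽ⁱ⁾(ξ) U* = M_{Θᵢ}(ξ)`, where `U` is the
Wold-von Neumann decomposition of `V`. -/
structure IsBCL {P : ProductSystem A} {H : Corr.{u, 0, v} A ℂ} (V : IsoCovRep P H)
    (M : IsoCovRep P V.model) (Θ₁ : IsoBimod P.E₁ V.W.corr V.model)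
    (Θ₂ : IsoBimod P.E₂ V.W.corr V.model) : Prop where
  mult₁ : IsMult P.t₁ Θ₁ M.V₁
  mult₂ : IsMult P.t₂ Θ₂ M.V₂
  wold : ∃ U : Iso H V.model, IsWold V U ∧
    (∀ ξ h, U (V.V₁.op ξ h) = M.V₁.op ξ (U h)) ∧ (∀ ξ h, U (V.V₂.op ξ h) = M.V₂.op ξ (U h))

end Covariant

end CStarCorr

open CStarCorr

/-! Wold decomposition. Since `Ṽ` is isometric and `𝒲` is orthogonal to its range, the subspaces
`Ṽ_n(E^{⊗ n} ⊗ 𝒲)` are pairwise orthogonal. A vector orthogonal to all of them lies in the range of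
every `Ṽ_n`, hence is fixed by every `Ṽ_n Ṽ_n*`, and purity makes it zero. The model has the same
structure, with `S̃` and the vacuum copy of `𝒲`. Matching degree by degree gives the unitary `U`
(`exists_wold`), and `U Ṽ = S̃ (I ⊗ U)` (`IsWold.comp_tilde`).

Existence and purity. The covariance relation lets `Ṽ⁽ⁱ⁾` pass `Ṽ` at the cost of the twist
`t_{i,𝟏}` (`comm_left`, `comm_right`). So `U V⁽ⁱ⁾ U*` passes `S̃` with the same twist and, by
iteration, `S̃_n` with the `n`-fold twist (`iter_comm`). A map with this property is determined on
the `n`-th level by its values on the vacuum, which is the equation defining `M_Θ`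
(`isMult_of_comm`). Purity is a unitary invariant.

Decompositions of `𝒲`. The range of `Ṽ` is also that of `Ṽ⁽²⁾(I ⊗ Ṽ⁽¹⁾)`. Split a vector of `𝒲`
along the range of `Ṽ⁽²⁾` and `𝒲₂`, and then the coordinate in `E₂ ⊗ H` along the range of `Ṽ⁽¹⁾`
and `𝒲₁`; the part coming from `E₂ ⊗ Ṽ⁽¹⁾(E₁ ⊗ H)` vanishes by orthogonality (`exists_add_wander`).
The other decomposition is symmetric, and tensoring with `Eᵢ` preserves orthogonal sums
(`IsOrthSum.tmap_id_left`).

Symbols. In any BCL-representation `Θ̃ᵢ` is `U Ṽ⁽ⁱ⁾` on `Eᵢ ⊗ 𝒲` (`IsWold.symbol_tilde`), so the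
formulas can be verified in `H`. On `E₁ ⊗ 𝒲₂` the values of `Ṽ⁽¹⁾` lie in `𝒲`, where `U` is the
vacuum embedding. On `E₁ ⊗ Ṽ⁽²⁾(E₂ ⊗ 𝒲₁)`, undoing `Ṽ⁽²⁾` by its adjoint turns `Ṽ⁽¹⁾` into `Ṽ` on `E
⊗ 𝒲₁`, which `U` carries to `S̃`. For `Θ̃₂` the factors occur in the order `E₂ ⊗ E₁`, whence
`t_{2,1}`. -/

namespace CStarCorr

set_option linter.unusedSectionVars false

universe u v w w₁ w₂ w₃ w₄ w₅ w₆

/-! ### Functoriality of the interior tensor product and naturality of its associator. -/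

section Functoriality

variable {A B C D : Type*} [NonUnitalCStarAlgebra A] [NonUnitalCStarAlgebra B]
  [NonUnitalCStarAlgebra C] [NonUnitalCStarAlgebra D] [PartialOrder B] [StarOrderedRing B]
  [PartialOrder C] [StarOrderedRing C] [PartialOrder D] [StarOrderedRing D]

lemma Hom.ext_apply {X : Corr.{_, _, w₁} A B} {Y : Corr.{_, _, w₂} A B} {f g : Hom X Y}
    (h : ∀ x, f x = g x) : f = g := by
  obtain ⟨f, _, _⟩ := f
  obtain ⟨g, _, _⟩ := g
  obtain rfl : f = g := LinearMap.ext h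
  rfl

/-- With its variants below, this reduces coherence identities between composites of `tmap`, `assoc`
and the unit isomorphisms to elementary tensors, where both sides can be evaluated. -/
lemma Hom.ext_tmul {X : Corr.{_, _, w₁} A B} {Y : Corr.{_, _, w₂} B C} {Z : Corr.{_, _, w₃} A C}
    {f g : Hom (X ⊠ Y) Z} (h : ∀ x y, f (tmul x y) = g (tmul x y)) : f = g :=
  Hom.ext_apply (Hom.ext_dense dense_tmul f g fun p => h p.1 p.2)

lemma Hom.ext_tmul₃ {X : Corr.{_, _, w₁} A B} {Y : Corr.{_, _, w₂} B C} {Z : Corr.{_, _, w₃} C D}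
    {T : Corr.{_, _, w₄} A D} {f g : Hom ((X ⊠ Y) ⊠ Z) T}
    (h : ∀ x y z, f (tmul (tmul x y) z) = g (tmul (tmul x y) z)) : f = g :=
  Hom.ext_apply (Hom.ext_dense (dense_tmul₁ X Y Z) f g fun _ => h _ _ _)

variable {A₁ : Type*} [NonUnitalCStarAlgebra A₁] [PartialOrder A₁] [StarOrderedRing A₁]

/-- This bracketing arises whenever the middle factor is itself a product, as `E₁ ⊗ E₂` or `E ⊗ E^{⊗
n}`. -/
lemma Hom.ext_tmul₄ {X : Corr.{_, _, w₁} A B} {Y : Corr.{_, _, w₂} B C} {Z : Corr.{_, _, w₃} C D}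
    {W : Corr.{_, _, w₅} D A₁} {T : Corr.{_, _, w₄} A A₁} {f g : Hom ((X ⊠ (Y ⊠ Z)) ⊠ W) T}
    (h : ∀ x y z t, f (tmul (tmul x (tmul y z)) t) = g (tmul (tmul x (tmul y z)) t)) : f = g :=
  Hom.ext_apply (Hom.ext_dense (dense_tmul_of_dense (dense_tmul₂ X Y Z) (dense_id W)) f g
    fun _ => h _ _ _ _)

lemma tmap_tmap {X : Corr.{_, _, w₁} A B} {X' : Corr.{_, _, w₂} A B} {X'' : Corr.{_, _, w₃} A B}
    {Y : Corr.{_, _, w₄} B C} {Y' : Corr.{_, _, w₅} B C} {Y'' : Corr.{_, _, w₆} B C}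
    (f' : Hom X' X'') (f : Hom X X') (g' : Hom Y' Y'') (g : Hom Y Y') (z : (X ⊠ Y : Corr A C)) :
    tmap f' g' (tmap f g z) = tmap (f'.comp f) (g'.comp g) z := by
  have : (tmap f' g').comp (tmap f g) = tmap (f'.comp f) (g'.comp g) :=
    Hom.ext_tmul fun x y => by simp
  rw [← this]; rfl

@[simp] lemma tmap_id {X : Corr.{_, _, w₁} A B} {Y : Corr.{_, _, w₂} B C} :
    tmap (Hom.id X) (Hom.id Y) = Hom.id (X ⊠ Y) :=
  Hom.ext_tmul fun x y => by simp

@[simp] lemma Hom.id_comp {X : Corr.{_, _, w₁} A B} {Y : Corr.{_, _, w₂} A B} (f : Hom X Y) :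
    (Hom.id Y).comp f = f := rfl

@[simp] lemma Hom.comp_id {X : Corr.{_, _, w₁} A B} {Y : Corr.{_, _, w₂} A B} (f : Hom X Y) :
    f.comp (Hom.id X) = f := rfl

lemma tmap_id_comp {X : Corr.{_, _, w₁} A B} {Y : Corr.{_, _, w₂} B C} {Y' : Corr.{_, _, w₃} B C}
    {Y'' : Corr.{_, _, w₄} B C} (g' : Hom Y' Y'') (g : Hom Y Y') (z : (X ⊠ Y : Corr A C)) :
    tmap (Hom.id X) (g'.comp g) z = tmap (Hom.id X) g' (tmap (Hom.id X) g z) :=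
  (tmap_tmap (Hom.id X) (Hom.id X) g' g z).symm

lemma assoc_tmap {X : Corr.{_, _, w₁} A B} {X' : Corr.{_, _, w₂} A B}
    {Y : Corr.{_, _, w₃} B C} {Y' : Corr.{_, _, w₄} B C} {Z : Corr.{_, _, w₅} C D}
    {Z' : Corr.{_, _, w₆} C D} (f : Hom X X') (g : Hom Y Y') (h : Hom Z Z')
    (z : ((X ⊠ Y) ⊠ Z : Corr A D)) :
    assoc X' Y' Z' (tmap (tmap f g) h z) = tmap f (tmap g h) (assoc X Y Z z) := by
  have : (assoc X' Y' Z').toHom.comp (tmap (tmap f g) h) =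
      (tmap f (tmap g h)).comp (assoc X Y Z).toHom :=
    Hom.ext_tmul₃ fun x y z => by simp
  exact congrArg (fun F : Hom _ _ => F z) this

lemma assoc_tmap_id {X : Corr.{_, _, w₁} A B} {Y : Corr.{_, _, w₂} B C} {Z : Corr.{_, _, w₃} C D}
    {Z' : Corr.{_, _, w₄} C D} (h : Hom Z Z') (z : ((X ⊠ Y) ⊠ Z : Corr A D)) :
    assoc X Y Z' (tmap (Hom.id (X ⊠ Y)) h z) =
      tmap (Hom.id X) (tmap (Hom.id Y) h) (assoc X Y Z z) := by
  rw [← tmap_id, assoc_tmap]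

lemma assoc_symm_tmap {X : Corr.{_, _, w₁} A B} {X' : Corr.{_, _, w₂} A B}
    {Y : Corr.{_, _, w₃} B C} {Y' : Corr.{_, _, w₄} B C} {Z : Corr.{_, _, w₅} C D}
    {Z' : Corr.{_, _, w₆} C D} (f : Hom X X') (g : Hom Y Y') (h : Hom Z Z')
    (z : (X ⊠ (Y ⊠ Z) : Corr A D)) :
    (assoc X' Y' Z').symm (tmap f (tmap g h) z) = tmap (tmap f g) h ((assoc X Y Z).symm z) := by
  apply (assoc X' Y' Z').toHom.injective
  rw [Iso.apply_symm_apply, assoc_tmap, Iso.apply_symm_apply]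

lemma tmapIso_toHom {X : Corr.{_, _, w₁} A B} {X' : Corr.{_, _, w₂} A B}
    {Y : Corr.{_, _, w₃} B C} {Y' : Corr.{_, _, w₄} B C} (f : Iso X X') (g : Iso Y Y') :
    (tmapIso f g).toHom = tmap f.toHom g.toHom := rfl

@[simp] lemma Iso.refl_toHom (X : Corr.{_, _, w₁} A B) : (Iso.refl X).toHom = Hom.id X := rfl

lemma Iso.trans_toHom {X : Corr.{_, _, w₁} A B} {Y : Corr.{_, _, w₂} A B} {Z : Corr.{_, _, w₃} A B}
    (f : Iso X Y) (g : Iso Y Z) : (f.trans g).toHom = g.toHom.comp f.toHom := rfl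

@[simp] lemma Iso.comp_symm {X : Corr.{_, _, w₁} A B} {Y : Corr.{_, _, w₂} A B} (f : Iso X Y) :
    f.toHom.comp f.symm.toHom = Hom.id Y := Hom.ext_apply fun y => by simp

/-- Isometric bimodule maps whose values on families with dense span are orthogonal have
orthogonal ranges. -/
lemma Hom.ip_eq_zero_of_dense {X : Corr.{_, _, w₁} A B} {Y : Corr.{_, _, w₂} A B}
    {Z : Corr.{_, _, w₃} A B} (f : Hom X Z) (g : Hom Y Z) {G G' : Type*} {a : G → X} {b : G' → Y}
    (ha : closure (Submodule.span ℂ (Set.range a) : Set X) = Set.univ)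
    (hb : closure (Submodule.span ℂ (Set.range b) : Set Y) = Set.univ)
    (h : ∀ i j, Z.ip (f (a i)) (g (b j)) = 0) (x : X) (y : Y) : Z.ip (f x) (g y) = 0 := by
  -- The bound 1 is the Cauchy–Schwarz inequality. Continuity in each variable separately allows
  -- passing to the closed span in `Y` first, then in `X`.
  let L := LinearMap.mkContinuous₂ Z.ipL 1
    (fun x y => by simpa [Corr.ipL_apply] using Z.norm_ip_le x y)
  have h1 : ∀ i y, Z.ip (f (a i)) (g y) = 0 := fun i y => by
    have : Set.EqOn ((L (f (a i))).comp g.toCLM) (0 : Y →L[ℂ] B) (closure (Submodule.span ℂ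
        (Set.range b) : Set Y)) :=
      ContinuousLinearMap.eqOn_closure_span (by rintro _ ⟨p, rfl⟩; exact h i p)
    exact this (by rw [hb]; trivial)
  have : Set.EqOn ((L.flip (g y)).comp f.toCLM) (0 : X →L⋆[ℂ] B) (closure (Submodule.span ℂ
      (Set.range a) : Set X)) :=
    ContinuousLinearMap.eqOn_closure_span (by rintro _ ⟨p, rfl⟩; exact h1 p y)
  exact this (by rw [ha]; trivial)

/-- A bimodule isometry with values in the range of another one factors through it. -/
lemma Hom.exists_lift {X : Corr.{_, _, w₁} A B} {Y : Corr.{_, _, w₂} A B} {Z : Corr.{_, _, w₃} A B}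
    (f : Hom X Z) (g : Hom Y Z) (h : ∀ x, ∃ y, g y = f x) : ∃ k : Hom X Y, g.comp k = f := by
  -- Since `g` is injective, the chosen preimages automatically depend linearly on `x` and respect
  -- the left action.
  choose k hk using h
  refine ⟨⟨⟨⟨k, fun x y => g.injective ?_⟩, fun c x => g.injective ?_⟩, fun x y => ?_,
    fun a x => g.injective ?_⟩, Hom.ext_apply hk⟩
  · rw [g.map_add, hk, hk, hk, f.map_add]
  · simp only [RingHom.id_apply, g.map_smul, hk, f.map_smul]
  · rw [← g.ip_map]
    exact (congrArg₂ Z.ip (hk x) (hk y)).trans (f.ip_map x y)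
  · rw [g.ls_map]
    exact (hk _).trans ((f.ls_map a x).trans (congrArg _ (hk x).symm))

end Functoriality

/-! ### Orthogonal sums and tensoring with a correspondence. -/

section OrthogonalSums

variable {A : Type u} [NonUnitalCStarAlgebra A] [PartialOrder A] [StarOrderedRing A]

/-- The range of an isometry on a complete space is closed, so the projection theorem applies. -/
lemma Hom.exists_add_orthogonal {X : Corr.{u, 0, w₁} A ℂ} {Z : Corr.{u, 0, w₂} A ℂ} (f : Hom X Z)
    (z : Z) : ∃ x, ∃ y ∈ (LinearMap.range f.toLin)ᗮ, z = f x + y := by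
  have : CompleteSpace (LinearMap.range f.toLin) := f.isClosed_range.completeSpace_coe
  obtain ⟨_, ⟨x, rfl⟩, y, hy, h⟩ :=
    (LinearMap.range f.toLin).exists_add_mem_mem_orthogonal z
  exact ⟨x, y, hy, h⟩

lemma Hom.isOrthSum_wander {X : Corr.{u, 0, w₁} A ℂ} {Z : Corr.{u, 0, w₂} A ℂ} (f : Hom X Z) :
    IsOrthSum f f.wander.incl :=
  ⟨fun x y => (Submodule.mem_orthogonal _ _).1 y.2 _ ⟨x, rfl⟩, fun z =>
    let ⟨x, y, hy, h⟩ := f.exists_add_orthogonal z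
    ⟨x, ⟨y, hy⟩, h⟩⟩

/-- Orthogonality survives because `⟨e ⊗ y, e' ⊗ y'⟩ = ⟨y, ⟨e, e'⟩ y'⟩` and the ranges are invariant
under `A`. To see that the two ranges fill `E ⊗ Z`, project onto one and then onto the other; the
remainder is orthogonal to every `e ⊗ (f x + g y)`, that is, to every elementary tensor. -/
lemma IsOrthSum.tmap_id_left {E : Corr.{u, u, u} A A} {X : Corr.{u, 0, w₁} A ℂ}
    {Y : Corr.{u, 0, w₂} A ℂ} {Z : Corr.{u, 0, w₃} A ℂ} {f : Hom X Z} {g : Hom Y Z}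
    (h : IsOrthSum f g) : IsOrthSum (tmap (Hom.id E) f) (tmap (Hom.id E) g) := by
  have ho := tmap_orth (X := E) f g h.1
  refine ⟨ho, fun z => ?_⟩
  obtain ⟨x, z', hz', rfl⟩ := (tmap (Hom.id E) f).exists_add_orthogonal z
  obtain ⟨y, t, ht, rfl⟩ := (tmap (Hom.id E) g).exists_add_orthogonal z'
  refine ⟨x, y, ?_⟩
  suffices t = 0 by rw [this, add_zero]
  have hg : ∀ y, (E ⊠ Z).ip (tmap (Hom.id E) g y) t = 0 := fun y =>
    (Submodule.mem_orthogonal _ _).1 ht _ ⟨y, rfl⟩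
  -- The first remainder is `(I ⊗ g) y + t`. It is orthogonal to the range of `I ⊗ f`, and so is its
  -- first summand; hence so is `t`.
  have hf : ∀ x, (E ⊠ Z).ip (tmap (Hom.id E) f x) t = 0 := fun x => by
    have := (Submodule.mem_orthogonal _ _).1 hz' _ ⟨x, rfl⟩
    rw [inner_add_right] at this
    have h0 := ho x y
    rw [← Corr.inner_eq] at h0
    exact (by simpa [h0] using this : ⟪_, t⟫_ℂ = 0)
  refine tensor_eq fun e z => ?_
  obtain ⟨x', y', rfl⟩ := h.2 z
  rw [Corr.ip_zero, tmul_add, Corr.add_ip]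
  have h1 := hf (tmul e x')
  have h2 := hg (tmul e y')
  simp only [tmap_tmul, Hom.id_apply] at h1 h2
  rw [h1, h2, add_zero]

end OrthogonalSums

/-! ### Wold decomposition of a pure isometry `E ⊗ H → H`, and its Fock space model. -/

section Wold

variable {A : Type u} [NonUnitalCStarAlgebra A] [PartialOrder A] [StarOrderedRing A]
  {E : Corr.{u, u, u} A A} {H : Corr.{u, 0, v} A ℂ} {W : Corr.{u, 0, w} A ℂ}

/-- In degree 0 the tensor power is `A`, acting on `H`, and `j` intertwines the actions: `a j(w) =
j(a w)`. -/
lemma iter_zero_tmap (f : Hom (E ⊠ H) H) (j : Hom W H) (x : (powT E 0 ⊠ W : Corr A ℂ)) :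
    iter f 0 (tmap (Hom.id (powT E 0)) j x) = j (lunit W x) := by
  have : (lunit H).toHom.comp (tmap (Hom.id (Corr.self A)) j) = j.comp (lunit W).toHom :=
    Hom.ext_tmul fun a w => by
      rw [Hom.comp_apply, Hom.comp_apply, tmap_tmul]
      exact (lunit_tmul H _ _).trans ((j.ls_map _ _).symm.trans
        (congrArg (fun t => j t) (lunit_tmul W _ _).symm))
  exact congrArg (fun F : Hom _ _ => F x) this

lemma iter_succ (f : Hom (E ⊠ H) H) (n : ℕ) (x : (powT E (n + 1) ⊠ H : Corr A ℂ)) :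
    iter f (n + 1) x = f (tmap (Hom.id E) (iter f n) (assoc E (powT E n) H x)) := rfl

lemma iter_succ_tmap (f : Hom (E ⊠ H) H) (j : Hom W H) (n : ℕ)
    (x : (powT E (n + 1) ⊠ W : Corr A ℂ)) :
    iter f (n + 1) (tmap (Hom.id (powT E (n + 1))) j x) =
      f (tmap (Hom.id E) ((iter f n).comp (tmap (Hom.id (powT E n)) j))
        (assoc E (powT E n) W x)) := by
  rw [iter_succ]
  have : assoc E (powT E n) H (tmap (Hom.id (powT E (n + 1))) j x) =
      tmap (Hom.id E) (tmap (Hom.id (powT E n)) j) (assoc E (powT E n) W x) := assoc_tmap_id j x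
  rw [this, tmap_tmap, Hom.id_comp]

/-- Exhibits `f (e ⊗ ·)` as the shift from degree `n` to degree `n + 1`; on these vectors the Wold
unitary is compared with the creation operators. -/
lemma iter_succ_tmap_assoc_symm (f : Hom (E ⊠ H) H) (j : Hom W H) (n : ℕ) (e : E)
    (x : (powT E n ⊠ W : Corr A ℂ)) :
    iter f (n + 1) (tmap (Hom.id (powT E (n + 1))) j ((assoc E (powT E n) W).symm (tmul e x))) =
      f (tmul e (iter f n (tmap (Hom.id (powT E n)) j x))) := by
  refine (iter_succ_tmap f j n _).trans (congrArg (fun t => f t) ?_)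
  rw [Iso.apply_symm_apply, tmap_tmul]
  rfl

/-- The subspaces `f_n (E^{⊗ n} ⊗ W)` are pairwise orthogonal if `W` is orthogonal to the range
of `f`. -/
lemma iter_orth_of_lt (f : Hom (E ⊠ H) H) (j : Hom W H) (h : ∀ w x, H.ip (j w) (f x) = 0)
    {n m : ℕ} (hnm : n < m) (x : (powT E n ⊠ W : Corr A ℂ)) (y : (powT E m ⊠ W : Corr A ℂ)) :
    H.ip (iter f n (tmap (Hom.id (powT E n)) j x)) (iter f m (tmap (Hom.id (powT E m)) j y)) =
      0 := by
  induction n generalizing m with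
  | zero =>
    obtain ⟨m, rfl⟩ := Nat.exists_eq_succ_of_ne_zero hnm.ne'
    -- Degree 0 lies in `j(W)`, positive degrees in the range of `f`. Higher degrees reduce to this
    -- case by cancelling the outer isometry `f`.
    rw [iter_zero_tmap, iter_succ_tmap, h]
  | succ n ih =>
    obtain ⟨m, rfl⟩ := Nat.exists_eq_succ_of_ne_zero (Nat.ne_zero_of_lt hnm)
    rw [iter_succ_tmap, iter_succ_tmap, f.ip_map]
    exact tmap_orth _ _ (fun x y => ih (Nat.succ_lt_succ_iff.1 hnm) x y) _ _

lemma iter_orth (f : Hom (E ⊠ H) H) (j : Hom W H) (h : ∀ w x, H.ip (j w) (f x) = 0)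
    {n m : ℕ} (hnm : n ≠ m) (x : (powT E n ⊠ W : Corr A ℂ)) (y : (powT E m ⊠ W : Corr A ℂ)) :
    H.ip (iter f n (tmap (Hom.id (powT E n)) j x)) (iter f m (tmap (Hom.id (powT E m)) j y)) =
      0 := by
  rcases hnm.lt_or_gt with h' | h'
  · exact iter_orth_of_lt f j h h' x y
  · rw [← H.star_ip, iter_orth_of_lt f j h h' y x, star_zero]

/-- Tensor powers grow on the left, so `f_{n+1}` is `f (I ⊗ f_n)`, whereas here the extra factor `E`
stands on the right. Only the inclusion of ranges is needed, so no isomorphism `E^{⊗ n} ⊗ E ≅ E ⊗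
E^{⊗ n}` has to be constructed. -/
lemma iter_tmap_mem_range (f : Hom (E ⊠ H) H) (n : ℕ)
    (y : (powT E n ⊠ (E ⊠ H) : Corr A ℂ)) :
    ∃ z, iter f (n + 1) z = iter f n (tmap (Hom.id (powT E n)) f y) := by
  induction n with
  | zero =>
    obtain ⟨z, hz⟩ := ((assoc E (powT E 0) H).trans (tmapIso (Iso.refl E) (lunit H))).surj
      (lunit (E ⊠ H) y)
    exact ⟨z, (congrArg (fun t => f t) hz).trans (iter_zero_tmap f f y).symm⟩
  | succ n ih =>
    -- A pointwise inclusion of ranges cannot be tensored with `E`, but a bimodule map `k` with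
    -- `f_{n+1} k = f_n (I ⊗ f)` can.
    obtain ⟨k, hk⟩ := Hom.exists_lift ((iter f n).comp (tmap (Hom.id (powT E n)) f))
      (iter f (n + 1)) ih
    obtain ⟨z, hz⟩ := (assoc E (powT E (n + 1)) H).surj
      (tmap (Hom.id E) k (assoc E (powT E n) (E ⊠ H) y))
    refine ⟨z, (congrArg (fun t => f (tmap (Hom.id E) (iter f (n + 1)) t)) hz).trans ?_⟩
    rw [iter_succ_tmap, ← hk, tmap_tmap, Hom.id_comp]

/-- For a pure representation the subspaces `f_n (E^{⊗ n} ⊗ W)` span a dense subspace, where `W`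
is the wandering subspace. -/
lemma dense_iter_wander (f : Hom (E ⊠ H) H)
    (hf : ∀ h : H, Tendsto (fun n => iter f n (ContinuousLinearMap.adjoint (iter f n).toCLM h))
      atTop (𝓝 0)) :
    closure (Submodule.span ℂ (Set.range fun p : Σ n, (powT E n ⊠ f.wander.corr : Corr A ℂ) =>
      iter f p.1 (tmap (Hom.id (powT E p.1)) f.wander.incl p.2)) : Set H) = Set.univ := by
  rw [← Submodule.topologicalClosure_coe, ← Submodule.top_coe (R := ℂ), SetLike.coe_set_eq,
    Submodule.topologicalClosure_eq_top_iff, Submodule.eq_bot_iff]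
  intro h hh
  have h0 : ∀ n x, H.ip (iter f n (tmap (Hom.id (powT E n)) f.wander.incl x)) h = 0 :=
    fun n x => (Submodule.mem_orthogonal _ _).1 hh _ (Submodule.subset_span ⟨⟨n, x⟩, rfl⟩)
  -- If `h = f_n z`, split `z` along `E^{⊗ n}` tensored with the range of `f` and with its
  -- complement. Pairing `h` with `f_n` of the second component gives that component's squared norm,
  -- which is therefore 0; the first component is sent into the range of `f_{n+1}`.
  have key : ∀ n, ∃ z, iter f n z = h := by
    intro n
    induction n with
    | zero => exact (lunit H).surj h
    | succ n ih =>
      obtain ⟨z, rfl⟩ := ih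
      have hs := (f.isOrthSum_wander).tmap_id_left (E := powT E n)
      obtain ⟨b, a, rfl⟩ := hs.2 z
      have h1 := h0 n a
      rw [(iter f n).ip_map, Corr.ip_add, ← Corr.inner_eq, ← inner_conj_symm, hs.1, map_zero,
        zero_add, ← Corr.inner_eq, inner_self_eq_zero] at h1
      rw [h1, add_zero]
      exact iter_tmap_mem_range f n b
  -- `f_n` is isometric, so `f_n f_n*` fixes its range. The sequence tending to 0 is thus constantly
  -- `h`.
  have h2 : ∀ n, iter f n (ContinuousLinearMap.adjoint (iter f n).toCLM h) = h := fun n => by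
    obtain ⟨z, rfl⟩ := key n
    rw [IsoCovRep.adjoint_map]
  have h3 := hf h
  simp only [h2] at h3
  exact tendsto_nhds_unique tendsto_const_nhds h3

/-- The two families indexed by `n` and `x ∈ E^{⊗ n} ⊗ W` have equal inner products: in a common
degree both sides are isometric images of the same space, and distinct degrees are orthogonal. Each
family has dense span, so the correspondence of generators extends to a unitary. -/
lemma exists_wold {H' : Corr.{u, 0, w₁} A ℂ} (f : Hom (E ⊠ H) H) (j : Hom W H)
    (f' : Hom (E ⊠ H') H') (j' : Hom W H')
    (h : ∀ w x, H.ip (j w) (f x) = 0) (h' : ∀ w x, H'.ip (j' w) (f' x) = 0)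
    (hd : closure (Submodule.span ℂ (Set.range fun p : Σ n, (powT E n ⊠ W : Corr A ℂ) =>
      iter f p.1 (tmap (Hom.id (powT E p.1)) j p.2)) : Set H) = Set.univ)
    (hd' : closure (Submodule.span ℂ (Set.range fun p : Σ n, (powT E n ⊠ W : Corr A ℂ) =>
      iter f' p.1 (tmap (Hom.id (powT E p.1)) j' p.2)) : Set H') = Set.univ) :
    ∃ U : Iso H H', ∀ n (x : (powT E n ⊠ W : Corr A ℂ)),
      U (iter f n (tmap (Hom.id (powT E n)) j x)) =
        iter f' n (tmap (Hom.id (powT E n)) j' x) := by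
  obtain ⟨F, hF⟩ := Hom.exists_ofGen (X := H) (Y := H')
    (fun p : Σ n, (powT E n ⊠ W : Corr A ℂ) => iter f p.1 (tmap (Hom.id (powT E p.1)) j p.2))
    (fun p => iter f' p.1 (tmap (Hom.id (powT E p.1)) j' p.2)) hd
    (fun p q => by
      obtain ⟨n, x⟩ := p
      obtain ⟨m, y⟩ := q
      by_cases hnm : n = m
      · subst hnm
        simp only [Hom.ip_map]
      · exact (iter_orth f' j' h' hnm x y).trans (iter_orth f j h hnm x y).symm)
    (fun a p => ⟨⟨p.1, (powT E p.1 ⊠ W).ls a p.2⟩, by simp only [Hom.ls_map],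
      by simp only [Hom.ls_map]⟩) inferInstance
  exact ⟨F.toIso _ hd' fun p => ⟨_, hF p⟩, fun n x => hF ⟨n, x⟩⟩

/-- The inclusion of `E^{⊗ n}` into the Fock space. -/
noncomputable def fockIncl (E : Corr.{u, u, u} A A) (n : ℕ) : Hom (powT E n) (Fock E) :=
  incl (powT E) n

lemma dense_fockIncl : closure (Submodule.span ℂ
    (Set.range fun p : Σ n, powT E n => fockIncl E p.1 p.2) : Set (Fock E)) = Set.univ := by
  refine Eq.trans ?_ (dense_single (powT E))
  congr 4
  funext p
  exact incl_apply (powT E) p.1 p.2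

lemma ip_fockIncl_ne {n m : ℕ} (h : n ≠ m) (x : powT E n) (y : powT E m) :
    (Fock E).ip (fockIncl E n x) (fockIncl E m y) = 0 :=
  (congrArg₂ (Fock E).ip (incl_apply (powT E) n x) (incl_apply (powT E) m y)).trans
    (ip_single_ne (powT E) h x y)

lemma create_tmul_fockIncl (e : E) (n : ℕ) (η : powT E n) :
    create E (tmul e (fockIncl E n η)) =
      fockIncl E (n + 1) (tmul e η : (E ⊠ powT E n : Corr A A)) :=
  (congrArg (fun t : Fock E => create E (tmul e t)) (incl_apply (powT E) n η)).trans
    ((create_tmul_single E e n η).trans (incl_apply (powT E) (n + 1) _).symm)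

lemma vac_apply (w : W) : vac E W w = tmap (fockIncl E 0) (Hom.id W) ((lunit W).symm w) := rfl

/-- The vacuum embedding uses the inverse of `A ⊗ W ≅ W` and is explicit only on vectors `a w`;
these span a dense subspace by nondegeneracy. -/
lemma vac_ls (a : A) (w : W) : vac E W (W.ls a w) = tmul (fockIncl E 0 a) w := by
  have : (lunit W).symm (W.ls a w) = tmul (X := Corr.self A) a w := by
    rw [← lunit_tmul, Iso.symm_apply_apply]
  exact (congrArg (fun t => tmap (fockIncl E 0) (Hom.id W) t) this).trans (tmap_tmul _ _ _ _)

lemma indS_tmul (e : E) (n : ℕ) (η : powT E n) (w : W) :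
    indS E W (tmul e (tmul (fockIncl E n η) w)) =
      tmul (fockIncl E (n + 1) (tmul e η : (E ⊠ powT E n : Corr A A))) w := by
  rw [← create_tmul_fockIncl, indS, Hom.comp_apply, assoc_symm_tmul, tmap_tmul, Hom.id_apply]

/-- Creating `n` particles from the vacuum produces exactly the `n`-th summand of the Fock space;
density of the model family is read off from this. -/
lemma iter_indS_vac (n : ℕ) (x : (powT E n ⊠ W : Corr A ℂ)) :
    iter (indS E W) n (tmap (Hom.id (powT E n)) (vac E W) x) =
      tmap (fockIncl E n) (Hom.id W) x := by
  induction n with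
  | zero =>
    rw [iter_zero_tmap, vac_apply]
    exact congrArg (fun t => tmap (fockIncl E 0) (Hom.id W) t) ((lunit W).symm_apply_apply x)
  | succ n ih =>
    rw [iter_succ_tmap]
    have h : (iter (indS E W) n).comp (tmap (Hom.id (powT E n)) (vac E W)) =
      tmap (fockIncl E n) (Hom.id W) := Hom.ext_apply ih
    rw [h]
    have : (indS E W).comp ((tmap (Hom.id E) (tmap (fockIncl E n)
        (Hom.id W))).comp (assoc E (powT E n) W).toHom) =
        tmap (X := E ⊠ powT E n) (fockIncl E (n + 1)) (Hom.id W) := by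
      refine Hom.ext_tmul₃ fun e η w => ?_
      rw [Hom.comp_apply, Hom.comp_apply, assoc_tmul, tmap_tmul, tmap_tmul]
      exact (indS_tmul e n η w).trans (tmap_tmul (fockIncl E (n + 1)) (Hom.id W)
        (tmul e η : (E ⊠ powT E n : Corr A A)) w).symm
    exact congrArg (fun F : Hom _ _ => F x) this

lemma dense_iter_vac :
    closure (Submodule.span ℂ (Set.range fun p : Σ n, (powT E n ⊠ W : Corr A ℂ) =>
      iter (indS E W) p.1 (tmap (Hom.id (powT E p.1)) (vac E W) p.2)) :
        Set (Fock E ⊠ W : Corr A ℂ)) = Set.univ := by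
  rw [← Set.univ_subset_iff, ← dense_tmul_of_dense (dense_fockIncl (E := E)) (dense_id W)]
  refine closure_mono (Submodule.span_mono ?_)
  rintro _ ⟨⟨⟨n, η⟩, w⟩, rfl⟩
  exact ⟨⟨n, tmul η w⟩, (iter_indS_vac n _).trans (tmap_tmul _ _ _ _)⟩

/-- Creation raises the degree, so its range has no component in degree 0. On generators the inner
product contains a factor `⟨a, e ⊗ η⟩` between different summands of `F(E)`. -/
lemma vac_orth_indS (w : W) (x : (E ⊠ (Fock E ⊠ W) : Corr A ℂ)) :
    (Fock E ⊠ W).ip (vac E W w) (indS E W x) = 0 := by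
  have h1 : closure (Submodule.span ℂ (Set.range fun p : A × W => W.ls p.1 p.2) : Set W) =
      Set.univ := by
    rw [← W.nondeg]
    congr 3
    ext y
    exact ⟨fun ⟨p, h⟩ => ⟨_, _, h.symm⟩, fun ⟨a, x, h⟩ => ⟨(a, x), h.symm⟩⟩
  refine Hom.ip_eq_zero_of_dense (vac E W) (indS E W) h1
    (dense_tmul_of_dense (dense_id E)
      (dense_tmul_of_dense (dense_fockIncl (E := E)) (dense_id W))) ?_ w x
  rintro ⟨a, w⟩ ⟨e, ⟨n, η⟩, w'⟩
  dsimp only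
  rw [indS_tmul, vac_ls, ip_tmul]
  have : (Fock E).ip (fockIncl E 0 a)
      (fockIncl E (n + 1) (tmul e η : (E ⊠ powT E n : Corr A A))) = 0 :=
    ip_fockIncl_ne (Nat.succ_ne_zero n).symm _ _
  rw [this]
  have h0 : W.ls 0 w' = 0 := by simpa using W.smul_ls 0 0 w'
  rw [h0, Corr.ip_zero]

end Wold

/-! ### Commutation of isometries through a twist `X ⊗ E → E ⊗ X` and its iterates. -/

section Commutation

variable {A : Type u} [NonUnitalCStarAlgebra A] [PartialOrder A] [StarOrderedRing A]
  {X E : Corr.{u, u, u} A A} {H : Corr.{u, 0, v} A ℂ}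

/-- The twist of order 0 is `X ⊗ A ≅ X ≅ A ⊗ X`, and both sides send `ξ ⊗ a ⊗ h` to `f (ξ a ⊗ h) = f
(ξ ⊗ a h)`. The target `K` may differ from `H`, since this is also applied to a symbol `Θ̃ : X ⊗ W →
F(E) ⊗ W`. -/
lemma iter_comm_zero {K : Corr.{u, 0, w} A ℂ} (f : Hom (X ⊠ H) K) (x : ((X ⊠ Corr.self A) ⊠ H : Corr A ℂ)) :
    f (tmap (Hom.id X) (lunit H).toHom (assoc X (Corr.self A) H x)) =
      lunit K (tmap (Hom.id (Corr.self A)) f (assoc (Corr.self A) X H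
        (tmap ((runit X).trans (lunit X).symm).toHom (Hom.id H) x))) := by
  have h1 : ∀ y : ((Corr.self A ⊠ X) ⊠ H : Corr A ℂ),
      lunit K (tmap (Hom.id (Corr.self A)) f (assoc (Corr.self A) X H y)) =
        f (tmap (lunit X).toHom (Hom.id H) y) := by
    intro y
    have : (lunit K).toHom.comp ((tmap (Hom.id (Corr.self A)) f).comp
        (assoc (Corr.self A) X H).toHom) = f.comp (tmap (lunit X).toHom (Hom.id H)) :=
      Hom.ext_tmul₃ fun a ξ h => by
        rw [Hom.comp_apply, Hom.comp_apply, Hom.comp_apply, assoc_tmul, tmap_tmul, tmap_tmul]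
        refine (lunit_tmul K _ _).trans ?_
        refine (f.ls_map _ _).symm.trans (congrArg (fun t => f t) ?_)
        exact (ls_tmul _ _ _).trans (congrArg (fun t => tmul t h) (lunit_tmul X _ _).symm)
    exact congrArg (fun F : Hom _ _ => F y) this
  have h2 : (tmap (Hom.id X) (lunit H).toHom).comp (assoc X (Corr.self A) H).toHom =
      tmap (runit X).toHom (Hom.id H) :=
    Hom.ext_tmul₃ fun ξ a h => by
      rw [Hom.comp_apply, assoc_tmul, tmap_tmul, tmap_tmul]
      refine (congrArg (fun t => tmul ξ t) (lunit_tmul H _ _)).trans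
        ((rs_tmul_eq _ _ _).symm.trans ?_)
      exact congrArg (fun t => tmul t h) (runit_tmul X _ _).symm
  rw [h1, tmap_tmap, Iso.trans_toHom]
  have h3 : (lunit X).toHom.comp ((lunit X).symm.toHom.comp (runit X).toHom) = (runit X).toHom :=
    Hom.ext_apply fun x => by simp
  rw [h3, Hom.comp_id, ← h2, Hom.comp_apply]

/-- Commutation of `f` with `g` through `t` and with `k` through `s` gives commutation of `f` with
`g (I ⊗ k)`. -/
lemma comm_comp {Q : Corr.{u, u, u} A A} {t : Hom (X ⊠ E) (E ⊠ X)} {s : Hom (X ⊠ Q) (Q ⊠ X)}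
    {f : Hom (X ⊠ H) H} {g : Hom (E ⊠ H) H} {k : Hom (Q ⊠ H) H}
    (hg : ∀ x : ((X ⊠ E) ⊠ H : Corr A ℂ), f (tmap (Hom.id X) g (assoc X E H x)) =
      g (tmap (Hom.id E) f (assoc E X H (tmap t (Hom.id H) x))))
    (hk : ∀ x : ((X ⊠ Q) ⊠ H : Corr A ℂ), f (tmap (Hom.id X) k (assoc X Q H x)) =
      k (tmap (Hom.id Q) f (assoc Q X H (tmap s (Hom.id H) x))))
    (x : ((X ⊠ (E ⊠ Q)) ⊠ H : Corr A ℂ)) :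
    f (tmap (Hom.id X) (g.comp ((tmap (Hom.id E) k).comp (assoc E Q H).toHom))
      (assoc X (E ⊠ Q) H x)) =
    g (tmap (Hom.id E) k (assoc E Q H (tmap (Hom.id (E ⊠ Q)) f (assoc (E ⊠ Q) X H
      (tmap ((assoc E Q X).symm.toHom.comp ((tmap (Hom.id E) s).comp ((assoc E X Q).toHom.comp
        ((tmap t (Hom.id Q)).comp (assoc X E Q).symm.toHom)))) (Hom.id H) x))))) := by
  -- Rebracket so that `k` acts first, on `Q ⊗ H`; what remains is `f (I ⊗ g)`, to which `hg`
  -- applies.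
  have h1 : (tmap (Hom.id X) (g.comp ((tmap (Hom.id E) k).comp (assoc E Q H).toHom))).comp
      (assoc X (E ⊠ Q) H).toHom = (tmap (Hom.id X) g).comp ((assoc X E H).toHom.comp
        ((tmap (Hom.id (X ⊠ E)) k).comp ((assoc (X ⊠ E) Q H).toHom.comp
          (tmap (assoc X E Q).symm.toHom (Hom.id H))))) :=
    Hom.ext_tmul₄ fun ξ e q h => by simp
  -- The twist `t` moves `X ⊗ E` and `k` acts on `Q ⊗ H`, so they commute (`h3`). Afterwards `f (I ⊗
  -- k)` stands behind a factor `E` (`h4`), ready for `hk`.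
  have h2 : (tmap (Hom.id E) f).comp ((assoc E X H).toHom.comp ((tmap t (Hom.id H)).comp
      ((tmap (Hom.id (X ⊠ E)) k).comp (assoc (X ⊠ E) Q H).toHom))) =
      ((tmap (Hom.id E) (f.comp ((tmap (Hom.id X) k).comp (assoc X Q H).toHom))).comp
        (assoc E (X ⊠ Q) H).toHom).comp
        (tmap ((assoc E X Q).toHom.comp (tmap t (Hom.id Q))) (Hom.id H)) := by
    have h3 : (tmap t (Hom.id H)).comp
      ((tmap (Hom.id (X ⊠ E)) k).comp (assoc (X ⊠ E) Q H).toHom) =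
      (tmap (Hom.id (E ⊠ X)) k).comp ((assoc (E ⊠ X) Q H).toHom.comp
        (tmap (tmap t (Hom.id Q)) (Hom.id H))) :=
      Hom.ext_tmul₃ fun a q h => by simp
    have h4 : (tmap (Hom.id E) f).comp ((assoc E X H).toHom.comp
        ((tmap (Hom.id (E ⊠ X)) k).comp (assoc (E ⊠ X) Q H).toHom)) =
        ((tmap (Hom.id E) (f.comp ((tmap (Hom.id X) k).comp (assoc X Q H).toHom))).comp
        (assoc E (X ⊠ Q) H).toHom).comp (tmap (assoc E X Q).toHom (Hom.id H)) := by
      -- Precomposing with an onto associator changes the bracketing to one in which elementary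
      -- tensors can be compared.
      have h5 : ∀ z : (((E ⊠ X) ⊠ Q) ⊠ H : Corr A ℂ),
          ∃ z', tmap (assoc E X Q).symm.toHom (Hom.id H) z' = z := fun z =>
        (tmapIso (assoc E X Q).symm (Iso.refl H)).surj z
      refine Hom.ext_apply fun z => ?_
      obtain ⟨z, rfl⟩ := h5 z
      have h6 : ((tmap (Hom.id E) f).comp ((assoc E X H).toHom.comp
        ((tmap (Hom.id (E ⊠ X)) k).comp (assoc (E ⊠ X) Q H).toHom))).comp
          (tmap (assoc E X Q).symm.toHom (Hom.id H)) =
        (((tmap (Hom.id E) (f.comp ((tmap (Hom.id X) k).comp (assoc X Q H).toHom))).comp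
        (assoc E (X ⊠ Q) H).toHom).comp (tmap (assoc E X Q).toHom (Hom.id H))).comp
          (tmap (assoc E X Q).symm.toHom (Hom.id H)) :=
        Hom.ext_tmul₄ fun e ξ q h => by simp
      exact congrArg (fun F : Hom _ _ => F z) h6
    have h7 := congrArg (fun F => ((tmap (Hom.id E) f).comp (assoc E X H).toHom).comp F) h3
    refine h7.trans ?_
    have h8 := congrArg (fun F : Hom _ _ => F.comp (tmap (tmap t (Hom.id Q)) (Hom.id H))) h4
    refine h8.trans (Hom.ext_apply fun z => ?_)
    simp only [Hom.comp_apply, tmap_tmap, Hom.id_comp]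
  -- Rebracketing after the use of `hk`: read backwards, it recovers the right-hand side of the
  -- claim.
  have h9 : (tmap (Hom.id E) k).comp ((assoc E Q H).toHom.comp ((tmap (Hom.id (E ⊠ Q)) f).comp
      ((assoc (E ⊠ Q) X H).toHom.comp (tmap (assoc E Q X).symm.toHom (Hom.id H))))) =
      (tmap (Hom.id E) (k.comp ((tmap (Hom.id Q) f).comp (assoc Q X H).toHom))).comp
        (assoc E (Q ⊠ X) H).toHom :=
    Hom.ext_tmul₄ fun e q ξ h => by simp
  have hk' : f.comp ((tmap (Hom.id X) k).comp (assoc X Q H).toHom) =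
      (k.comp ((tmap (Hom.id Q) f).comp (assoc Q X H).toHom)).comp (tmap s (Hom.id H)) :=
    Hom.ext_apply hk
  refine (congrArg (fun F : Hom _ _ => f (F x)) h1).trans ((hg _).trans ?_)
  refine (congrArg (fun F : Hom _ _ => g (F (tmap (assoc X E Q).symm.toHom (Hom.id H) x)))
    h2).trans ?_
  congr 1
  rw [hk', Hom.comp_apply, Hom.comp_apply, tmap_tmap, tmap_id_comp, ← assoc_tmap]
  refine (congrArg (fun F : Hom _ _ => F _) h9).symm.trans ?_
  simp only [Hom.comp_apply, tmap_tmap, Hom.id_comp]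
  rfl

/-- If `f` and `g` commute through `t : X ⊗ E → E ⊗ X`, then `f` and `g_n` commute through the
`n`-fold iterate of `t`. -/
lemma iter_comm {t : Iso (X ⊠ E) (E ⊠ X)} (f : Hom (X ⊠ H) H) (g : Hom (E ⊠ H) H)
    (hc : ∀ x : ((X ⊠ E) ⊠ H : Corr A ℂ), f (tmap (Hom.id X) g (assoc X E H x)) =
      g (tmap (Hom.id E) f (assoc E X H (tmap t.toHom (Hom.id H) x))))
    (n : ℕ) (x : ((X ⊠ powT E n) ⊠ H : Corr A ℂ)) :
    f (tmap (Hom.id X) (iter g n) (assoc X (powT E n) H x)) =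
      iter g n (tmap (Hom.id (powT E n)) f (assoc (powT E n) X H
        (tmap (tpow t n).toHom (Hom.id H) x))) := by
  induction n with
  | zero => exact iter_comm_zero f x
  -- With `Q = E^{⊗ n}`, `k = g_n` and `s = t^{(n)}`, the composite twist in `comm_comp` is the
  -- recursive definition of `t^{(n+1)}`.
  | succ n ih => exact comm_comp hc ih x

section ProductMaps

variable {F : Corr.{u, u, u} A A} {t : Iso (F ⊠ E) (E ⊠ F)} {f : Hom (E ⊠ H) H}
  {g : Hom (F ⊠ H) H}

/-- Here `E`, `F`, `t` play the roles of `E₁`, `E₂`, `t_{2,1}`. The outer `f` is untouched, as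
`t_{1,1} = id`; inside, the claim is the hypothesis solved for `f (I ⊗ g)`, namely `f (I ⊗ g) = g (I
⊗ f)(t⁻¹ ⊗ I)`. -/
lemma comm_left (hc : ∀ x : ((F ⊠ E) ⊠ H : Corr A ℂ),
      g (tmap (Hom.id F) f (assoc F E H x)) =
        f (tmap (Hom.id E) g (assoc E F H (tmap t.toHom (Hom.id H) x))))
    (x : ((E ⊠ (E ⊠ F)) ⊠ H : Corr A ℂ)) :
    f (tmap (Hom.id E) (f.comp ((tmap (Hom.id E) g).comp (assoc E F H).toHom))
      (assoc E (E ⊠ F) H x)) =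
    f (tmap (Hom.id E) g (assoc E F H (tmap (Hom.id (E ⊠ F)) f (assoc (E ⊠ F) E H
      (tmap ((tmapIso (Iso.refl E) t.symm).trans (assoc E F E).symm).toHom (Hom.id H) x))))) := by
  have h1 : (tmap (Hom.id E) g).comp ((assoc E F H).toHom.comp ((tmap (Hom.id (E ⊠ F)) f).comp
      ((assoc (E ⊠ F) E H).toHom.comp (tmap (assoc E F E).symm.toHom (Hom.id H))))) =
      (tmap (Hom.id E) (g.comp ((tmap (Hom.id F) f).comp (assoc F E H).toHom))).comp
        (assoc E (F ⊠ E) H).toHom :=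
    Hom.ext_tmul₄ fun e₁ e₂ e₁' h => by simp
  have hc' : g.comp ((tmap (Hom.id F) f).comp (assoc F E H).toHom) =
      (f.comp ((tmap (Hom.id E) g).comp (assoc E F H).toHom)).comp (tmap t.toHom (Hom.id H)) :=
    Hom.ext_apply hc
  have h2 : (tmap t.toHom (Hom.id H)).comp (tmap t.symm.toHom (Hom.id H)) =
      Hom.id ((E ⊠ F) ⊠ H) := Hom.ext_apply fun y => by
    rw [Hom.comp_apply, tmap_tmap, Iso.comp_symm, Hom.comp_id, tmap_id]
  have h3 := congrArg (fun F : Hom _ _ => F (tmap (tmap (Hom.id E) t.symm.toHom) (Hom.id H) x)) h1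
  simp only [Hom.comp_apply, tmap_tmap, Hom.id_comp, assoc_tmap] at h3
  have h4 : ((f.comp ((tmap (Hom.id E) g).comp (assoc E F H).toHom)).comp
      (tmap t.toHom (Hom.id H))).comp (tmap t.symm.toHom (Hom.id H)) =
      f.comp ((tmap (Hom.id E) g).comp (assoc E F H).toHom) :=
    congrArg (fun G => (f.comp ((tmap (Hom.id E) g).comp (assoc E F H).toHom)).comp G) h2
  rw [Iso.trans_toHom, tmapIso_toHom, Iso.refl_toHom, h3, hc', h4]

/-- The hypothesis is applied to the two outer operators `g (I ⊗ f)`. The inner `g` acts on the last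
two factors and commutes with `t`; then `t_{2,2} = id` leaves nothing to do. -/
lemma comm_right (hc : ∀ x : ((F ⊠ E) ⊠ H : Corr A ℂ),
      g (tmap (Hom.id F) f (assoc F E H x)) =
        f (tmap (Hom.id E) g (assoc E F H (tmap t.toHom (Hom.id H) x))))
    (x : ((F ⊠ (E ⊠ F)) ⊠ H : Corr A ℂ)) :
    g (tmap (Hom.id F) (f.comp ((tmap (Hom.id E) g).comp (assoc E F H).toHom))
      (assoc F (E ⊠ F) H x)) =
    f (tmap (Hom.id E) g (assoc E F H (tmap (Hom.id (E ⊠ F)) g (assoc (E ⊠ F) F H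
      (tmap ((assoc F E F).symm.trans (tmapIso t (Iso.refl F))).toHom (Hom.id H) x))))) := by
  have h1 : (tmap (Hom.id F) (f.comp ((tmap (Hom.id E) g).comp (assoc E F H).toHom))).comp
      (assoc F (E ⊠ F) H).toHom =
      ((tmap (Hom.id F) f).comp (assoc F E H).toHom).comp
        ((tmap (Hom.id (F ⊠ E)) g).comp ((assoc (F ⊠ E) F H).toHom.comp
          (tmap (assoc F E F).symm.toHom (Hom.id H)))) :=
    Hom.ext_tmul₄ fun e₂ e₁ e₂' h => by simp
  refine (congrArg (fun G : Hom _ _ => g (G x)) h1).trans ((hc _).trans ?_)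
  rw [Iso.trans_toHom, tmapIso_toHom, Iso.refl_toHom, ← Hom.comp_id (Hom.id H), ← tmap_tmap,
    assoc_tmap]
  simp only [Hom.comp_apply, tmap_tmap, Hom.id_comp, Hom.comp_id, tmap_id]

end ProductMaps

end Commutation

/-! ### Composing isometric bimodule maps with isometries on both sides. -/

section BimoduleMaps

variable {A : Type u} [NonUnitalCStarAlgebra A] {B : Type w} [NonUnitalCStarAlgebra B]
  [PartialOrder B] [StarOrderedRing B]
  {X : Corr.{u, w, w₁} A B} {W : Corr.{w, 0, w₂} B ℂ} {Z : Corr.{u, 0, w₃} A ℂ}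
  {W' : Corr.{w, 0, w₄} B ℂ} {Z' : Corr.{u, 0, w₅} A ℂ}

/-- The isometric bimodule map `ξ ↦ u Θ(ξ) j`, for bimodule isometries `u` and `j`. -/
noncomputable def IsoBimod.conj (Θ : IsoBimod X W Z) (u : Hom Z Z') (j : Hom W' W) :
    IsoBimod X W' Z' where
  op := ⟨⟨fun x => u.toCLM ∘L Θ.op x ∘L j.toCLM, fun x y => by
    ext w; simp⟩, fun c x => by ext w; simp⟩
  op_ls a x := by
    ext w
    simp [Θ.op_ls, u.ls_map]
  op_rs x b := by
    ext w
    simp [Θ.op_rs, j.ls_map]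
  op_adj x y := by
    ext w
    -- `⟨u Θ(x) j w', u Θ(y) j w⟩ = ⟨j w', ⟨x, y⟩ j w⟩ = ⟨w', ⟨x, y⟩ w⟩`: only isometry of `u` and
    -- `j` and the equivariance of `j` enter, so no adjoints of `u` or `j` are computed.
    refine ext_inner_left ℂ fun w' => ?_
    rw [ContinuousLinearMap.comp_apply, ContinuousLinearMap.adjoint_inner_right]
    refine (u.ip_map (Θ.op x (j w')) (Θ.op y (j w))).trans ?_
    rw [← Corr.inner_eq, ← ContinuousLinearMap.adjoint_inner_right,
      ← ContinuousLinearMap.comp_apply, Θ.op_adj, Corr.lsL_apply, ← j.ls_map]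
    exact j.ip_map _ _

lemma IsoBimod.conj_op (Θ : IsoBimod X W Z) (u : Hom Z Z') (j : Hom W' W) (x : X) (w : W') :
    (Θ.conj u j).op x w = u (Θ.op x (j w)) := rfl

lemma IsoBimod.conj_tilde (Θ : IsoBimod X W Z) (u : Hom Z Z') (j : Hom W' W) :
    (Θ.conj u j).tilde = (u.comp Θ.tilde).comp (tmap (Hom.id X) j) :=
  Hom.ext_tmul fun x w => by simp [conj_op]

end BimoduleMaps

/-! ### Covariant representations: commutation with `Ṽ`, and transport along a unitary. -/

namespace IsoCovRep

variable {A : Type u} [NonUnitalCStarAlgebra A] [PartialOrder A] [StarOrderedRing A]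
  {P : ProductSystem A} {H : Corr.{u, 0, v} A ℂ} {K : Corr.{u, 0, w} A ℂ}

/-- Once `Ṽ` has been identified with `S̃`, this and its companion become commutation with the
creation operators, the property characterizing multipliers. -/
lemma V₁_tilde_comm (V : IsoCovRep P H) (x : ((P.E₁ ⊠ P.E) ⊠ H : Corr A ℂ)) :
    V.V₁.tilde (tmap (Hom.id P.E₁) V.tilde (assoc P.E₁ P.E H x)) =
      V.tilde (tmap (Hom.id P.E) V.V₁.tilde (assoc P.E P.E₁ H
        (tmap P.t₁.toHom (Hom.id H) x))) :=
  comm_left V.comm x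

lemma V₂_tilde_comm (V : IsoCovRep P H) (x : ((P.E₂ ⊠ P.E) ⊠ H : Corr A ℂ)) :
    V.V₂.tilde (tmap (Hom.id P.E₂) V.tilde (assoc P.E₂ P.E H x)) =
      V.tilde (tmap (Hom.id P.E) V.V₂.tilde (assoc P.E P.E₂ H
        (tmap P.t₂.toHom (Hom.id H) x))) :=
  comm_right V.comm x

lemma tilde_tmul (V : IsoCovRep P H) (e₁ : P.E₁) (e₂ : P.E₂) (h : H) :
    V.tilde (tmul (X := P.E) (tmul e₁ e₂ : (P.E₁ ⊠ P.E₂ : Corr A A)) h) =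
      V.V₁.op e₁ (V.V₂.op e₂ h) := by
  refine (congrArg (fun t => V.V₁.tilde (tmap (Hom.id P.E₁) V.V₂.tilde t))
    (assoc_tmul e₁ e₂ h)).trans ?_
  rw [tmap_tmul, IsoBimod.tilde_tmul, IsoBimod.tilde_tmul]
  rfl

/-- The representation transported along a unitary. -/
noncomputable def conj (V : IsoCovRep P H) (U : Iso H K) : IsoCovRep P K where
  V₁ := V.V₁.conj U.toHom U.symm.toHom
  V₂ := V.V₂.conj U.toHom U.symm.toHom
  comm x := by
    -- The inner `U* U` between two transported operators cancels; what is left is the relation for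
    -- `V` at `(I ⊗ U*) x`, with `U` applied.
    have hU : ∀ {X : Corr.{u, u, u} A A} (f : Hom (X ⊠ H) H),
        U.symm.toHom.comp ((U.toHom.comp f).comp (tmap (Hom.id X) U.symm.toHom)) =
          f.comp (tmap (Hom.id X) U.symm.toHom) :=
      fun f => Hom.ext_apply fun y => by simp
    have h := V.comm (tmap (Hom.id (P.E₂ ⊠ P.E₁)) U.symm.toHom x)
    rw [tmap_tmap, Hom.id_comp, Hom.comp_id, ← Hom.id_comp P.t.toHom,
      ← Hom.comp_id U.symm.toHom, ← tmap_tmap, assoc_tmap_id, assoc_tmap_id, tmap_tmap,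
      tmap_tmap] at h
    simp only [IsoBimod.conj_tilde, Hom.comp_apply, tmap_tmap, hU]
    exact congrArg (fun t => U t) h

lemma conj_V₁_op (V : IsoCovRep P H) (U : Iso H K) (ξ : P.E₁) (h : H) :
    (V.conj U).V₁.op ξ (U h) = U (V.V₁.op ξ h) :=
  congrArg (fun t => U (V.V₁.op ξ t)) (U.symm_apply_apply h)

lemma conj_V₂_op (V : IsoCovRep P H) (U : Iso H K) (ξ : P.E₂) (h : H) :
    (V.conj U).V₂.op ξ (U h) = U (V.V₂.op ξ h) :=
  congrArg (fun t => U (V.V₂.op ξ t)) (U.symm_apply_apply h)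

lemma tilde_intertwine {V : IsoCovRep P H} {M : IsoCovRep P K} {U : Hom H K}
    (h₁ : ∀ ξ h, U (V.V₁.op ξ h) = M.V₁.op ξ (U h))
    (h₂ : ∀ ξ h, U (V.V₂.op ξ h) = M.V₂.op ξ (U h)) :
    U.comp V.tilde = M.tilde.comp (tmap (Hom.id P.E) U) :=
  Hom.ext_tmul₃ (X := P.E₁) (Y := P.E₂) fun e₁ e₂ h => by
    refine (congrArg (fun t => U t) (V.tilde_tmul e₁ e₂ h)).trans ?_
    rw [h₁, h₂, ← M.tilde_tmul]
    exact congrArg (fun t => M.tilde t)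
      (tmap_tmul (Hom.id P.E) U (tmul e₁ e₂ : (P.E₁ ⊠ P.E₂ : Corr A A)) h).symm

end IsoCovRep

lemma iter_intertwine {A : Type u} [NonUnitalCStarAlgebra A] [PartialOrder A] [StarOrderedRing A]
    {E : Corr.{u, u, u} A A} {H : Corr.{u, 0, v} A ℂ} {K : Corr.{u, 0, w} A ℂ}
    {f : Hom (E ⊠ H) H} {g : Hom (E ⊠ K) K} {U : Hom H K}
    (h : U.comp f = g.comp (tmap (Hom.id E) U)) (n : ℕ) :
    U.comp (iter f n) = (iter g n).comp (tmap (Hom.id (powT E n)) U) := by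
  induction n with
  | zero => exact Hom.ext_apply fun x => (iter_zero_tmap g U x).symm
  | succ n ih =>
    refine Hom.ext_apply fun x => ?_
    rw [Hom.comp_apply, Hom.comp_apply, iter_succ_tmap, ← ih, iter_succ]
    refine (congrArg (fun F : Hom _ _ => F _) h).trans ?_
    rw [Hom.comp_apply, tmap_tmap, Hom.id_comp]

/-! ### Multipliers `M_Θ` and their restriction to the vacuum. -/

section Multipliers

variable {A : Type u} [NonUnitalCStarAlgebra A] [PartialOrder A] [StarOrderedRing A]
  {X E : Corr.{u, u, u} A A} {W : Corr.{u, 0, v} A ℂ}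

/-- An isometric bimodule map commuting with the creation operators through `t` is `M_Θ`, where
`Θ` is its restriction to the vacuum part. -/
lemma isMult_of_comm (t : Iso (X ⊠ E) (E ⊠ X)) (M : IsoBimod X (Fock E ⊠ W) (Fock E ⊠ W))
    (hc : ∀ x : ((X ⊠ E) ⊠ (Fock E ⊠ W) : Corr A ℂ),
      M.tilde (tmap (Hom.id X) (indS E W) (assoc X E (Fock E ⊠ W) x)) =
        indS E W (tmap (Hom.id E) M.tilde (assoc E X (Fock E ⊠ W) (tmap t.toHom (Hom.id _) x)))) :
    IsMult t (M.conj (Hom.id _) (vac E W)) M := by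
  intro n ξ x
  -- The commutation is evaluated at vectors built on the vacuum. Naturality then carries `vac` past
  -- the twist, next to `M̃`, where `M̃ (I ⊗ vac) = Θ̃`.
  have h := iter_comm M.tilde (indS E W) hc n ((assoc X (powT E n) (Fock E ⊠ W)).symm
    (tmul ξ (tmap (Hom.id (powT E n)) (vac E W) x)))
  rw [Iso.apply_symm_apply, tmap_tmul, IsoBimod.tilde_tmul, Hom.id_apply] at h
  rw [h, IsoBimod.conj_tilde, Hom.id_comp, tmap_id_comp, ← assoc_tmap_id, tmap_tmap]
  have h1 : (tmul ξ (tmap (Hom.id (powT E n)) (vac E W) x) :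
      (X ⊠ (powT E n ⊠ (Fock E ⊠ W)) : Corr A ℂ)) =
      tmap (Hom.id X) (tmap (Hom.id (powT E n)) (vac E W)) (tmul ξ x) := by
    rw [tmap_tmul, Hom.id_apply]
  rw [h1, assoc_symm_tmap, tmap_tmap, tmap_id, Hom.comp_id, Hom.comp_id, Hom.id_comp, Hom.id_comp]

/-- `Θ` is the restriction of `M_Θ` to the vacuum part. -/
lemma IsMult.tilde_eq {t : Iso (X ⊠ E) (E ⊠ X)} {Θ : IsoBimod X W (Fock E ⊠ W)}
    {M : IsoBimod X (Fock E ⊠ W) (Fock E ⊠ W)} (h : IsMult t Θ M) :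
    Θ.tilde = M.tilde.comp (tmap (Hom.id X) (vac E W)) := by
  refine Hom.ext_tmul fun ξ w => ?_
  obtain ⟨x, rfl⟩ : ∃ x : (powT E 0 ⊠ W : Corr A ℂ), lunit W x = w := (lunit W).surj w
  have h0 := h 0 ξ x
  rw [iter_zero_tmap] at h0
  rw [Hom.comp_apply, tmap_tmul, IsoBimod.tilde_tmul M, Hom.id_apply, h0]
  -- In degree 0 the right side of the multiplier equation is `Θ̃` preceded by the trivial twist,
  -- which `iter_comm_zero` removes.
  refine Eq.trans ?_
    (iter_comm_zero Θ.tilde ((assoc X (Corr.self A) W).symm (tmul ξ x)))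
  rw [Iso.apply_symm_apply]
  exact congrArg (fun t => Θ.tilde t)
    (tmap_tmul (Hom.id X) (lunit W).toHom ξ (x : (Corr.self A ⊠ W : Corr A ℂ))).symm

end Multipliers

/-! ### The Wold unitary and existence of the BCL-representation. -/

section WoldUnitary

variable {A : Type u} [NonUnitalCStarAlgebra A] [PartialOrder A] [StarOrderedRing A]
  {P : ProductSystem A} {H : Corr.{u, 0, v} A ℂ} {V : IsoCovRep P H}

lemma exists_isWold (hV : V.IsPure) : ∃ U : Iso H V.model, IsWold V U :=
  exists_wold V.tilde V.W.incl (indS P.E V.W.corr) (vac P.E V.W.corr)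
    (fun w x => by
      rw [← H.star_ip]
      exact (congrArg star ((V.tilde.isOrthSum_wander).1 x w)).trans (star_zero ℂ))
    vac_orth_indS (dense_iter_wander V.tilde hV) dense_iter_vac

lemma IsWold.comp_incl {U : Iso H V.model} (hU : IsWold V U) :
    U.toHom.comp V.W.incl = vac P.E V.W.corr := by
  refine Hom.ext_apply fun w => ?_
  obtain ⟨x, rfl⟩ : ∃ x : (powT P.E 0 ⊠ V.W.corr : Corr A ℂ), lunit V.W.corr x = w :=
    (lunit V.W.corr).surj w
  have h := hU 0 x
  rwa [iter_zero_tmap, iter_zero_tmap] at h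

/-- The Wold relation in degrees `n` and `n + 1` gives the identity on `e ⊗ Ṽ_n(x)`, where both
sides are `S̃_{n+1}(e ⊗ x)`; purity makes these vectors span a dense subspace of `E ⊗ H`. -/
lemma IsWold.comp_tilde {U : Iso H V.model} (hU : IsWold V U) (hV : V.IsPure) :
    U.toHom.comp V.tilde = (indS P.E V.W.corr).comp (tmap (Hom.id P.E) U.toHom) := by
  refine Hom.ext_apply (Hom.ext_dense
    (dense_tmul_of_dense (dense_id P.E) (dense_iter_wander V.tilde hV)) _ _ ?_)
  rintro ⟨e, n, x⟩
  refine (congrArg (fun t => U t)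
    (iter_succ_tmap_assoc_symm V.tilde V.W.incl n e x)).symm.trans ((hU (n + 1) _).trans ?_)
  refine (iter_succ_tmap_assoc_symm _ _ n e x).trans ?_
  rw [Hom.comp_apply, tmap_tmul]
  exact congrArg (fun t => indS P.E V.W.corr (tmul e t)) (hU n x).symm

/-- Both operators, composed with the surjection `I ⊗ U`, equal `U Ṽ`. -/
lemma tilde_eq_indS {U : Iso H V.model} (hU : IsWold V U) (hV : V.IsPure)
    {M : IsoCovRep P V.model} (h₁ : ∀ ξ h, U (V.V₁.op ξ h) = M.V₁.op ξ (U h))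
    (h₂ : ∀ ξ h, U (V.V₂.op ξ h) = M.V₂.op ξ (U h)) : M.tilde = indS P.E V.W.corr := by
  refine Hom.ext_apply fun x => ?_
  obtain ⟨y, rfl⟩ := (tmapIso (Iso.refl P.E) U).surj x
  have h := (IsoCovRep.tilde_intertwine h₁ h₂).symm.trans (hU.comp_tilde hV)
  exact congrArg (fun F : Hom _ _ => F y) h

/-- The operators are those of `V` transported by `U`, and the symbols are their restrictions to the
vacuum. -/
theorem exists_isBCL (hV : V.IsPure) :
    ∃ (M : IsoCovRep P V.model) (Θ₁ : IsoBimod P.E₁ V.W.corr V.model)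
      (Θ₂ : IsoBimod P.E₂ V.W.corr V.model), IsBCL V M Θ₁ Θ₂ := by
  obtain ⟨U, hU⟩ := exists_isWold hV
  have h₁ := fun ξ h => (V.conj_V₁_op U ξ h).symm
  have h₂ := fun ξ h => (V.conj_V₂_op U ξ h).symm
  have hM := tilde_eq_indS hU hV h₁ h₂
  have hc₁ := (V.conj U).V₁_tilde_comm
  have hc₂ := (V.conj U).V₂_tilde_comm
  rw [hM] at hc₁ hc₂
  exact ⟨V.conj U, _, _, isMult_of_comm P.t₁ _ hc₁, isMult_of_comm P.t₂ _ hc₂, U, hU, h₁, h₂⟩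

end WoldUnitary

/-! ### Unitary invariance of purity, and `Ṽ` written in either order of the factors. -/

namespace IsoCovRep

variable {A : Type u} [NonUnitalCStarAlgebra A] [PartialOrder A] [StarOrderedRing A]
  {P : ProductSystem A} {H : Corr.{u, 0, v} A ℂ} {K : Corr.{u, 0, w} A ℂ}

lemma IsPure.of_intertwine {V : IsoCovRep P H} (hV : V.IsPure) {M : IsoCovRep P K} {U : Iso H K}
    (h₁ : ∀ ξ h, U (V.V₁.op ξ h) = M.V₁.op ξ (U h))
    (h₂ : ∀ ξ h, U (V.V₂.op ξ h) = M.V₂.op ξ (U h)) : M.IsPure := by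
  intro k
  obtain ⟨h, rfl⟩ := U.surj k
  have hi : ∀ n x, U (iter V.tilde n x) =
      iter M.tilde n (tmap (Hom.id (powT P.E n)) U.toHom x) := fun n x =>
    congrArg (fun F : Hom _ _ => F x) (iter_intertwine (tilde_intertwine h₁ h₂) n)
  -- As `I ⊗ U` is onto, the adjoint can be tested on vectors `(I ⊗ U) z`. It follows that `M̃_n
  -- M̃_n* U = U Ṽ_n Ṽ_n*`.
  have ha : ∀ n, ContinuousLinearMap.adjoint (iter M.tilde n).toCLM (U h) =
      tmap (Hom.id (powT P.E n)) U.toHom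
        (ContinuousLinearMap.adjoint (iter V.tilde n).toCLM h) := fun n => by
    refine ext_inner_left ℂ fun y => ?_
    obtain ⟨z, rfl⟩ := (tmapIso (Iso.refl (powT P.E n)) U).surj y
    rw [ContinuousLinearMap.adjoint_inner_right, Hom.toCLM_apply, tmapIso_toHom, Iso.refl_toHom,
      ← hi]
    refine (U.ip_map _ _).trans (Eq.trans ?_ ((tmap _ _).ip_map _ _).symm)
    exact (ContinuousLinearMap.adjoint_inner_right (iter V.tilde n).toCLM z h).symm
  simp only [ha, ← hi]
  have h0 := (U.toHom.continuous.tendsto 0).comp (hV h)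
  rwa [map_zero U.toLin] at h0

lemma tilde_tmap_assoc_symm (V : IsoCovRep P H) (j : Hom K H)
    (y : (P.E₁ ⊠ (P.E₂ ⊠ K) : Corr A ℂ)) :
    V.tilde (tmap (Hom.id P.E) j ((assoc P.E₁ P.E₂ K).symm y)) =
      V.V₁.tilde (tmap (Hom.id P.E₁) (V.V₂.tilde.comp (tmap (Hom.id P.E₂) j)) y) := by
  have h := assoc_tmap_id j ((assoc P.E₁ P.E₂ K).symm y)
  rw [Iso.apply_symm_apply] at h
  rw [tmap_id_comp]
  exact congrArg (fun t => V.V₁.tilde (tmap (Hom.id P.E₁) V.V₂.tilde t)) h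

/-- Counterpart of `tilde_tmap_assoc_symm` for the order `E₂ ⊗ E₁`: the covariance relation inserts
the `t_{2,1}` seen in the formula for `Θ̃₂`. -/
lemma tilde_tmap_t_assoc_symm (V : IsoCovRep P H) (j : Hom K H)
    (y : (P.E₂ ⊠ (P.E₁ ⊠ K) : Corr A ℂ)) :
    V.tilde (tmap P.t.toHom j ((assoc P.E₂ P.E₁ K).symm y)) =
      V.V₂.tilde (tmap (Hom.id P.E₂) (V.V₁.tilde.comp (tmap (Hom.id P.E₁) j)) y) := by
  have h := V.comm (tmap (Hom.id (P.E₂ ⊠ P.E₁)) j ((assoc P.E₂ P.E₁ K).symm y))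
  rw [assoc_tmap_id, Iso.apply_symm_apply, tmap_tmap, tmap_tmap] at h
  exact h.symm

end IsoCovRep

/-! ### The two decompositions of the wandering subspace. -/

section WanderingSubspaces

variable {A : Type u} [NonUnitalCStarAlgebra A] [PartialOrder A] [StarOrderedRing A]
  {E F : Corr.{u, u, u} A A} {H : Corr.{u, 0, v} A ℂ}

/-- A vector orthogonal to the range of `g (I ⊗ f)` is the sum of a vector in
`g (F ⊗ ker f*)` and a vector in `ker g*`. -/
lemma exists_add_wander (f : Hom (E ⊠ H) H) (g : Hom (F ⊠ H) H) (h : H)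
    (hh : ∀ z : (F ⊠ (E ⊠ H) : Corr A ℂ), H.ip (g (tmap (Hom.id F) f z)) h = 0) :
    ∃ (x : (F ⊠ f.wander.corr : Corr A ℂ)) (y : g.wander.corr),
      h = g (tmap (Hom.id F) f.wander.incl x) + y.1 := by
  obtain ⟨q, y, rfl⟩ := g.isOrthSum_wander.2 h
  have hs := f.isOrthSum_wander.tmap_id_left (E := F)
  obtain ⟨z, x, rfl⟩ := hs.2 q
  refine ⟨x, y, ?_⟩
  -- `h` is orthogonal to `g (I ⊗ f) z`, and so are the other two parts of `h`. Hence `‖(I ⊗ f) z‖²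
  -- = 0`, and that part drops out.
  have h1 := hh z
  have h2 : H.ip (g (tmap (Hom.id F) f z)) (g.wander.incl y) = 0 := g.isOrthSum_wander.1 _ _
  have h3 : (F ⊠ H).ip (tmap (Hom.id F) f z) (tmap (Hom.id F) f.wander.incl x) = 0 := hs.1 z x
  rw [H.ip_add, h2, add_zero, g.ip_map, Corr.ip_add, h3, add_zero, ← Corr.inner_eq,
    inner_self_eq_zero] at h1
  rw [h1, zero_add]
  rfl

variable {P : ProductSystem A} (V : IsoCovRep P H)

lemma isOrthSum_L₂_W₂ : IsOrthSum (InvSub.le V.L₂_le) (InvSub.le V.W₂_le) := by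
  refine ⟨?_, fun z => ?_⟩
  · rintro ⟨_, x, rfl⟩ y
    exact V.V₂.tilde.isOrthSum_wander.1 (tmap (Hom.id P.E₂) V.W₁.incl x) y
  -- `𝒲` is defined through the order `Ṽ⁽¹⁾(I ⊗ Ṽ⁽²⁾)`; the covariance relation puts the range of
  -- `Ṽ⁽²⁾(I ⊗ Ṽ⁽¹⁾)` inside that of `Ṽ`.
  · obtain ⟨x, y, h⟩ := exists_add_wander V.V₁.tilde V.V₂.tilde z.1 fun y => by
      obtain ⟨x, rfl⟩ := (assoc P.E₂ P.E₁ H).surj y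
      exact (congrArg (fun t => H.ip t z.1) (V.comm x)).trans
        ((Submodule.mem_orthogonal _ _).1 z.2 _ ⟨tmap P.t.toHom (Hom.id H) x, rfl⟩)
    exact ⟨V.r₂.toRange x, y, Subtype.ext h⟩

lemma isOrthSum_L₁_W₁ : IsOrthSum (InvSub.le V.L₁_le) (InvSub.le V.W₁_le) := by
  refine ⟨?_, fun z => ?_⟩
  · rintro ⟨_, x, rfl⟩ y
    exact V.V₁.tilde.isOrthSum_wander.1 (tmap (Hom.id P.E₁) V.W₂.incl x) y
  · obtain ⟨x, y, h⟩ := exists_add_wander V.V₂.tilde V.V₁.tilde z.1 fun y => by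
      obtain ⟨x, rfl⟩ := (assoc P.E₁ P.E₂ H).surj y
      exact (Submodule.mem_orthogonal _ _).1 z.2 _ ⟨x, rfl⟩
    exact ⟨V.r₁.toRange x, y, Subtype.ext h⟩

end WanderingSubspaces

/-! ### Reading the symbols in `H` through the Wold unitary. -/

section Symbols

variable {A : Type u} [NonUnitalCStarAlgebra A] [PartialOrder A] [StarOrderedRing A]
  {P : ProductSystem A} {H : Corr.{u, 0, v} A ℂ} {V : IsoCovRep P H}

lemma IsoCovRep.r₁_comp_adj₁ (V : IsoCovRep P H) : V.r₁.comp V.adj₁ = V.L₁.incl :=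
  Hom.ext_apply fun x => congrArg Subtype.val (V.r₁.toRange.apply_symm_apply x)

lemma IsoCovRep.r₂_comp_adj₂ (V : IsoCovRep P H) : V.r₂.comp V.adj₂ = V.L₂.incl :=
  Hom.ext_apply fun x => congrArg Subtype.val (V.r₂.toRange.apply_symm_apply x)

lemma IsWold.apply_mem {U : Iso H V.model} (hU : IsWold V U) (w : V.W.corr) :
    U w.1 = vac P.E V.W.corr w :=
  congrArg (fun F : Hom _ _ => F w) hU.comp_incl

/-- `U` agrees with the vacuum embedding on `𝒲`, so `S̃` on `E ⊗ 𝒲` is `U Ṽ`. The free map `s`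
allows both `s = id` and `s = t_{2,1}`, as the two symbols require. -/
lemma IsWold.indSW_tmap {U : Iso H V.model} (hU : IsWold V U) (hV : V.IsPure)
    {Q : Corr.{u, u, u} A A} {Y : Corr.{u, 0, w} A ℂ} (s : Hom Q P.E) (k : Hom Y V.W.corr)
    (z : (Q ⊠ Y : Corr A ℂ)) :
    V.indSW (tmap s k z) = U (V.tilde (tmap s (V.W.incl.comp k) z)) := by
  refine Eq.trans ?_ (congrArg (fun F : Hom _ _ => F _) (hU.comp_tilde hV)).symm
  rw [IsoCovRep.indSW, Hom.comp_apply, Hom.comp_apply, tmap_tmap, tmap_tmap, ← hU.comp_incl]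
  rfl

/-- If `U` intertwines `T` and `M_Θ`, then `Θ̃` is the restriction of `U T̃` to the wandering
subspace. -/
lemma IsWold.symbol_tilde {U : Iso H V.model} (hU : IsWold V U) {X : Corr.{u, u, u} A A}
    {t : Iso (X ⊠ P.E) (P.E ⊠ X)} {Θ : IsoBimod X V.W.corr V.model}
    {M : IsoBimod X V.model V.model} {T : IsoBimod X H H} (h : IsMult t Θ M)
    (hi : ∀ ξ x, U (T.op ξ x) = M.op ξ (U x)) {Y : Corr.{u, 0, w} A ℂ} (k : Hom Y V.W.corr)
    (x : (X ⊠ Y : Corr A ℂ)) :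
    Θ.tilde (tmap (Hom.id X) k x) = U (T.tilde (tmap (Hom.id X) (V.W.incl.comp k) x)) := by
  have h1 : U.toHom.comp T.tilde = M.tilde.comp (tmap (Hom.id X) U.toHom) :=
    Hom.ext_tmul fun ξ y => by simp [hi]
  refine Eq.trans ?_ (congrArg (fun F : Hom _ _ => F _) h1).symm
  rw [h.tilde_eq, Hom.comp_apply, Hom.comp_apply, tmap_tmap, tmap_tmap, ← hU.comp_incl]
  rfl

end Symbols

end CStarCorr

theorem theorem2p3 {A : Type*} [NonUnitalCStarAlgebra A] [PartialOrder A] [StarOrderedRing A]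
    (P : ProductSystem A)
    {H : Type*} [NormedAddCommGroup H] [InnerProductSpace ℂ H] [CompleteSpace H]
    (σ : A →⋆ₙₐ[ℂ] (H →L[ℂ] H))
    (hσ : closure (Submodule.span ℂ {y | ∃ a x, y = σ a x} : Set H) = Set.univ)
    (V : IsoCovRep P (Corr.ofRep σ hσ)) (hV : V.IsPure) :
    -- the BCL-representation of `V` exists
    (∃ (M : IsoCovRep P V.model) (Θ₁ : IsoBimod P.E₁ V.W.corr V.model)
      (Θ₂ : IsoBimod P.E₂ V.W.corr V.model), IsBCL V M Θ₁ Θ₂) ∧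
    -- `𝒲 = Ṽ⁽²⁾(E₂ ⊗ 𝒲₁) ⊕ 𝒲₂ = Ṽ⁽¹⁾(E₁ ⊗ 𝒲₂) ⊕ 𝒲₁`, and correspondingly for `Eᵢ ⊗ 𝒲`
    IsOrthSum (InvSub.le V.L₂_le) (InvSub.le V.W₂_le) ∧
    IsOrthSum (InvSub.le V.L₁_le) (InvSub.le V.W₁_le) ∧
    IsOrthSum (tmap (Hom.id P.E₁) (InvSub.le V.L₂_le)) (tmap (Hom.id P.E₁) (InvSub.le V.W₂_le)) ∧
    IsOrthSum (tmap (Hom.id P.E₂) (InvSub.le V.L₁_le)) (tmap (Hom.id P.E₂) (InvSub.le V.W₁_le)) ∧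
    ∀ (M : IsoCovRep P V.model) (Θ₁ : IsoBimod P.E₁ V.W.corr V.model)
      (Θ₂ : IsoBimod P.E₂ V.W.corr V.model), IsBCL V M Θ₁ Θ₂ →
      M.IsPure ∧
      -- `Θ̃₁ = S̃ (I ⊗ Ṽ⁽²⁾*)` on `E₁ ⊗ Ṽ⁽²⁾(E₂ ⊗ 𝒲₁)`
      (∀ x : (P.E₁ ⊠ V.L₂.corr : Corr A ℂ),
        Θ₁.tilde (tmap (Hom.id P.E₁) (InvSub.le V.L₂_le) x) =
          V.indSW (tmap (Hom.id P.E) (InvSub.le V.W₁_le)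
            ((assoc P.E₁ P.E₂ V.W₁.corr).symm (tmap (Hom.id P.E₁) V.adj₂ x)))) ∧
      -- `Θ̃₁ = Ṽ⁽¹⁾` on `E₁ ⊗ 𝒲₂`, with values in `𝒲 ⊆ F(E) ⊗ 𝒲`
      (∀ x : (P.E₁ ⊠ V.W₂.corr : Corr A ℂ),
        Θ₁.tilde (tmap (Hom.id P.E₁) (InvSub.le V.W₂_le) x) =
          vac P.E V.W.corr (InvSub.le V.L₁_le (V.r₁.toRange x))) ∧
      -- `Θ̃₂ = S̃ (t_{2,1} ⊗ I) (I ⊗ Ṽ⁽¹⁾*)` on `E₂ ⊗ Ṽ⁽¹⁾(E₁ ⊗ 𝒲₂)`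
      (∀ x : (P.E₂ ⊠ V.L₁.corr : Corr A ℂ),
        Θ₂.tilde (tmap (Hom.id P.E₂) (InvSub.le V.L₁_le) x) =
          V.indSW (tmap P.t.toHom (InvSub.le V.W₂_le)
            ((assoc P.E₂ P.E₁ V.W₂.corr).symm (tmap (Hom.id P.E₂) V.adj₁ x)))) ∧
      -- `Θ̃₂ = Ṽ⁽²⁾` on `E₂ ⊗ 𝒲₁`, with values in `𝒲 ⊆ F(E) ⊗ 𝒲`
      (∀ x : (P.E₂ ⊠ V.W₁.corr : Corr A ℂ),
        Θ₂.tilde (tmap (Hom.id P.E₂) (InvSub.le V.W₁_le) x) =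
          vac P.E V.W.corr (InvSub.le V.L₂_le (V.r₂.toRange x))) := by
  refine ⟨exists_isBCL hV, isOrthSum_L₂_W₂ V, isOrthSum_L₁_W₁ V,
    (isOrthSum_L₂_W₂ V).tmap_id_left, (isOrthSum_L₁_W₁ V).tmap_id_left, ?_⟩
  -- `U` is the Wold unitary supplied by the given BCL-representation; the argument uses only its
  -- defining relations.
  rintro M Θ₁ Θ₂ ⟨hm₁, hm₂, U, hU, h₁, h₂⟩
  refine ⟨hV.of_intertwine h₁ h₂, fun x => ?_, fun x => ?_, fun x => ?_, fun x => ?_⟩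
  -- Both sides are `U` of a vector of `H`. These vectors agree because `Ṽ⁽²⁾ Ṽ⁽²⁾*` is the identity
  -- on `Ṽ⁽²⁾(E₂ ⊗ 𝒲₁)`, in the form `r₂_comp_adj₂`.
  · rw [hU.symbol_tilde hm₁ h₁]
    refine Eq.trans ?_ (hU.indSW_tmap hV _ _ _).symm
    refine congrArg (fun t => U t) (Eq.trans ?_ (V.tilde_tmap_assoc_symm V.W₁.incl _).symm)
    exact (congrArg (fun G => V.V₁.tilde (tmap (Hom.id P.E₁) G x)) V.r₂_comp_adj₂.symm).trans
      (congrArg (fun t => V.V₁.tilde t) (tmap_id_comp _ _ _))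
  -- The vector `Ṽ⁽¹⁾ x` already lies in `𝒲`, where `U` is the vacuum embedding.
  · rw [hU.symbol_tilde hm₁ h₁]
    exact hU.apply_mem (InvSub.le V.L₁_le (V.r₁.toRange x))
  · rw [hU.symbol_tilde hm₂ h₂]
    refine Eq.trans ?_ (hU.indSW_tmap hV _ _ _).symm
    refine congrArg (fun t => U t) (Eq.trans ?_ (V.tilde_tmap_t_assoc_symm V.W₂.incl _).symm)
    exact (congrArg (fun G => V.V₂.tilde (tmap (Hom.id P.E₂) G x)) V.r₁_comp_adj₁.symm).trans
      (congrArg (fun t => V.V₂.tilde t) (tmap_id_comp _ _ _))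
  · rw [hU.symbol_tilde hm₂ h₂]
    exact hU.apply_mem (InvSub.le V.L₂_le (V.r₂.toRange x))
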